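/- Let $C$ be a commutative ring with a ring automorphism $\sigma$, and let $\underline C$ be the local system of rings on the torus $T=\mathbf R^2/\mathbf Z^2$ pulled back along $(x,y)\mapsto x$ from the local system on $\mathbf R/\mathbf Z$ with étalé space $(\mathbf R\times C)/((x,c)\sim(x+1,\sigma(c)))$. Stalks are identified with $C$ through representatives $x\in[0,1)$, so that parallel transport applies $\sigma$ (resp. $\sigma^{-1}$) for each crossing of $x=0$ from right to left (resp. left to right). Let $L=L_{(0)}=\{y=0\}$ and $\varphi^s(x,y)=(x,y-s\cos 2\pi x)$. All curves $\varphi^sL$ are oriented from left to right; the base point (star) of $\varphi^sL$, $s\neq0$, is $(1/2,s)$ and that of $L$ is $(0,0)$. For $s>0$, $s\notin\mathbf Z$, let $\mathrm{CF}(\varphi^sL,L;\underline C)=\bigoplus_{x\in\varphi^sL\cap L}x\cdot C$, graded by the Maslov index. The intersection points are $z_i^{(s)}=(\tfrac1{2\pi}\arccos(i/s),0)$ (degree $0$) and $\xi_i^{(s)}=(1-\tfrac1{2\pi}\arccos(i/s),0)$ (degree $1$), for integers $|i|<s$. Polygon maps at Novikov parameter $t=1$ are signed counts of rigid polygons weighted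 by parallel transport along their sides $\gamma_0,\gamma_1,\dots$ (counterclockwise from the output corner $y$). Here polygons are taken up to reparametrization, and are the orientation-preserving immersed ones together with constant ones; rigid means that the degree of the output corner is the sum of the degrees of the input corners, plus $1$ for bigons. The sign is $(-1)^{\#\text{stars on the boundary}}$, times $(-1)^{|y|+|x_n|}$ if the last side, and $(-1)^{|x_k|}$ if the $k$-th side ($0<k<n$), is traversed against the orientation of its curve ($x_1,\dots,x_n$ are the input corners). The differential is $$\mu_1(x\cdot a)=\sum_y y\cdot\sum_{u\in\mathcal M(y,x)}\pm\nabla\gamma_1(a\,\nabla\gamma_0(1)).$$ For $s,s',s+s'\notin\mathbf Z$, the product of $p\cdot a\in\mathrm{CF}(\varphi^sL,L;\underline C)$ and $q\cdot b\in\mathrm{CF}(\varphi^{s'}L,L;\underline C)$ is $$\sum_y y\cdot\sum_{u\in\mathcal M(y,\varphi^sq,p)}\pm\nabla\gamma_2(a\,\nabla\gamma_1(b\,\nabla\gamma_0(1)))\in\mathrm{CF}(\varphi^{s+s'}L,L;\underline C),$$ the sides of the triangles lying on $\varphi^{s+s'}L$, $\varphi^sL$, $L$; in the two non-transverse cases it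 is set by convention to be $(\xi_0^{(s)}a,z_0^{(s')}b)\mapsto\xi_0^{(s+s')}ab$ and $(z_0^{(s)}a,\xi_0^{(s')}b)\mapsto\xi_0^{(s+s')}\sigma(a)b$. For $s<s'$ the continuation map $\mathrm{CF}(\varphi^sL,L;\underline C)\to\mathrm{CF}(\varphi^{s'}L,L;\underline C)$ is $z_i^{(s)}a\mapsto z_i^{(s')}a$, $\xi_i^{(s)}a\mapsto\xi_i^{(s')}a$ (the linear cascades limit), and $$\mathrm{CF}_{\mathrm{loud}}=\varinjlim_{s>0,\ s\notin\mathbf Z}\mathrm{CF}(\varphi^sL,L;\underline C).$$ Write $z_i\cdot a$, $\xi_i\cdot a$ for the images of $z^{(s)}_i\cdot a$, $\xi^{(s)}_i\cdot a$ in the limit. Then: 1. $\mathrm{CF}^0_{\mathrm{loud}}=\bigoplus_{i\in\mathbf Z}z_i\cdot C$ and $\mathrm{CF}^1_{\mathrm{loud}}=\bigoplus_{i\in\mathbf Z}\xi_i\cdot C$, and $\mathrm{CF}_{\mathrm{loud}}$ is their direct sum. The differentials $\mu_1$ induce a unique additive map $\mu_1$ on $\mathrm{CF}_{\mathrm{loud}}$,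 and $\mu_1(z_i\cdot a)=\xi_i\cdot(\sigma(a)-a)$, $\mu_1(\xi_i\cdot a)=0$. 2. For every irrational $e>0$, the products $\mathrm{CF}(\varphi^sL,L;\underline C)\times\mathrm{CF}(\varphi^{es}L,L;\underline C)\to\mathrm{CF}(\varphi^{s+es}L,L;\underline C)$ (for all $s>0$ such that $s,es,s+es\notin\mathbf Z$) induce a unique biadditive multiplication on $\mathrm{CF}_{\mathrm{loud}}$. It is given by $(z_i a)(z_j b)=z_{i+j}ab$; $(\xi_i a)(z_j b)=\xi_{i+j}a\sigma(b)$ and $(z_i a)(\xi_j b)=\xi_{i+j}ab$ if $j/e<i$; $(\xi_i a)(z_j b)=\xi_{i+j}ab$ and $(z_i a)(\xi_j b)=\xi_{i+j}\sigma(a)b$ if $j/e\ge i$; and $(\xi_ia)(\xi_jb)=0$. It satisfies the Leibniz rule $\mu_1(ww')=\mu_1(w)w'+w\mu_1(w')$. If $\sigma\neq\mathrm{id}$ it is not associative, and distinct $e$ give distinct multiplications. 3. The induced product on $\mathrm{HF}^0_{\mathrm{loud}}=\ker(\mu_1)\cap\mathrm{CF}^0_{\mathrm{loud}}$ is associative and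 independent of $e$, and so is the induced product on the total cohomology $\ker\mu_1/\operatorname{im}\mu_1$. The map $\sum_i c_iz^i\mapsto\sum_i z_i\cdot c_i$ is an isomorphism of rings $C^\sigma[z,z^{-1}]\cong\mathrm{HF}^0_{\mathrm{loud}}$, where $C^\sigma=\{c\in C:\sigma(c)=c\}$. -/

import Mathlib

noncomputable section

namespace LoudFloer

open Metric

/-! ### The torus, the Hamiltonian flow and the Lagrangians -/

/-- The torus `T = ℝ² / ℤ²`. -/
abbrev Torus : Type := UnitAddCircle × UnitAddCircle

/-- The universal covering `ℝ² → T`; the plane is written as `ℂ`, `w = x + i y`. -/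
def proj (w : ℂ) : Torus := ((w.re : UnitAddCircle), (w.im : UnitAddCircle))

/-- The function `x ↦ cos (2 π x)` on `ℝ / ℤ`. -/
def cosT (x : UnitAddCircle) : ℝ := ((AddCircle.toCircle x : Circle) : ℂ).re

/-- The function `x ↦ sin (2 π x)` on `ℝ / ℤ`. -/
def sinT (x : UnitAddCircle) : ℝ := ((AddCircle.toCircle x : Circle) : ℂ).im

theorem cosT_coe (x : ℝ) : cosT (x : UnitAddCircle) = Real.cos (2 * Real.pi * x) := by
  rw [cosT, AddCircle.toCircle_apply_mk, Circle.coe_exp, Complex.exp_ofReal_mul_I_re, div_one]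

theorem sinT_coe (x : ℝ) : sinT (x : UnitAddCircle) = Real.sin (2 * Real.pi * x) := by
  rw [sinT, AddCircle.toCircle_apply_mk, Circle.coe_exp, Complex.exp_ofReal_mul_I_im, div_one]

/-- The flow `φ^s (x, y) = (x, y - s cos (2 π x))` of the Hamiltonian `sin (2 π x)`. -/
def phi (s : ℝ) (p : Torus) : Torus := (p.1, p.2 - ((s * cosT p.1 : ℝ) : UnitAddCircle))

theorem phi_phi (s s' : ℝ) (p : Torus) : phi s (phi s' p) = phi (s + s') p := by
  ext
  · rfl
  · simp only [phi, add_mul, AddCircle.coe_add]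
    abel

/-- The horizontal circle `L_(0)`, oriented from left to right. -/
def L0 : Set Torus := {p | p.2 = 0}

/-- The Lagrangian `φ^s L_(0)`, oriented from left to right; `φ^0 L_(0) = L_(0)`. -/
def Lag (s : ℝ) : Set Torus := phi s '' L0

theorem mem_Lag {s : ℝ} {p : Torus} :
    p ∈ Lag s ↔ p.2 = -((s * cosT p.1 : ℝ) : UnitAddCircle) := by
  constructor
  · rintro ⟨q, hq, rfl⟩
    have hq' : q.2 = 0 := hq
    simp [phi, hq']
  · intro h
    refine ⟨(p.1, 0), rfl, ?_⟩
    ext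
    · rfl
    · simp [phi, h]

/-- The base point (star) of `φ^s L_(0)`: the point `φ^s (1/2, 0) = (1/2, s)` for `s ≠ 0`, and the
point `(0, 0)` for `L_(0)` itself. -/
def starPt (s : ℝ) : Torus :=
  if s = 0 then proj 0 else phi s (((1 / 2 : ℝ) : UnitAddCircle), 0)

/-! ### Intersection points and Floer cochains -/

/-- The intersection points of `φ^a L_(0)` and `φ^b L_(0)`. -/
abbrev InterPt (a b : ℝ) : Type := {p : Torus // p ∈ Lag a ∧ p ∈ Lag b}

/-- The Maslov index of an intersection point of `φ^a L_(0)` and `φ^b L_(0)`: `0` when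
the slope `2 π a sin (2 π x)` of the first curve exceeds the slope of the second, and `1` when it is
smaller. -/
def mas (a b : ℝ) (p : Torus) : ℕ := if 0 < (a - b) * sinT p.1 then 0 else 1

/-- Floer cochains `CF(φ^a L_(0), φ^b L_(0); C)`: one copy of `C` for each intersection
point `x`, the stalk at `x` of the local system being identified with `C` by means of the
representative in `[0, 1)` of the first coordinate of `x`. -/
abbrev CF (C : Type*) [CommRing C] (a b : ℝ) : Type _ := InterPt a b →₀ C

/-- The cochains of Maslov degree `k`. -/
def cfDeg (C : Type*) [CommRing C] (a b : ℝ) (k : ℕ) : AddSubgroup (CF C a b) :=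
  (Finsupp.supported C C {p : InterPt a b | mas a b p.1 = k}).toAddSubgroup

/-! ### Polygons

Polygons are parametrized by the closed unit disc with its `N` marked points at the `N`-th roots
of unity. On a surface the rigid holomorphic polygons, modulo conformal
reparametrization, are the orientation-preserving immersed polygons (together with
constant ones at multiple intersections), modulo reparametrization by homeomorphisms of the disc,
the conformal structure being pulled back from the target and uniformized. -/

/-- The `k`-th marked point of the disc. -/
def corner (N k : ℕ) : ℂ :=
  Complex.exp (2 * Real.pi * Complex.I * ((k : ℝ) / (N : ℝ) : ℝ))

/-- The counterclockwise closed arc of the unit circle from the `k`-th to the `(k+1)`-st marked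
point. -/
def arc (N k : ℕ) : Set ℂ :=
  (fun θ : ℝ => Complex.exp (2 * Real.pi * Complex.I * (θ : ℂ))) ''
    Set.Icc ((k : ℝ) / (N : ℝ)) (((k : ℝ) + 1) / (N : ℝ))

/-- A `1`-periodic loop `γ` in `ℂ` avoids `0` and has winding number `1` about it. -/
def WindsOnce (γ : ℝ → ℂ) : Prop :=
  (∀ t, γ t ≠ 0) ∧
    ∃ g : ℝ → ℝ, Continuous g ∧ (∀ t, g (t + 1) = g t + 1) ∧
      ∀ t, γ t = (‖γ t‖ : ℂ) * Complex.exp (2 * Real.pi * Complex.I * (g t : ℂ))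

/-- `f` is injective near the interior point `ζ` of the disc, with local degree `1`. -/
def LocalDegreeOne (f : ℂ → ℂ) (ζ : ℂ) : Prop :=
  ∃ r : ℝ, 0 < r ∧ closedBall ζ r ⊆ ball 0 1 ∧ Set.InjOn f (closedBall ζ r) ∧
    WindsOnce fun t : ℝ =>
      f (ζ + (r : ℂ) * Complex.exp (2 * Real.pi * Complex.I * (t : ℂ))) - f ζ

/-- `f` is a (topological) orientation-preserving immersion of the closed unit disc in the plane,
up to the boundary: it is locally injective, with local degree `1` at interior points. -/
def IsImmersedDisc (f : ℂ → ℂ) : Prop :=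
  (∀ ζ ∈ closedBall (0 : ℂ) 1, ∃ U ∈ nhds ζ, Set.InjOn f (U ∩ closedBall 0 1)) ∧
    ∀ ζ ∈ ball (0 : ℂ) 1, LocalDegreeOne f ζ

/-- A polygon `u` in the torus, with sides on `L_k = φ^{a k} L_(0)` and corners `x k`: the
counterclockwise arc from the `k`-th to the `(k+1)`-st marked point is mapped to `L_k`.
The map `u : D → T` is recorded through a lift `D → ℝ²` (it always has one, as `D` is simply
connected); only the restriction of `lift` to the closed disc matters. -/
structure Polygon {N : ℕ} (a : Fin N → ℝ) (x : Fin N → Torus) where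
  lift : ℂ → ℂ
  continuousOn_lift : ContinuousOn lift (closedBall 0 1)
  map_corner : ∀ k : Fin N, proj (lift (corner N k)) = x k
  map_side : ∀ k : Fin N, ∀ ζ ∈ arc N k, proj (lift ζ) ∈ Lag (a k)
  constant_or_immersed :
    (∃ c : ℂ, ∀ ζ ∈ closedBall (0 : ℂ) 1, lift ζ = c) ∨ IsImmersedDisc lift

/-- The closed unit disc. -/
abbrev Disc : Type := closedBall (0 : ℂ) 1

/-- Two polygons in the torus are identified when they differ by a homeomorphism of the disc which
preserves each marked point and each side. (Lifts that differ by `ℤ²` are identified, too.) -/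
instance polygonSetoid {N : ℕ} (a : Fin N → ℝ) (x : Fin N → Torus) : Setoid (Polygon a x) where
  r u v := ∃ φ : Disc ≃ₜ Disc,
    (∀ k : Fin N, ∀ ζ : Disc, (ζ : ℂ) = corner N k ↔ (φ ζ : ℂ) = corner N k) ∧
    (∀ k : Fin N, ∀ ζ : Disc, (ζ : ℂ) ∈ arc N k ↔ (φ ζ : ℂ) ∈ arc N k) ∧
    ∀ ζ : Disc, proj (v.lift (φ ζ)) = proj (u.lift ζ)
  iseqv :=
    { refl := fun _ => ⟨Homeomorph.refl _, fun _ _ => Iff.rfl, fun _ _ => Iff.rfl, fun _ => rfl⟩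
      symm := by
        rintro u v ⟨φ, h1, h2, h3⟩
        refine ⟨φ.symm, fun k ζ => ?_, fun k ζ => ?_, fun ζ => ?_⟩
        · simpa using (h1 k (φ.symm ζ)).symm
        · simpa using (h2 k (φ.symm ζ)).symm
        · simpa using (h3 (φ.symm ζ)).symm
      trans := by
        rintro u v w ⟨φ, h1, h2, h3⟩ ⟨ψ, k1, k2, k3⟩
        refine ⟨φ.trans ψ, fun k ζ => (h1 k ζ).trans (k1 k (φ ζ)),
          fun k ζ => (h2 k ζ).trans (k2 k (φ ζ)), fun ζ => ?_⟩
        exact (k3 (φ ζ)).trans (h3 ζ) }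

/-- The set `M(x 0, …, x n)` of polygons modulo reparametrization. -/
abbrev Moduli {N : ℕ} (a : Fin N → ℝ) (x : Fin N → Torus) : Type :=
  Quotient (polygonSetoid a x)

namespace Polygon

variable {N : ℕ} {a : Fin N → ℝ} {x : Fin N → Torus}

/-- The first coordinate of the `k`-th corner in the universal cover (the `N`-th corner is
the `0`-th one). -/
def cornerX (u : Polygon a x) (k : ℕ) : ℝ := (u.lift (corner N k)).re

/-- The number of stars on the boundary of `u`. -/
def numStars (u : Polygon a x) : ℕ :=
  ∑ k : Fin N, Set.ncard {ζ : ℂ | ζ ∈ arc N k ∧ proj (u.lift ζ) = starPt (a k)}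

/-- The counterclockwise boundary orientation of the `k`-th side is opposite to the orientation
of `L_k`. -/
def Backward (u : Polygon a x) (k : ℕ) : Prop := u.cornerX (k + 1) < u.cornerX k

/-- Parallel transport along the `k`-th side, in the local system pulled back from
`(ℝ × C) / ((x, c) ∼ (x + 1, σ c))` along the first projection of the torus: with the stalks
identified with `C` through representatives in `[0, 1)`, one applies `σ` for every
crossing of the line `x = 0` from right to left, and `σ⁻¹` for every crossing from left to right. -/
def nabla {C : Type*} [CommRing C] (σ : C ≃+* C) (u : Polygon a x) (k : ℕ) : C ≃+* C :=
  σ ^ (⌊u.cornerX k⌋ - ⌊u.cornerX (k + 1)⌋)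

end Polygon

open Classical in
/-- The sign of a bigon with corners `y` (output) and `x` (input), with sides on
`L_0 = φ^a L_(0)` and `L_1 = φ^b L_(0)`. -/
def bigonSign {a b : ℝ} {y x : Torus} (u : Polygon ![a, b] ![y, x]) : ℤ :=
  (-1) ^ u.numStars * (if u.Backward 1 then (-1) ^ (mas a b y + mas a b x) else 1)

open Classical in
/-- The sign of a triangle with corners `y` (output), `x₁ ∈ L_0 ∩ L_1` and `x₂ ∈ L_1 ∩ L_2`. -/
def triangleSign {a₀ a₁ a₂ : ℝ} {y x₁ x₂ : Torus}
    (u : Polygon ![a₀, a₁, a₂] ![y, x₁, x₂]) : ℤ :=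
  (-1) ^ u.numStars * (if u.Backward 1 then (-1) ^ mas a₀ a₁ x₁ else 1) *
    (if u.Backward 2 then (-1) ^ (mas a₀ a₂ y + mas a₁ a₂ x₂) else 1)

section Cochains

variable {C : Type*} [CommRing C] (σ : C ≃+* C)

/-- The differential of `CF(φ^a L_(0), φ^b L_(0); C)`:
`x · c ↦ ∑_y y · ∑_u ± ∇γ₁ (c ∇γ₀ 1)`, the sum over the rigid bigons `u` in `M(y, x)`, which are
those for which the Maslov index of `y` is one more than that of `x`. -/
def mu1 (a b : ℝ) (w : CF C a b) : CF C a b :=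
  w.sum fun x c =>
    ∑ᶠ (y : InterPt a b) (_ : mas a b y.1 = mas a b x.1 + 1),
      Finsupp.single y (∑ᶠ u : Moduli ![a, b] ![y.1, x.1],
        bigonSign u.out • u.out.nabla σ 1 (c * u.out.nabla σ 0 1))

/-- The triangle product of `x₂ · c₂` and `x₁ · c₁` for the Lagrangians `L_k = φ^{a_k} L_(0)`:
`∑_y y · ∑_u ± ∇γ₂ (c₂ ∇γ₁ (c₁ ∇γ₀ 1))`, the sum over the rigid triangles `u` in `M(y, x₁, x₂)`,
which are those for which the Maslov index of `y` is the sum of those of `x₁` and `x₂`. -/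
def triangleSum (a₀ a₁ a₂ : ℝ) (x₂ : InterPt a₁ a₂) (c₂ : C) (x₁ : InterPt a₀ a₁) (c₁ : C) :
    CF C a₀ a₂ :=
  ∑ᶠ (y : InterPt a₀ a₂) (_ : mas a₀ a₂ y.1 = mas a₀ a₁ x₁.1 + mas a₁ a₂ x₂.1),
    Finsupp.single y (∑ᶠ u : Moduli ![a₀, a₁, a₂] ![y.1, x₁.1, x₂.1],
      triangleSign u.out •
        u.out.nabla σ 2 (c₂ * u.out.nabla σ 1 (c₁ * u.out.nabla σ 0 1)))

end Cochains

/-! ### The intersection points of `φ^s L_(0)` and `L_(0)` -/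

theorem mem_Lag_of_cos {s x : ℝ} {i : ℤ} (h : s * Real.cos (2 * Real.pi * x) = i) :
    (((x : UnitAddCircle), 0) : Torus) ∈ Lag s ∧ (((x : UnitAddCircle), 0) : Torus) ∈ Lag 0 := by
  refine ⟨mem_Lag.2 ?_, mem_Lag.2 (by simp)⟩
  have h0 : ((i : ℝ) : UnitAddCircle) = 0 := (AddCircle.coe_eq_zero_iff 1).2 ⟨i, by simp⟩
  simp [cosT_coe, h, h0]

theorem mul_cos_arccos {s : ℝ} {i : ℤ} (h : |(i : ℝ)| ≤ s) :
    s * Real.cos (2 * Real.pi * (Real.arccos (i / s) / (2 * Real.pi))) = i := by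
  have hs : 0 ≤ s := (abs_nonneg _).trans h
  have hpi : 2 * Real.pi ≠ 0 := by positivity
  rw [mul_div_cancel₀ _ hpi]
  rcases hs.eq_or_lt with rfl | hs
  · have : (i : ℝ) = 0 := abs_nonpos_iff.1 h
    simp [this]
  · obtain ⟨h1, h2⟩ := abs_le.1 h
    rw [Real.cos_arccos (by rw [le_div_iff₀ hs]; linarith) (by rw [div_le_iff₀ hs]; linarith)]
    field_simp

theorem mul_cos_one_sub_arccos {s : ℝ} {i : ℤ} (h : |(i : ℝ)| ≤ s) :
    s * Real.cos (2 * Real.pi * (1 - Real.arccos (i / s) / (2 * Real.pi))) = i := by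
  rw [mul_sub, mul_one, Real.cos_two_pi_sub, mul_cos_arccos h]

/-- The point `z_i^{(s)}`, with first coordinate `arccos (i / s) / (2 π)`. -/
def zPt (s : ℝ) (i : ℤ) (h : |(i : ℝ)| ≤ s) : InterPt s 0 :=
  ⟨(((Real.arccos (i / s) / (2 * Real.pi) : ℝ) : UnitAddCircle), 0),
    mem_Lag_of_cos (mul_cos_arccos h)⟩

/-- The point `ξ_i^{(s)}`, with first coordinate `1 - arccos (i / s) / (2 π)`. -/
def xiPt (s : ℝ) (i : ℤ) (h : |(i : ℝ)| ≤ s) : InterPt s 0 :=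
  ⟨(((1 - Real.arccos (i / s) / (2 * Real.pi) : ℝ) : UnitAddCircle), 0),
    mem_Lag_of_cos (mul_cos_one_sub_arccos h)⟩

/-- The integer `i` with `i = s cos (2 π x)` attached to an intersection point. -/
def label {s : ℝ} (p : InterPt s 0) : ℤ := round (s * cosT p.1.1)

theorem label_eq {s : ℝ} (p : InterPt s 0) : (label p : ℝ) = s * cosT p.1.1 := by
  have h1 := mem_Lag.1 p.2.1
  have h2 := mem_Lag.1 p.2.2
  have h3 : ((s * cosT p.1.1 : ℝ) : UnitAddCircle) = 0 := by
    rw [h2] at h1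
    simpa using h1.symm
  obtain ⟨n, hn⟩ := (AddCircle.coe_eq_zero_iff 1).1 h3
  have hn' : s * cosT p.1.1 = n := by simpa using hn.symm
  simp [label, hn']

theorem abs_label_le {s : ℝ} (hs : 0 ≤ s) (p : InterPt s 0) : |(label p : ℝ)| ≤ s := by
  have h : |cosT p.1.1| ≤ 1 := by
    have := Complex.abs_re_le_norm ((AddCircle.toCircle p.1.1 : Circle) : ℂ)
    rwa [Circle.norm_coe] at this
  rw [label_eq, abs_mul, abs_of_nonneg hs]
  exact mul_le_of_le_one_right hs h

open Classical in
/-- The intersection point on `φ^{s'} L_(0) ∩ L_(0)` with the same name `z_i` or `ξ_i` as `p`. -/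
def move {s s' : ℝ} (hs : 0 ≤ s) (h : s ≤ s') (p : InterPt s 0) : InterPt s' 0 :=
  if 0 < sinT p.1.1 then zPt s' (label p) ((abs_label_le hs p).trans h)
  else xiPt s' (label p) ((abs_label_le hs p).trans h)

/-! ### Loud Floer cochains -/

/-- The index set of the direct limit: the positive real numbers which are not integers. -/
abbrev LoudIdx : Type := {s : ℝ // 0 < s ∧ ∀ n : ℤ, (n : ℝ) ≠ s}

section Loud

variable (C : Type*) [CommRing C]

/-- The continuation map `CF(φ^s L_(0), L_(0); C) → CF(φ^{s'} L_(0), L_(0); C)` in the linear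
cascades limit, for `s ≤ s'`: it carries `z_i^{(s)} · a` to `z_i^{(s')} · a` and `ξ_i^{(s)} · a` to
`ξ_i^{(s')} · a`. -/
def continuation (s s' : LoudIdx) (h : s ≤ s') : CF C s.1 0 →+ CF C s'.1 0 :=
  Finsupp.mapDomain.addMonoidHom (move s.2.1.le h)

open Classical in
/-- The loud Floer cochains, the direct limit of `CF(φ^s L_(0), L_(0); C)` along the
continuation maps. -/
abbrev CFloud : Type _ :=
  AddCommGroup.DirectLimit (fun s : LoudIdx => CF C s.1 0) (continuation C)

open Classical in
/-- The canonical map of `CF(φ^s L_(0), L_(0); C)` to the direct limit. -/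
def toLoud (s : LoudIdx) : CF C s.1 0 →+ CFloud C :=
  AddCommGroup.DirectLimit.of (fun s : LoudIdx => CF C s.1 0) (continuation C) s

/-- The degree `k` part of the loud Floer cochains. -/
def loudDeg (k : ℕ) : AddSubgroup (CFloud C) :=
  ⨆ s : LoudIdx, (cfDeg C s.1 0 k).map (toLoud C s)

/-- An index `s > |i|`. -/
def bigIdx (i : ℤ) : LoudIdx :=
  ⟨|(i : ℝ)| + 1 / 2, by positivity, fun n hn => by
    have h : (2 * n : ℤ) = 2 * |i| + 1 := by
      have : (2 : ℝ) * n = 2 * |(i : ℝ)| + 1 := by rw [hn]; ring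
      exact_mod_cast this
    omega⟩

theorem abs_le_bigIdx (i : ℤ) : |(i : ℝ)| ≤ (bigIdx i).1 := by
  simp [bigIdx]

/-- The element `z_i · a` of the direct limit. -/
def zLoud (i : ℤ) (a : C) : CFloud C :=
  toLoud C (bigIdx i) (Finsupp.single (zPt _ i (abs_le_bigIdx i)) a)

/-- The element `ξ_i · a` of the direct limit. -/
def xiLoud (i : ℤ) (a : C) : CFloud C :=
  toLoud C (bigIdx i) (Finsupp.single (xiPt _ i (abs_le_bigIdx i)) a)

end Loud

section Product

variable {C : Type*} [CommRing C] (σ : C ≃+* C)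

/-- The map `φ^s` from `φ^{s'} L_(0) ∩ L_(0)` to `φ^{s+s'} L_(0) ∩ φ^s L_(0)`. -/
def shift (s s' : ℝ) (q : InterPt s' 0) : InterPt (s + s') s :=
  ⟨phi s q.1, by
    obtain ⟨⟨r, hr, h⟩, ⟨r', hr', h'⟩⟩ := q.2
    refine ⟨⟨r, hr, ?_⟩, ⟨r', hr', ?_⟩⟩
    · rw [← h, phi_phi]
    · rw [← h', phi_phi, add_zero]⟩

open Classical in
/-- The product of `p · a ∈ CF(φ^s L_(0), L_(0); C)` and `q · b ∈ CF(φ^{s'} L_(0), L_(0); C)`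
in `CF(φ^{s+s'} L_(0), L_(0); C)`: the triangle sum of `p · a` and of `φ^s q · b`, except in the
two cases `(ξ_0, z_0)` and `(z_0, ξ_0)`, where the moduli space is not transversely cut and
the product is fixed by convention. Here `z_0 = (1/4, 0)` and `ξ_0 = (3/4, 0)`. -/
def prodBasis (s s' : LoudIdx) (p : InterPt s.1 0) (a : C) (q : InterPt s'.1 0) (b : C) :
    CF C (s.1 + s'.1) 0 :=
  if p.1.1 = ((3 / 4 : ℝ) : UnitAddCircle) ∧ q.1.1 = ((1 / 4 : ℝ) : UnitAddCircle) then
    Finsupp.single (xiPt (s.1 + s'.1) 0 (by simpa using (add_pos s.2.1 s'.2.1).le)) (a * b)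
  else if p.1.1 = ((1 / 4 : ℝ) : UnitAddCircle) ∧ q.1.1 = ((3 / 4 : ℝ) : UnitAddCircle) then
    Finsupp.single (xiPt (s.1 + s'.1) 0 (by simpa using (add_pos s.2.1 s'.2.1).le)) (σ a * b)
  else triangleSum σ (s.1 + s'.1) s.1 0 p a (shift s.1 s'.1 q) b

/-- The triangle product
`CF(φ^s L_(0), L_(0); C) × CF(φ^{s'} L_(0), L_(0); C) → CF(φ^{s+s'} L_(0), L_(0); C)`. -/
def triangleProd (s s' : LoudIdx) (w : CF C s.1 0) (w' : CF C s'.1 0) : CF C (s.1 + s'.1) 0 :=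
  w.sum fun p a => w'.sum fun q b => prodBasis σ s s' p a q b

/-- `d` is the additive map of the direct limit induced by the differentials `μ₁`. -/
def IsLoudDifferential (d : CFloud C →+ CFloud C) : Prop :=
  ∀ (s : LoudIdx) (w : CF C s.1 0), d (toLoud C s w) = toLoud C s (mu1 σ s.1 0 w)

/-- `m` is the biadditive map on the direct limit induced by the triangle products of
`CF(φ^s L_(0), L_(0); C)` and `CF(φ^{e s} L_(0), L_(0); C)`, for all `s` for which none of
`s`, `e s`, `s + e s` is an integer. -/
def IsLoudProduct (e : ℝ) (m : CFloud C →+ CFloud C →+ CFloud C) : Prop :=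
  ∀ (s s' : LoudIdx), s'.1 = e * s.1 →
    ∀ (hsum : 0 < s.1 + s'.1 ∧ ∀ n : ℤ, (n : ℝ) ≠ s.1 + s'.1)
      (w : CF C s.1 0) (w' : CF C s'.1 0),
      m (toLoud C s w) (toLoud C s' w') = toLoud C ⟨s.1 + s'.1, hsum⟩ (triangleProd σ s s' w w')

/-- The subring `C^σ` of elements fixed by `σ`. -/
def fixedSubring : Subring C := (σ : C →+* C).eqLocus (RingHom.id C)

/-- `HF^0_loud`, for the differential `d`: the cocycles of degree `0`. -/
def HF0 (d : CFloud C →+ CFloud C) : AddSubgroup (CFloud C) := d.ker ⊓ loudDeg C 0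

end Product

end LoudFloer

end

noncomputable section

namespace LoudFloer

open Metric Set Filter Topology

/-! ### Winding numbers -/

/-! Counting polygons is a problem in the plane. Along a side of a lifted polygon the imaginary part
is `n - a * cs x` with a constant integer `n`, so every side lies on a graph over the `x`-axis. A
locally injective map into a graph has a strictly monotone abscissa (`Sides.injOn_side`). Hence the
boundary of an immersed bigon runs along one graph to the right and returns along another; for a
triangle, the two sides at the corner with the middle abscissa are glued into one graph. This
situation is `GraphBoundary`.

For such a disc everything is forced. Immersions are open in the interior
(`IsImmersedDisc.nhds_le_map`, by winding numbers), so a maximum principle puts the interior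
strictly between the graphs. The pairs of distinct points with equal image then form a compact set
whose projection is open in the plane, so there are none and the map is injective. The local degree
makes the graph traversed to the right the lower one, and connectedness makes the image the whole
region between the graphs. Two polygons whose corners differ by a common integer translation
therefore differ by a homeomorphism of the disc (`Polygon.equiv_of_sides`). Conversely, the explicit
map `fill`, preceded by an automorphism of the disc that places the marked points, realizes every
admissible region. The moduli spaces become sets of corner abscissae subject to inequalities for the
cosine: `sides_bigon_iff` and `sides_triangle_iff`.

The inequalities are then solved. From `z_i` to `ξ_i` there are two bigons, one over an interval
around `0`, whose transport is `σ`, and one over an interval around `1/2`, with trivial transport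
and the opposite sign. Labels add up in triangles, so a product of generators has one possible
output, and one triangle contributes to it. When one input is a `z` and the other a `ξ`, that
triangle lies around `0` or around `1/2` according to the order of the angles `ang s i` and `ang s'
j`, that is, to whether `j / e < i` when `s' = e * s`. Irrationality of `e` leaves `i = j = 0` as
the only tie; for a `z` and a `ξ` it is settled by convention, and for two `z` by a constant
triangle.

Continuation maps preserve the names of the points, so the limit is free on the `z_i` and `ξ_i`
(`loudEquiv`), and the maps on it are given by the formulas for generators. The rest is algebra. The
Leibniz rule telescopes in both branches of the product. The branches differ only by whether `σ` is
applied to the coefficient of a `z`; cocycles have `σ`-fixed coefficients there, so on them the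
product is that of Laurent polynomials, extended by the `ξ` part, and does not depend on `e`. -/

/-- The parametrization `t ↦ exp (2 π i t)` of the unit circle. -/
def circ (t : ℝ) : ℂ := Complex.exp (2 * Real.pi * Complex.I * (t : ℂ))

@[fun_prop]
theorem continuous_circ : Continuous circ := by
  unfold circ
  fun_prop

theorem circ_eq (t : ℝ) : circ t = Complex.exp ((2 * Real.pi * t : ℝ) * Complex.I) := by
  rw [circ]
  congr 1
  push_cast
  ring

@[simp]
theorem norm_circ (t : ℝ) : ‖circ t‖ = 1 := by
  rw [circ_eq, Complex.norm_exp_ofReal_mul_I]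

theorem circ_add (s t : ℝ) : circ (s + t) = circ s * circ t := by
  simp only [circ, ← Complex.exp_add]
  congr 1
  push_cast
  ring

theorem circ_int (n : ℤ) : circ n = 1 := by
  rw [circ, Complex.exp_eq_one_iff]
  exact ⟨n, by push_cast; ring⟩

@[simp]
theorem circ_zero : circ 0 = 1 := by simpa using circ_int 0

@[simp]
theorem circ_add_one (t : ℝ) : circ (t + 1) = circ t := by
  rw [circ_add, show (1 : ℝ) = ((1 : ℤ) : ℝ) by simp, circ_int, mul_one]

theorem circ_ne_zero (t : ℝ) : circ t ≠ 0 := Complex.exp_ne_zero _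

theorem circ_re (t : ℝ) : (circ t).re = Real.cos (2 * Real.pi * t) := by
  rw [circ_eq, Complex.exp_ofReal_mul_I_re]

theorem circ_im (t : ℝ) : (circ t).im = Real.sin (2 * Real.pi * t) := by
  rw [circ_eq, Complex.exp_ofReal_mul_I_im]

theorem circ_eq_circ {s t : ℝ} : circ s = circ t ↔ ∃ n : ℤ, s = t + n := by
  rw [circ, circ, Complex.exp_eq_exp_iff_exists_int]
  have h0 : (2 * Real.pi * Complex.I : ℂ) ≠ 0 := Complex.two_pi_I_ne_zero
  refine exists_congr fun n => ?_
  constructor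
  · intro h
    have h1 : (2 * Real.pi * Complex.I : ℂ) * s = (2 * Real.pi * Complex.I) * ((t + n : ℝ) : ℂ) := by
      rw [h]; push_cast; ring
    exact_mod_cast mul_left_cancel₀ h0 h1
  · rintro rfl
    push_cast
    ring

theorem exists_circ_eq {z : ℂ} (hz : ‖z‖ = 1) (a : ℝ) : ∃ t ∈ Ico a (a + 1), circ t = z := by
  obtain ⟨t, ht⟩ : ∃ t, circ t = z := by
    refine ⟨Complex.arg z / (2 * Real.pi), ?_⟩
    rw [circ_eq, mul_div_cancel₀ _ (by positivity)]
    have := Complex.norm_mul_exp_arg_mul_I z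
    rw [hz] at this
    simpa using this
  refine ⟨toIcoMod one_pos a t, toIcoMod_mem_Ico one_pos a t, ?_⟩
  rw [← ht, circ_eq_circ]
  refine ⟨-toIcoDiv one_pos a t, ?_⟩
  rw [toIcoMod]
  simp [sub_eq_add_neg]

theorem circ_mem_closedBall (t : ℝ) : circ t ∈ closedBall (0 : ℂ) 1 := by simp

/-- A continuous integer valued function is constant on preconnected sets. -/
theorem _root_.IsPreconnected.eq_of_int_valued {X : Type*} [TopologicalSpace X] {S : Set X}
    (hS : IsPreconnected S) {f : X → ℝ} (hf : ContinuousOn f S)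
    (hn : ∀ x ∈ S, ∃ n : ℤ, f x = n) {x y : X} (hx : x ∈ S) (hy : y ∈ S) : f x = f y := by
  have hd : DiscreteTopology (range ((↑) : ℤ → ℝ)) :=
    (Int.isClosedEmbedding_coe_real.toHomeomorph).symm.isInducing.isEmbedding.discreteTopology
  refine hS.constant_of_mapsTo (T := range ((↑) : ℤ → ℝ)) ⟨hd⟩ hf ?_ hx hy
  intro z hz
  obtain ⟨n, hn⟩ := hn z hz
  exact ⟨n, hn.symm⟩

/-- The loop `γ` winds `n` times about `0`. -/
def Winds (γ : ℝ → ℂ) (n : ℤ) : Prop :=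
  ∃ L : ℝ → ℂ, Continuous L ∧ (∀ t, Complex.exp (L t) = γ t) ∧
    ∀ t, L (t + 1) = L t + 2 * Real.pi * Complex.I * n

theorem Winds.ne_zero {γ : ℝ → ℂ} {n : ℤ} (h : Winds γ n) (t : ℝ) : γ t ≠ 0 := by
  obtain ⟨L, -, h, -⟩ := h
  rw [← h]
  exact Complex.exp_ne_zero _

theorem Winds.continuous {γ : ℝ → ℂ} {n : ℤ} (h : Winds γ n) : Continuous γ := by
  obtain ⟨L, hL, h, -⟩ := h
  rw [← funext h]
  fun_prop

theorem Winds.periodic {γ : ℝ → ℂ} {n : ℤ} (h : Winds γ n) (t : ℝ) : γ (t + 1) = γ t := by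
  obtain ⟨L, -, h, h1⟩ := h
  rw [← h, ← h, h1, Complex.exp_eq_exp_iff_exists_int]
  exact ⟨n, by ring⟩

/-- Two continuous logarithms of the same loop differ by `2 π i` times a continuous integer valued
function, hence by a constant; comparing the increments over one period gives the claim. -/
theorem Winds.unique {γ : ℝ → ℂ} {n m : ℤ} (h : Winds γ n) (h' : Winds γ m) : n = m := by
  obtain ⟨L, hL, h1, h2⟩ := h
  obtain ⟨M, hM, h1', h2'⟩ := h'
  have hpi : (2 * Real.pi : ℝ) ≠ 0 := by positivity
  have key : ((L 1).im - (M 1).im) / (2 * Real.pi) = ((L 0).im - (M 0).im) / (2 * Real.pi) := by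
    refine isPreconnected_univ.eq_of_int_valued (S := (univ : Set ℝ))
      (f := fun t => ((L t).im - (M t).im) / (2 * Real.pi)) (by fun_prop) ?_
      (mem_univ _) (mem_univ _)
    intro t _
    obtain ⟨k, hk⟩ := Complex.exp_eq_exp_iff_exists_int.1 ((h1 t).trans (h1' t).symm)
    refine ⟨k, ?_⟩
    rw [hk]
    simp
  have e1 := h2 0
  have e2 := h2' 0
  rw [zero_add] at e1 e2
  rw [div_left_inj' hpi, e1, e2] at key
  simp at key
  have : (n : ℝ) = m := by
    have : (2 * Real.pi) * ((n : ℝ) - m) = 0 := by linarith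
    rcases mul_eq_zero.1 this with h | h
    · exact absurd h hpi
    · linarith
  exact_mod_cast this

/-- Rouché's argument: the quotient `γ' / γ` stays in the open unit disc about `1`, so its principal
logarithm is continuous and periodic and may be added to a logarithm of `γ`. -/
theorem Winds.perturb {γ γ' : ℝ → ℂ} {n : ℤ} (h : Winds γ n) (hc : Continuous γ')
    (hp : ∀ t, γ' (t + 1) = γ' t) (hlt : ∀ t, ‖γ' t - γ t‖ < ‖γ t‖) : Winds γ' n := by
  have hγ := h.ne_zero
  have hγc := h.continuous
  have hγp := h.periodic
  obtain ⟨L, hL, h1, h2⟩ := h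
  have hs : ∀ t, γ' t / γ t ∈ Complex.slitPlane := by
    intro t
    have : γ' t / γ t = 1 + (γ' t - γ t) / γ t := by
      field_simp [hγ t]
      ring
    rw [this]
    apply Complex.mem_slitPlane_of_norm_lt_one
    rw [norm_div, div_lt_one (norm_pos_iff.2 (hγ t))]
    exact hlt t
  refine ⟨fun t => L t + Complex.log (γ' t / γ t), ?_, ?_, ?_⟩
  · exact hL.add ((hc.div hγc hγ).clog hs)
  · intro t
    rw [Complex.exp_add, h1, Complex.exp_log (Complex.slitPlane_ne_zero (hs t)),
      mul_div_cancel₀ _ (hγ t)]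
  · intro t
    simp only [h2, hp, hγp]
    ring

theorem Winds.const {c : ℂ} (hc : c ≠ 0) : Winds (fun _ => c) 0 :=
  ⟨fun _ => Complex.log c, continuous_const, fun _ => Complex.exp_log hc, fun _ => by simp⟩

theorem winds_circ : Winds circ 1 :=
  ⟨fun t => 2 * Real.pi * Complex.I * (t : ℂ), by fun_prop, fun _ => rfl, fun t => by
    push_cast; ring⟩

/-- Homotopy invariance of the winding number. -/
theorem Winds.homotopy {P : Type*} [TopologicalSpace P] [PreconnectedSpace P] {H : P → ℝ → ℂ}
    (hc : Continuous fun x : P × ℝ => H x.1 x.2) (hp : ∀ p t, H p (t + 1) = H p t)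
    (h0 : ∀ p t, H p t ≠ 0) {p q : P} {n : ℤ} (h : Winds (H p) n) : Winds (H q) n := by
  have hcp : ∀ p, Continuous (H p) := fun p =>
    hc.comp (Continuous.prodMk_right p)
  -- Uniform closeness in `t` comes from compactness of one period. Both norms are bounded from
  -- below so that `Winds.perturb` applies from either loop to the other: one direction makes the
  -- set of good parameters open, the other makes its complement open.
  have close : ∀ p, ∀ᶠ p' in 𝓝 p, ∀ t, ‖H p' t - H p t‖ < ‖H p t‖ ∧ ‖H p' t - H p t‖ < ‖H p' t‖ := by
    intro p
    have : ∀ᶠ p' in 𝓝 p, ∀ t ∈ Icc (0 : ℝ) 1,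
        ‖H p' t - H p t‖ < ‖H p t‖ ∧ ‖H p' t - H p t‖ < ‖H p' t‖ := by
      refine isCompact_Icc.eventually_forall_of_forall_eventually fun t _ => ?_
      have c1 : Continuous fun x : P × ℝ => ‖H x.1 x.2 - H p x.2‖ :=
        (hc.sub ((hcp p).comp continuous_snd)).norm
      have c2 : Continuous fun x : P × ℝ => ‖H p x.2‖ := ((hcp p).comp continuous_snd).norm
      have hpos : 0 < ‖H p t‖ := norm_pos_iff.2 (h0 p t)
      exact (c1.continuousAt.eventually_lt c2.continuousAt (by simpa using hpos)).and
        (c1.continuousAt.eventually_lt hc.norm.continuousAt (by simpa using hpos))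
    filter_upwards [this] with p' hp' t
    have hper : ∀ p, H p (Int.fract t) = H p t := by
      intro p
      have : Function.Periodic (H p) 1 := hp p
      have h := this.sub_int_mul_eq (x := t) ⌊t⌋
      rwa [mul_one, Int.self_sub_floor] at h
    have := hp' (Int.fract t) ⟨Int.fract_nonneg t, (Int.fract_lt_one t).le⟩
    rwa [hper, hper] at this
  have hclopen : IsClopen {p | Winds (H p) n} := by
    constructor
    · rw [← isOpen_compl_iff, isOpen_iff_mem_nhds]
      intro p hp'
      filter_upwards [close p] with p' hcl hw
      exact hp' (hw.perturb (hcp p) (hp p) fun t => by rw [norm_sub_rev]; exact (hcl t).2)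
    · rw [isOpen_iff_mem_nhds]
      intro p hp'
      filter_upwards [close p] with p' hcl
      exact hp'.perturb (hcp p') (hp p') fun t => (hcl t).1
  have := hclopen.eq_univ ⟨p, h⟩
  exact this.superset (mem_univ q)

/-- The polar form supplies a logarithm, with real part `log ‖γ‖`; continuity and periodicity of the
modulus are what a bare angle function does not provide. -/
theorem WindsOnce.winds {γ : ℝ → ℂ} (h : WindsOnce γ) (hc : Continuous γ)
    (hp : ∀ t, γ (t + 1) = γ t) : Winds γ 1 := by
  obtain ⟨h0, g, hg, hg1, hγ⟩ := h
  refine ⟨fun t => (Real.log ‖γ t‖ : ℝ) + 2 * Real.pi * Complex.I * (g t : ℂ), ?_, ?_, ?_⟩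
  · exact (Complex.continuous_ofReal.comp (hc.norm.log fun t => norm_ne_zero_iff.2 (h0 t))).add
      (by fun_prop)
  · intro t
    rw [Complex.exp_add, ← Complex.ofReal_exp, Real.exp_log (norm_pos_iff.2 (h0 t)), ← hγ]
  · intro t
    simp only [hp, hg1]
    push_cast
    ring

theorem Winds.windsOnce {γ : ℝ → ℂ} (h : Winds γ 1) : WindsOnce γ := by
  refine ⟨h.ne_zero, ?_⟩
  obtain ⟨L, hL, h1, h2⟩ := h
  have hpi : (2 * Real.pi : ℝ) ≠ 0 := by positivity
  refine ⟨fun t => (L t).im / (2 * Real.pi), by fun_prop, fun t => ?_, fun t => ?_⟩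
  · simp only [h2]
    field_simp
    simp
  · have := Complex.norm_mul_exp_arg_mul_I
    rw [← h1, Complex.norm_exp, Complex.ofReal_exp, ← Complex.exp_add]
    congr 1
    have hpi' : (Real.pi : ℂ) ≠ 0 := by exact_mod_cast Real.pi_ne_zero
    push_cast
    field_simp
    rw [mul_comm Complex.I, Complex.re_add_im]

/-- Loops in the image of a map from a closed disc, about a point that it omits. -/
theorem winds_zero_of_notMem_image {F : ℂ → ℂ} {z q : ℂ} {r : ℝ} (hr : 0 ≤ r)
    (hF : ContinuousOn F (closedBall z r)) (hq : q ∉ F '' closedBall z r) :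
    Winds (fun t => F (z + r * circ t) - q) 0 := by
  have hmem : ∀ ρ ∈ Icc (0 : ℝ) 1, ∀ t, z + (ρ * r : ℝ) * circ t ∈ closedBall z r := by
    intro ρ hρ t
    rw [mem_closedBall, dist_eq_norm, add_sub_cancel_left, norm_mul, norm_circ, mul_one,
      Complex.norm_real, Real.norm_eq_abs, abs_of_nonneg (mul_nonneg hρ.1 hr)]
    exact mul_le_of_le_one_left hr hρ.2
  have : PreconnectedSpace (Icc (0 : ℝ) 1) := Subtype.preconnectedSpace isPreconnected_Icc
  -- Shrink the circle to its centre; since `q` is never met, the winding number is that of a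
  -- constant loop.
  let H : Icc (0 : ℝ) 1 → ℝ → ℂ := fun ρ t => F (z + (ρ.1 * r : ℝ) * circ t) - q
  have h0 : Winds (H ⟨0, by simp⟩) 0 := by
    have h1 : F z - q ≠ 0 := sub_ne_zero.2 fun h => hq ⟨z, mem_closedBall_self hr, h⟩
    simpa [H] using Winds.const h1
  have h1 : Winds (H ⟨1, by simp⟩) 0 := by
    refine Winds.homotopy ?_ ?_ ?_ h0
    · refine Continuous.sub ?_ continuous_const
      exact hF.comp_continuous (by fun_prop) fun x => hmem _ x.1.2 _
    · intro p t
      simp [H]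
    · intro p t
      exact sub_ne_zero.2 fun h => hq ⟨_, hmem _ p.2 t, h⟩
  simpa [H] using h1

/-- A map of a closed disc which winds about the value at the centre covers a neighbourhood. -/
theorem image_mem_nhds_of_winds {F : ℂ → ℂ} {z : ℂ} {r : ℝ} {n : ℤ} (hn : n ≠ 0) (hr : 0 ≤ r)
    (hF : ContinuousOn F (closedBall z r)) (hw : Winds (fun t => F (z + r * circ t) - F z) n) :
    F '' closedBall z r ∈ 𝓝 (F z) := by
  obtain ⟨t₀, -, ht₀⟩ := isCompact_Icc.exists_isMinOn (nonempty_Icc.2 (zero_le_one (α := ℝ)))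
    hw.continuous.norm.continuousOn
  have hmin : ∀ t, ‖F (z + r * circ t₀) - F z‖ ≤ ‖F (z + r * circ t) - F z‖ := by
    intro t
    have hper : Function.Periodic (fun t => F (z + r * circ t) - F z) 1 := hw.periodic
    have h := hper.sub_int_mul_eq (x := t) ⌊t⌋
    rw [mul_one, Int.self_sub_floor] at h
    rw [← h]
    exact ht₀ ⟨Int.fract_nonneg t, (Int.fract_lt_one t).le⟩
  -- Take the ball whose radius is the distance from `F z` to the image of the circle. Moving the
  -- base point inside it does not change the winding number, which would have to be `0` about an
  -- omitted point.
  refine mem_of_superset (ball_mem_nhds _ (norm_pos_iff.2 (hw.ne_zero t₀))) fun q hq => ?_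
  by_contra hcon
  have h0 := winds_zero_of_notMem_image hr hF hcon
  refine hn ((hw.perturb (γ' := fun t => F (z + r * circ t) - q) h0.continuous h0.periodic
    fun t => ?_).unique h0)
  rw [sub_sub_sub_cancel_left, ← dist_eq_norm, dist_comm]
  exact (mem_ball.1 hq).trans_le (hmin t)

/-- The local degree of an injective map of a convex set does not depend on the point. -/
theorem Winds.of_injOn {F : ℂ → ℂ} {D : Set ℂ} (hD : Convex ℝ D) (hF : ContinuousOn F D)
    (hinj : InjOn F D) {z z' : ℂ} {r r' : ℝ} (hr : 0 < r) (hr' : 0 < r')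
    (hs : closedBall z r ⊆ D) (hs' : closedBall z' r' ⊆ D) {n : ℤ}
    (hw : Winds (fun t => F (z + r * circ t) - F z) n) :
    Winds (fun t => F (z' + r' * circ t) - F z') n := by
  -- The discs contained in `D` form a convex, hence connected, set of pairs (centre, radius), and
  -- by injectivity the loop about the image of the centre never vanishes along it.
  let P : Set (ℂ × ℝ) := {p | 0 < p.2 ∧ ∀ v ∈ closedBall (0 : ℂ) 1, p.1 + p.2 * v ∈ D}
  have hP : Convex ℝ P := by
    rintro ⟨z, r⟩ ⟨hr, h⟩ ⟨z', r'⟩ ⟨hr', h'⟩ a b ha hb hab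
    refine ⟨?_, fun v hv => ?_⟩
    · exact (convex_Ioi (0 : ℝ)) hr hr' ha hb hab
    · convert hD (h v hv) (h' v hv) ha hb hab using 1
      simp
      ring
  have hmem : ∀ {z : ℂ} {r : ℝ}, 0 < r → closedBall z r ⊆ D → (z, r) ∈ P := by
    intro z r hr hs
    refine ⟨hr, fun v hv => hs ?_⟩
    rw [mem_closedBall, dist_eq_norm, add_sub_cancel_left, norm_mul, Complex.norm_real,
      Real.norm_eq_abs, abs_of_pos hr]
    exact mul_le_of_le_one_right hr.le (mem_closedBall_zero_iff.1 hv)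
  have : PreconnectedSpace P := Subtype.preconnectedSpace hP.isPreconnected
  have hc : ∀ p : P, p.1.1 ∈ D := fun p => by simpa using p.2.2 0 (by simp)
  have hm : ∀ (p : P) t, p.1.1 + p.1.2 * circ t ∈ D := fun p t =>
    p.2.2 _ (circ_mem_closedBall t)
  refine Winds.homotopy (P := P) (H := fun p t => F (p.1.1 + p.1.2 * circ t) - F p.1.1) ?_ ?_ ?_
    (p := ⟨(z, r), hmem hr hs⟩) (q := ⟨(z', r'), hmem hr' hs'⟩) hw
  · exact (hF.comp_continuous (by fun_prop) fun x => hm _ _).sub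
      (hF.comp_continuous (by fun_prop) fun x => hc x.1)
  · intro p t
    simp
  · intro p t h
    have := hinj (hm p t) (hc p) (sub_eq_zero.1 h)
    have h2 : (p.1.2 : ℂ) * circ t = 0 := by simpa using this
    rcases mul_eq_zero.1 h2 with h3 | h3
    · exact p.2.1.ne' (by exact_mod_cast h3)
    · exact circ_ne_zero _ h3

theorem LocalDegreeOne.winds {F : ℂ → ℂ} {z : ℂ} (hF : ContinuousOn F (closedBall 0 1))
    (h : LocalDegreeOne F z) : ∃ r : ℝ, 0 < r ∧ closedBall z r ⊆ ball 0 1 ∧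
      InjOn F (closedBall z r) ∧ Winds (fun t => F (z + r * circ t) - F z) 1 := by
  obtain ⟨r, hr, hs, hi, hw⟩ := h
  refine ⟨r, hr, hs, hi, WindsOnce.winds hw ?_ ?_⟩
  · refine Continuous.sub ?_ continuous_const
    refine hF.comp_continuous (by fun_prop) fun t => ball_subset_closedBall (hs ?_)
    rw [mem_closedBall, dist_eq_norm, add_sub_cancel_left, norm_mul, norm_circ, mul_one,
      Complex.norm_real, Real.norm_eq_abs, abs_of_pos hr]
  · intro t
    simp

/-- Immersed discs are open maps in the interior. -/
theorem IsImmersedDisc.nhds_le_map {F : ℂ → ℂ} (hF : ContinuousOn F (closedBall 0 1))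
    (h : IsImmersedDisc F) {z : ℂ} (hz : z ∈ ball (0 : ℂ) 1) : 𝓝 (F z) ≤ map F (𝓝 z) := by
  obtain ⟨r, hr, hs, hi, hw⟩ := (h.2 z hz).winds hF
  intro W hW
  obtain ⟨ε, hε, hεW⟩ := Metric.nhds_basis_closedBall.mem_iff.1 (mem_map.1 hW)
  have hmin : 0 < min r ε := lt_min hr hε
  have hFr : ContinuousOn F (closedBall z r) := hF.mono (hs.trans ball_subset_closedBall)
  -- Local degree one is given for a single radius, while openness needs arbitrarily small ones;
  -- injectivity allows shrinking.
  have hw' := hw.of_injOn (convex_closedBall z r) hFr hi hr hmin subset_rfl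
    (closedBall_subset_closedBall (min_le_left r ε))
  refine mem_of_superset (image_mem_nhds_of_winds one_ne_zero hmin.le
    (hFr.mono (closedBall_subset_closedBall (min_le_left r ε))) hw') ?_
  rw [image_subset_iff]
  exact (closedBall_subset_closedBall (min_le_right r ε)).trans hεW

/-- An injective map of the closed disc whose boundary winds once about the image of the centre is
an immersed disc. -/
theorem isImmersedDisc_of_injOn {F : ℂ → ℂ} (hF : ContinuousOn F (closedBall 0 1))
    (hinj : InjOn F (closedBall 0 1)) (hw : Winds (fun t => F (circ t) - F 0) 1) :
    IsImmersedDisc F := by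
  refine ⟨fun z _ => ⟨univ, univ_mem, hinj.mono inter_subset_right⟩, fun z hz => ?_⟩
  have hz' : ‖z‖ < 1 := mem_ball_zero_iff.1 hz
  have hr : 0 < (1 - ‖z‖) / 2 := by linarith
  have hs : closedBall z ((1 - ‖z‖) / 2) ⊆ ball 0 1 :=
    closedBall_subset_ball' (by rw [dist_zero_right]; linarith)
  have hs' := hs.trans ball_subset_closedBall
  refine ⟨(1 - ‖z‖) / 2, hr, hs, hinj.mono hs', Winds.windsOnce ?_⟩
  refine Winds.of_injOn (convex_closedBall _ _) hF hinj one_pos hr subset_rfl hs' ?_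
  simpa using hw

theorem IsImmersedDisc.winds {F : ℂ → ℂ} (hF : ContinuousOn F (closedBall 0 1))
    (hinj : InjOn F (closedBall 0 1)) (h : IsImmersedDisc F) :
    Winds (fun t => F (circ t) - F 0) 1 := by
  obtain ⟨r, hr, hs, hi, hw⟩ := (h.2 0 (by simp)).winds hF
  simpa using Winds.of_injOn (convex_closedBall _ _) hF hinj hr one_pos
    (hs.trans ball_subset_closedBall) subset_rfl hw

/-- A real function on an interval whose cosine stays nonnegative does not leave
`[-π / 2, π / 2]`. -/
theorem mem_Icc_of_cos_nonneg {h : ℝ → ℝ} (hc : Continuous h) {a b : ℝ} (hab : a ≤ b)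
    (ha : h a ∈ Icc (-(Real.pi / 2)) (Real.pi / 2)) (hcos : ∀ t ∈ Icc a b, 0 ≤ Real.cos (h t)) :
    h b ∈ Icc (-(Real.pi / 2)) (Real.pi / 2) := by
  have hpi := Real.pi_pos
  constructor
  · by_contra! hlt
    obtain ⟨m, hm1, hm2⟩ := exists_between (max_lt hlt (by linarith : -(3 * Real.pi / 2) < _))
    obtain ⟨h1, h2⟩ := max_lt_iff.1 hm1
    obtain ⟨t, ht, rfl⟩ := intermediate_value_Icc' hab hc.continuousOn ⟨h1.le, hm2.le.trans ha.1⟩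
    have := hcos t ht
    rw [← Real.cos_neg] at this
    exact absurd this (not_le.2 (Real.cos_neg_of_pi_div_two_lt_of_lt (by linarith) (by linarith)))
  · by_contra! hlt
    obtain ⟨m, hm1, hm2⟩ := exists_between (lt_min hlt (by linarith : _ < 3 * Real.pi / 2))
    obtain ⟨h1, h2⟩ := lt_min_iff.1 hm2
    obtain ⟨t, ht, rfl⟩ := intermediate_value_Icc hab hc.continuousOn ⟨ha.2.trans hm1.le, h1.le⟩
    exact absurd (hcos t ht)
      (not_le.2 (Real.cos_neg_of_pi_div_two_lt_of_lt (by linarith) (by linarith)))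

/-- The angle cannot leave the closed half turn centred at `c`. It starts at the upper end, and the
conditions at `b` single out the lower end. -/
theorem half_turn {g : ℝ → ℝ} (hc : Continuous g) {a b c : ℝ} (hab : a ≤ b)
    (ha : g a = c + Real.pi / 2) (hcos : ∀ t ∈ Icc a b, 0 ≤ Real.cos (g t - c))
    (hb : Real.cos (g b - c) = 0) (hb' : Real.sin (g b - c) < 0) : g b = c - Real.pi / 2 := by
  have hpi := Real.pi_pos
  have h1 := mem_Icc_of_cos_nonneg (h := fun t => g t - c) (by fun_prop) hab
    (by rw [ha]; constructor <;> linarith) hcos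
  have h2 : g b - c < 0 := by
    by_contra! h
    exact absurd hb' (not_lt.2 (Real.sin_nonneg_of_nonneg_of_le_pi h (by linarith [h1.2])))
  by_contra hne
  have h3 : -(Real.pi / 2) < g b - c := lt_of_le_of_ne h1.1 fun h => hne (by linarith)
  exact (Real.cos_pos_of_mem_Ioo ⟨h3, by linarith⟩).ne' hb

/-- A loop that crosses the imaginary axis downwards on the right and upwards on the left winds
`-1` times about the origin. -/
theorem Winds.eq_neg_one {γ : ℝ → ℂ} {n : ℤ} (h : Winds γ n) {t₁ t₂ : ℝ} (h1 : t₁ ≤ t₂)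
    (h2 : t₂ ≤ t₁ + 1) (hr : ∀ t ∈ Icc t₁ t₂, 0 ≤ (γ t).re)
    (hl : ∀ t ∈ Icc t₂ (t₁ + 1), (γ t).re ≤ 0) (hi1 : 0 < (γ t₁).im) (hi2 : (γ t₂).im < 0) :
    n = -1 := by
  have hper := h.periodic
  obtain ⟨L, hL, hexp, hL1⟩ := h
  have hre : ∀ t, (γ t).re = Real.exp (L t).re * Real.cos (L t).im := fun t => by
    rw [← hexp, Complex.exp_re]
  have him : ∀ t, (γ t).im = Real.exp (L t).re * Real.sin (L t).im := fun t => by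
    rw [← hexp, Complex.exp_im]
  have hg : Continuous fun t => (L t).im := by fun_prop
  have z1 : (γ t₁).re = 0 := le_antisymm
    (by rw [← hper]; exact hl _ ⟨h2, le_rfl⟩) (hr _ ⟨le_rfl, h1⟩)
  have z2 : (γ t₂).re = 0 := le_antisymm (hl _ ⟨le_rfl, h2⟩) (hr _ ⟨h1, le_rfl⟩)
  have cos1 : Real.cos (L t₁).im = 0 := by simpa [hre, Real.exp_ne_zero] using z1
  have cos2 : Real.cos (L t₂).im = 0 := by simpa [hre, Real.exp_ne_zero] using z2
  have sin1 : 0 < Real.sin (L t₁).im := by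
    rw [him] at hi1
    exact pos_of_mul_pos_right hi1 (Real.exp_pos _).le
  have sin2 : Real.sin (L t₂).im < 0 := by
    rw [him] at hi2
    exact neg_of_mul_neg_right hi2 (Real.exp_pos _).le
  obtain ⟨k, hk⟩ : ∃ k : ℤ, (L t₁).im = k * (2 * Real.pi) + Real.pi / 2 := by
    have : Real.sin (L t₁).im = 1 := by
      have := Real.sin_sq_add_cos_sq (L t₁).im
      rw [cos1] at this
      nlinarith
    obtain ⟨k, hk⟩ := (Real.sin_eq_one_iff).1 this
    exact ⟨k, by rw [← hk]; ring⟩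
  have cosk : ∀ x, Real.cos (x - k * (2 * Real.pi)) = Real.cos x := fun x =>
    Real.cos_sub_int_mul_two_pi x k
  have sink : ∀ x, Real.sin (x - k * (2 * Real.pi)) = Real.sin x := fun x =>
    Real.sin_sub_int_mul_two_pi x k
  have e2 := half_turn hg h1 hk (fun t ht => by
    rw [cosk]
    have := hr t ht
    rw [hre] at this
    exact nonneg_of_mul_nonneg_right this (Real.exp_pos _)) (by rw [cosk, cos2])
    (by rw [sink]; exact sin2)
  have him1 : (L (t₁ + 1)).im = (L t₁).im + 2 * Real.pi * n := by
    rw [hL1]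
    simp
  -- The rest of the loop lies in the left half plane, where the half turn is centred `π` lower. The
  -- two half turns add up to `-2 π`.
  have e3 := half_turn (c := k * (2 * Real.pi) - Real.pi) hg h2 (by rw [e2]; ring) (fun t ht => by
    rw [show (L t).im - (k * (2 * Real.pi) - Real.pi) = (L t).im - k * (2 * Real.pi) + Real.pi by
      ring, Real.cos_add_pi, cosk]
    have := hl t ht
    rw [hre] at this
    have := nonpos_of_mul_nonpos_right this (Real.exp_pos _)
    linarith) (by
      rw [show (L (t₁ + 1)).im - (k * (2 * Real.pi) - Real.pi) =
        (L t₁).im - k * (2 * Real.pi) + Real.pi + n * (2 * Real.pi) by rw [him1]; ring,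
        Real.cos_add_int_mul_two_pi, Real.cos_add_pi, cosk, cos1, neg_zero]) (by
      rw [show (L (t₁ + 1)).im - (k * (2 * Real.pi) - Real.pi) =
        (L t₁).im - k * (2 * Real.pi) + Real.pi + n * (2 * Real.pi) by rw [him1]; ring,
        Real.sin_add_int_mul_two_pi, Real.sin_add_pi, sink]
      linarith)
  rw [him1, hk] at e3
  have h4 : (2 * Real.pi) * ((n : ℝ) + 1) = 0 := by linarith
  have h5 : (n : ℝ) + 1 = 0 := (mul_eq_zero.1 h4).resolve_left (by positivity)
  have : n + 1 = 0 := by exact_mod_cast h5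
  omega

/-! ### Immersed discs bounded by two graphs -/

/-- The boundary of `F` runs along the graph of `u` from left to right, and then along the
graph of `v` from right to left. -/
structure GraphBoundary (F : ℂ → ℂ) (u v : ℝ → ℝ) (A B θ₀ θ₁ : ℝ) : Prop where
  lt : θ₀ < θ₁
  lt' : θ₁ < θ₀ + 1
  left : (F (circ θ₀)).re = A
  right : (F (circ θ₁)).re = B
  mono : StrictMonoOn (fun θ => (F (circ θ)).re) (Icc θ₀ θ₁)
  anti : StrictAntiOn (fun θ => (F (circ θ)).re) (Icc θ₁ (θ₀ + 1))
  on_left : ∀ θ ∈ Icc θ₀ θ₁, (F (circ θ)).im = u (F (circ θ)).re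
  on_right : ∀ θ ∈ Icc θ₁ (θ₀ + 1), (F (circ θ)).im = v (F (circ θ)).re

/-- A maximum principle for open maps of the disc. -/
theorem IsImmersedDisc.lt_zero_of_boundary {F : ℂ → ℂ} (hF : ContinuousOn F (closedBall 0 1))
    (h : IsImmersedDisc F) {Ψ : ℂ → ℝ} (hΨ : Continuous Ψ) (d : ℂ)
    (hd : ∀ (w : ℂ) (δ : ℝ), 0 < δ → Ψ w < Ψ (w + δ * d))
    (hb : ∀ z, ‖z‖ = 1 → Ψ (F z) ≤ 0) {z : ℂ} (hz : z ∈ ball (0 : ℂ) 1) : Ψ (F z) < 0 := by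
  -- The image of the open disc is open, so it contains points slightly further in the direction
  -- `d`, where `Ψ` is larger: `Ψ ∘ F` has no interior maximum.
  have hinc : ∀ z ∈ ball (0 : ℂ) 1, ∃ z' ∈ ball (0 : ℂ) 1, Ψ (F z) < Ψ (F z') := by
    intro z hz
    have hnhds : F '' ball 0 1 ∈ 𝓝 (F z) :=
      h.nhds_le_map hF hz (image_mem_map (isOpen_ball.mem_nhds hz))
    have hlim : Tendsto (fun δ : ℝ => F z + δ * d) (𝓝[>] 0) (𝓝 (F z)) := by
      have : Continuous fun δ : ℝ => F z + δ * d := by fun_prop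
      simpa using (this.tendsto 0).mono_left nhdsWithin_le_nhds
    obtain ⟨δ, ⟨z', hz', he⟩, hδ⟩ :=
      ((hlim.eventually_mem hnhds).and self_mem_nhdsWithin).exists
    exact ⟨z', hz', he ▸ hd _ _ hδ⟩
  obtain ⟨m, hm, hmax⟩ := (isCompact_closedBall (0 : ℂ) 1).exists_isMaxOn
    ⟨0, by simp⟩ (hΨ.comp_continuousOn hF)
  have hm' : ‖m‖ = 1 := by
    refine le_antisymm (mem_closedBall_zero_iff.1 hm) (not_lt.1 fun hlt => ?_)
    obtain ⟨z', hz', h'⟩ := hinc m (mem_ball_zero_iff.2 hlt)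
    exact absurd (hmax (ball_subset_closedBall hz')) (not_le.2 h')
  obtain ⟨z', hz', h'⟩ := hinc z hz
  exact h'.trans_le ((hmax (ball_subset_closedBall hz')).trans (hb m hm'))

/-- An immersed disc which is injective on the boundary circle, and maps the open disc to
the complement of the image of the circle, is injective. -/
theorem IsImmersedDisc.injOn {F : ℂ → ℂ} (hF : ContinuousOn F (closedBall 0 1))
    (h : IsImmersedDisc F) (hb : InjOn F (sphere 0 1))
    (hd : ∀ z ∈ ball (0 : ℂ) 1, ∀ w ∈ sphere (0 : ℂ) 1, F z ≠ F w) :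
    InjOn F (closedBall 0 1) := by
  choose! U hU hUi using h.1
  let D := closedBall (0 : ℂ) 1
  -- The double points. They are shown to be compact, and their first projection open; a clopen
  -- bounded subset of the plane is empty.
  let P : Set (ℂ × ℂ) := {p | p ∈ D ×ˢ D ∧ F p.1 = F p.2 ∧ p.1 ≠ p.2}
  have hP0 : IsCompact {p : ℂ × ℂ | p ∈ D ×ˢ D ∧ F p.1 = F p.2} := by
    have hDD : IsCompact (D ×ˢ D) := (isCompact_closedBall _ _).prod (isCompact_closedBall _ _)
    refine hDD.of_isClosed_subset ?_ fun p hp => hp.1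
    have hc : ContinuousOn (fun p : ℂ × ℂ => (F p.1, F p.2)) (D ×ˢ D) :=
      (hF.comp continuousOn_fst fun p hp => hp.1).prodMk
        (hF.comp continuousOn_snd fun p hp => hp.2)
    exact hc.preimage_isClosed_of_isClosed hDD.isClosed isClosed_diagonal
  have hP : IsCompact P := by
    -- Local injectivity keeps double points away from the diagonal, so deleting the diagonal
    -- amounts to deleting an open neighbourhood of it.
    have : P = {p : ℂ × ℂ | p ∈ D ×ˢ D ∧ F p.1 = F p.2} \
        ⋃ z ∈ D, interior (U z) ×ˢ interior (U z) := by
      ext ⟨p, q⟩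
      simp only [P, mem_ofPred_eq, Set.mem_sdiff, mem_iUnion, not_exists]
      constructor
      · rintro ⟨h1, h2, h3⟩
        refine ⟨⟨h1, h2⟩, fun z hz hpq => h3 ?_⟩
        exact hUi z hz ⟨interior_subset hpq.1, h1.1⟩ ⟨interior_subset hpq.2, h1.2⟩ h2
      · rintro ⟨⟨h1, h2⟩, h3⟩
        refine ⟨h1, h2, ?_⟩
        rintro rfl
        have := mem_interior_iff_mem_nhds.2 (hU p h1.1)
        exact h3 p h1.1 ⟨this, this⟩
    rw [this]
    exact hP0.diff (isOpen_biUnion fun z _ => isOpen_interior.prod isOpen_interior)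
  have hball : ∀ p ∈ P, p.1 ∈ ball (0 : ℂ) 1 ∧ p.2 ∈ ball (0 : ℂ) 1 := by
    rintro ⟨p, q⟩ ⟨⟨hp, hq⟩, he, hne⟩
    have key : ∀ z ∈ D, z ∈ ball (0 : ℂ) 1 ∨ z ∈ sphere (0 : ℂ) 1 := fun z hz =>
      (mem_closedBall.1 hz).lt_or_eq
    rcases key p hp with h1 | h1 <;> rcases key q hq with h2 | h2
    · exact ⟨h1, h2⟩
    · exact absurd he (hd p h1 q h2)
    · exact absurd he.symm (hd q h2 p h1)
    · exact absurd (hb h1 h2 he) hne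
  -- Both members of a double point are interior. Since `F` is open near the second one, every point
  -- close to the first still has a partner there.
  have hopen : IsOpen (Prod.fst '' P) := by
    rw [isOpen_iff_mem_nhds]
    rintro _ ⟨⟨p, q⟩, hpq, rfl⟩
    obtain ⟨hp, hq⟩ := hball _ hpq
    obtain ⟨⟨-, -⟩, he, hne⟩ := hpq
    obtain ⟨V, W, hV, hW, hpV, hqW, hVW⟩ := t2_separation hne
    have h1 : F '' (W ∩ ball 0 1) ∈ 𝓝 (F q) := h.nhds_le_map hF hq
      (image_mem_map ((hW.inter isOpen_ball).mem_nhds ⟨hqW, hq⟩))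
    rw [← show F p = F q from he] at h1
    have h2 : ∀ᶠ z in 𝓝 p, F z ∈ F '' (W ∩ ball 0 1) :=
      (hF.continuousAt (mem_of_superset (isOpen_ball.mem_nhds hp)
        ball_subset_closedBall)).eventually_mem h1
    filter_upwards [h2, (hV.inter isOpen_ball).mem_nhds ⟨hpV, hp⟩] with z ⟨w, hw, hwe⟩ hz
    refine ⟨(z, w), ⟨⟨ball_subset_closedBall hz.2, ball_subset_closedBall hw.2⟩, hwe.symm, ?_⟩, rfl⟩
    exact hVW.ne_of_mem hz.1 hw.1
  have hcl : IsClopen (Prod.fst '' P) := ⟨(hP.image continuous_fst).isClosed, hopen⟩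
  rcases isClopen_iff.1 hcl with h0 | h1
  · intro p hp q hq he
    by_contra hne
    have : p ∈ Prod.fst '' P := ⟨(p, q), ⟨⟨hp, hq⟩, he, hne⟩, rfl⟩
    rw [h0] at this
    exact this
  · exfalso
    obtain ⟨p, hp, he⟩ := h1.symm ▸ mem_univ (2 : ℂ)
    have := mem_ball_zero_iff.1 (hball p hp).1
    rw [he] at this
    norm_num at this

namespace GraphBoundary

variable {F : ℂ → ℂ} {u v : ℝ → ℝ} {A B θ₀ θ₁ : ℝ}

theorem left' (h : GraphBoundary F u v A B θ₀ θ₁) : (F (circ (θ₀ + 1))).re = A := by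
  rw [circ_add_one, h.left]

theorem eq_left (h : GraphBoundary F u v A B θ₀ θ₁) : u A = v A := by
  have h1 := h.on_left θ₀ ⟨le_rfl, h.lt.le⟩
  have h2 := h.on_right (θ₀ + 1) ⟨h.lt'.le, le_rfl⟩
  rw [circ_add_one] at h2
  rw [← h.left, ← h1, h2]

theorem eq_right (h : GraphBoundary F u v A B θ₀ θ₁) : u B = v B := by
  have h1 := h.on_left θ₁ ⟨h.lt.le, le_rfl⟩
  have h2 := h.on_right θ₁ ⟨le_rfl, h.lt'.le⟩
  rw [← h.right, ← h1, h2]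

theorem re_mem_of_left (h : GraphBoundary F u v A B θ₀ θ₁) {θ : ℝ} (hθ : θ ∈ Icc θ₀ θ₁) :
    (F (circ θ)).re ∈ Icc A B := by
  rw [← h.left, ← h.right]
  exact ⟨h.mono.monotoneOn ⟨le_rfl, h.lt.le⟩ hθ hθ.1, h.mono.monotoneOn hθ ⟨h.lt.le, le_rfl⟩ hθ.2⟩

theorem re_mem_of_right (h : GraphBoundary F u v A B θ₀ θ₁) {θ : ℝ} (hθ : θ ∈ Icc θ₁ (θ₀ + 1)) :
    (F (circ θ)).re ∈ Icc A B := by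
  rw [← h.left', ← h.right]
  exact ⟨h.anti.antitoneOn hθ ⟨h.lt'.le, le_rfl⟩ hθ.2, h.anti.antitoneOn ⟨le_rfl, h.lt'.le⟩ hθ hθ.1⟩

theorem boundary (h : GraphBoundary F u v A B θ₀ θ₁) {z : ℂ} (hz : ‖z‖ = 1) :
    (F z).re ∈ Icc A B ∧ ((F z).im = u (F z).re ∨ (F z).im = v (F z).re) := by
  obtain ⟨θ, hθ, rfl⟩ := exists_circ_eq hz θ₀
  rcases le_total θ θ₁ with h1 | h1
  · exact ⟨h.re_mem_of_left ⟨hθ.1, h1⟩, .inl (h.on_left _ ⟨hθ.1, h1⟩)⟩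
  · exact ⟨h.re_mem_of_right ⟨h1, hθ.2.le⟩, .inr (h.on_right _ ⟨h1, hθ.2.le⟩)⟩

theorem continuous_circ_comp (hF : ContinuousOn F (closedBall 0 1)) :
    Continuous fun θ => F (circ θ) :=
  hF.comp_continuous continuous_circ circ_mem_closedBall

theorem surj_left (h : GraphBoundary F u v A B θ₀ θ₁) (hF : ContinuousOn F (closedBall 0 1))
    {x : ℝ} (hx : x ∈ Icc A B) : ∃ θ ∈ Icc θ₀ θ₁, (F (circ θ)).re = x := by
  have hc := continuous_circ_comp hF
  have := intermediate_value_Icc h.lt.le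
    (f := fun θ => (F (circ θ)).re) (Complex.continuous_re.comp hc).continuousOn
  rw [h.left, h.right] at this
  exact this hx

theorem surj_right (h : GraphBoundary F u v A B θ₀ θ₁) (hF : ContinuousOn F (closedBall 0 1))
    {x : ℝ} (hx : x ∈ Icc A B) : ∃ θ ∈ Icc θ₁ (θ₀ + 1), (F (circ θ)).re = x := by
  have hc := continuous_circ_comp hF
  have := intermediate_value_Icc' h.lt'.le
    (f := fun θ => (F (circ θ)).re) (Complex.continuous_re.comp hc).continuousOn
  rw [h.left', h.right] at this
  exact this hx

/-- Each of the four inequalities is the maximum principle for a function that strictly increases in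
a fixed direction: horizontal for the bounds by `A` and `B`, vertical for those by the graphs. -/
theorem interior_mem (h : GraphBoundary F u v A B θ₀ θ₁) (hF : ContinuousOn F (closedBall 0 1))
    (hI : IsImmersedDisc F) (hu : Continuous u) (hv : Continuous v) {z : ℂ}
    (hz : z ∈ ball (0 : ℂ) 1) : (F z).re ∈ Ioo A B ∧
      min (u (F z).re) (v (F z).re) < (F z).im ∧ (F z).im < max (u (F z).re) (v (F z).re) := by
  refine ⟨⟨?_, ?_⟩, ?_, ?_⟩
  · have := hI.lt_zero_of_boundary hF (Ψ := fun w => A - w.re) (by fun_prop) (-1)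
      (fun w δ hδ => by simp [hδ]) (fun w hw => by linarith [(h.boundary hw).1.1]) hz
    linarith
  · have := hI.lt_zero_of_boundary hF (Ψ := fun w => w.re - B) (by fun_prop) 1
      (fun w δ hδ => by simp [hδ]) (fun w hw => by linarith [(h.boundary hw).1.2]) hz
    linarith
  · have := hI.lt_zero_of_boundary hF (Ψ := fun w => min (u w.re) (v w.re) - w.im)
      (by fun_prop) (-Complex.I) (fun w δ hδ => by simp [hδ]) (fun w hw => ?_) hz
    · linarith
    · rcases (h.boundary hw).2 with h1 | h1 <;> rw [h1] <;> simp
  · have := hI.lt_zero_of_boundary hF (Ψ := fun w => w.im - max (u w.re) (v w.re))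
      (by fun_prop) Complex.I (fun w δ hδ => by simp [hδ]) (fun w hw => ?_) hz
    · linarith
    · rcases (h.boundary hw).2 with h1 | h1 <;> rw [h1] <;> simp

/-- The open disc together with the two extreme corners is connected, so all intermediate abscissae
occur on it, and those strictly between `A` and `B` do not occur at the corners. -/
theorem exists_interior (h : GraphBoundary F u v A B θ₀ θ₁) (hF : ContinuousOn F (closedBall 0 1))
    {x : ℝ} (hx : x ∈ Ioo A B) : ∃ z ∈ ball (0 : ℂ) 1, (F z).re = x := by
  let S : Set ℂ := ball 0 1 ∪ {circ θ₀, circ θ₁}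
  have hS : S ⊆ closedBall 0 1 := by
    rintro z (hz | rfl | rfl)
    · exact ball_subset_closedBall hz
    · exact circ_mem_closedBall _
    · exact circ_mem_closedBall _
  have hpre : IsPreconnected S := by
    refine (convex_ball (0 : ℂ) 1).isPreconnected.subset_closure subset_union_left ?_
    rwa [closure_ball _ one_ne_zero]
  have hc : ContinuousOn (fun z => (F z).re) S :=
    Complex.continuous_re.comp_continuousOn (hF.mono hS)
  have := hpre.intermediate_value (a := circ θ₀) (b := circ θ₁) (by simp [S]) (by simp [S]) hc
  rw [h.left, h.right] at this
  obtain ⟨z, hz | rfl | rfl, hzx⟩ := this ⟨hx.1.le, hx.2.le⟩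
  · exact ⟨z, hz, hzx⟩
  · exact absurd (h.left.symm.trans hzx) hx.1.ne
  · exact absurd (h.right.symm.trans hzx) hx.2.ne'

/-- Above each abscissa in the open interval there is an interior point strictly between the graphs,
so they cannot cross there. -/
theorem lt_or_lt (h : GraphBoundary F u v A B θ₀ θ₁) (hF : ContinuousOn F (closedBall 0 1))
    (hI : IsImmersedDisc F) (hu : Continuous u) (hv : Continuous v) :
    (∀ x ∈ Ioo A B, u x < v x) ∨ ∀ x ∈ Ioo A B, v x < u x := by
  have hne : ∀ x ∈ Ioo A B, u x - v x ≠ 0 := by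
    intro x hx h0
    obtain ⟨z, hz, rfl⟩ := h.exists_interior hF hx
    obtain ⟨-, h1, h2⟩ := h.interior_mem hF hI hu hv hz
    rw [sub_eq_zero.1 h0] at h1 h2
    simp only [min_self, max_self] at h1 h2
    exact absurd h1 h2.not_gt
  by_contra! hcon
  obtain ⟨⟨x, hx, hx'⟩, y, hy, hy'⟩ := hcon
  obtain ⟨z, hz, hz0⟩ := isPreconnected_Ioo.intermediate_value hy hx
    (f := fun x => u x - v x) (by fun_prop) (show (0 : ℝ) ∈ _ from ⟨by linarith, by linarith⟩)
  exact hne z hz hz0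

/-- On each half of the boundary the abscissa is injective. Points of different halves with the same
image lie over a crossing of the graphs, which is `A` or `B`, and then both are the corresponding
corner. -/
theorem injOn_sphere (h : GraphBoundary F u v A B θ₀ θ₁) (hne : ∀ x ∈ Ioo A B, u x ≠ v x) :
    InjOn F (sphere 0 1) := by
  have key : ∀ s ∈ Icc θ₀ θ₁, ∀ t ∈ Icc θ₁ (θ₀ + 1), F (circ s) = F (circ t) → circ s = circ t := by
    intro s hs t ht he
    have h1 := h.on_left s hs
    have h2 := h.on_right t ht
    rw [← he] at h2
    have hAB := h.re_mem_of_left hs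
    have hx : (F (circ s)).re = A ∨ (F (circ s)).re = B := by
      by_contra! hcon
      exact hne _ ⟨lt_of_le_of_ne hAB.1 hcon.1.symm, lt_of_le_of_ne hAB.2 hcon.2⟩
        (h1.symm.trans h2)
    rcases hx with hx | hx
    · have e1 : s = θ₀ := h.mono.injOn hs ⟨le_rfl, h.lt.le⟩ (hx.trans h.left.symm)
      have e2 : t = θ₀ + 1 := h.anti.injOn ht ⟨h.lt'.le, le_rfl⟩
        (show (F (circ t)).re = _ from he ▸ hx.trans h.left'.symm)
      rw [e1, e2, circ_add_one]
    · have e1 : s = θ₁ := h.mono.injOn hs ⟨h.lt.le, le_rfl⟩ (hx.trans h.right.symm)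
      have e2 : t = θ₁ := h.anti.injOn ht ⟨le_rfl, h.lt'.le⟩
        (show (F (circ t)).re = _ from he ▸ hx.trans h.right.symm)
      rw [e1, e2]
  intro z hz w hw he
  obtain ⟨s, hs, rfl⟩ := exists_circ_eq (mem_sphere_zero_iff_norm.1 hz) θ₀
  obtain ⟨t, ht, rfl⟩ := exists_circ_eq (mem_sphere_zero_iff_norm.1 hw) θ₀
  rcases le_total s θ₁ with h1 | h1 <;> rcases le_total t θ₁ with h2 | h2
  · rw [h.mono.injOn ⟨hs.1, h1⟩ ⟨ht.1, h2⟩ (congrArg Complex.re he)]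
  · exact key s ⟨hs.1, h1⟩ t ⟨h2, ht.2.le⟩ he
  · exact (key t ⟨ht.1, h2⟩ s ⟨h1, hs.2.le⟩ he.symm).symm
  · rw [h.anti.injOn ⟨h1, hs.2.le⟩ ⟨h2, ht.2.le⟩ (congrArg Complex.re he)]

theorem injOn (h : GraphBoundary F u v A B θ₀ θ₁) (hF : ContinuousOn F (closedBall 0 1))
    (hI : IsImmersedDisc F) (hu : Continuous u) (hv : Continuous v) :
    InjOn F (closedBall 0 1) := by
  refine hI.injOn hF (h.injOn_sphere ?_) ?_
  · rcases h.lt_or_lt hF hI hu hv with h1 | h1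
    · exact fun x hx => (h1 x hx).ne
    · exact fun x hx => (h1 x hx).ne'
  · intro z hz w hw he
    obtain ⟨-, h1, h2⟩ := h.interior_mem hF hI hu hv hz
    have h3 := (h.boundary (mem_sphere_zero_iff_norm.1 hw)).2
    rw [← he] at h3
    rcases h3 with h3 | h3 <;> rw [h3] at h1 h2
    · rcases min_lt_iff.1 h1 with h1 | h1 <;> rcases lt_max_iff.1 h2 with h2 | h2 <;> linarith
    · rcases min_lt_iff.1 h1 with h1 | h1 <;> rcases lt_max_iff.1 h2 with h2 | h2 <;> linarith

/-- The lower boundary is the one which is traversed from left to right. -/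
theorem lower_lt_upper (h : GraphBoundary F u v A B θ₀ θ₁) (hF : ContinuousOn F (closedBall 0 1))
    (hI : IsImmersedDisc F) (hu : Continuous u) (hv : Continuous v) {x : ℝ} (hx : x ∈ Ioo A B) :
    u x < v x := by
  rcases h.lt_or_lt hF hI hu hv with h1 | h1
  · exact h1 x hx
  -- If the graph traversed to the right were the upper one, the boundary would go down on the right
  -- of `F 0` and up on its left, with winding number `-1` instead of `1`.
  exfalso
  have hw := hI.winds hF (h.injOn hF hI hu hv)
  obtain ⟨hp, hp1, hp2⟩ := h.interior_mem hF hI hu hv (z := 0) (by simp)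
  rw [min_eq_right (h1 _ hp).le] at hp1
  rw [max_eq_left (h1 _ hp).le] at hp2
  obtain ⟨t₁, ht₁, e1⟩ := h.surj_left hF ⟨hp.1.le, hp.2.le⟩
  obtain ⟨t₂, ht₂, e2⟩ := h.surj_right hF ⟨hp.1.le, hp.2.le⟩
  have := hw.eq_neg_one (t₁ := t₁) (t₂ := t₂) (ht₁.2.trans ht₂.1) (by linarith [ht₂.2, ht₁.1])
    (fun t ht => ?_) (fun t ht => ?_) ?_ ?_
  · norm_num at this
  · rw [Complex.sub_re, sub_nonneg]
    rcases le_total t θ₁ with h2 | h2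
    · rw [← e1]
      exact h.mono.monotoneOn ht₁ ⟨ht₁.1.trans ht.1, h2⟩ ht.1
    · rw [← e2]
      exact h.anti.antitoneOn ⟨h2, ht.2.trans ht₂.2⟩ ht₂ ht.2
  · rw [Complex.sub_re, sub_nonpos]
    rcases le_total t (θ₀ + 1) with h2 | h2
    · rw [← e2]
      exact h.anti.antitoneOn ht₂ ⟨ht₂.1.trans ht.1, h2⟩ ht.1
    · rw [← e1, show t = (t - 1) + 1 by ring, circ_add_one]
      exact h.mono.monotoneOn ⟨by linarith, by linarith [ht.2, ht₁.2]⟩ ht₁ (by linarith [ht.2])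
  · rw [Complex.sub_im, h.on_left _ ht₁, e1]
    linarith
  · rw [Complex.sub_im, h.on_right _ ht₂, e2]
    linarith

/-- The image of the disc is the region between the two graphs. -/
theorem image_eq (h : GraphBoundary F u v A B θ₀ θ₁) (hF : ContinuousOn F (closedBall 0 1))
    (hI : IsImmersedDisc F) (hu : Continuous u) (hv : Continuous v) :
    F '' closedBall 0 1 = {w | w.re ∈ Icc A B ∧ w.im ∈ Icc (u w.re) (v w.re)} := by
  have hlt : ∀ x ∈ Ioo A B, u x < v x := fun x hx => h.lower_lt_upper hF hI hu hv hx
  have hle : ∀ x ∈ Icc A B, u x ≤ v x := by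
    intro x hx
    rcases hx.1.eq_or_lt with rfl | h1
    · exact h.eq_left.le
    rcases hx.2.eq_or_lt with rfl | h2
    · exact h.eq_right.le
    exact (hlt x ⟨h1, h2⟩).le
  ext w
  constructor
  · rintro ⟨z, hz, rfl⟩
    rcases (mem_closedBall_zero_iff.1 hz).lt_or_eq with h1 | h1
    · obtain ⟨hx, h2, h3⟩ := h.interior_mem hF hI hu hv (mem_ball_zero_iff.2 h1)
      rw [min_eq_left (hlt _ hx).le] at h2
      rw [max_eq_right (hlt _ hx).le] at h3
      exact ⟨⟨hx.1.le, hx.2.le⟩, h2.le, h3.le⟩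
    · obtain ⟨hx, h2⟩ := h.boundary h1
      have := hle _ hx
      rcases h2 with h2 | h2
      · exact ⟨hx, h2.ge, h2.le.trans this⟩
      · exact ⟨hx, this.trans h2.ge, h2.le⟩
  · rintro ⟨hx, h1, h2⟩
    rcases h1.eq_or_lt with h1 | h1
    · obtain ⟨θ, hθ, he⟩ := h.surj_left hF hx
      exact ⟨_, circ_mem_closedBall θ, Complex.ext he (by rw [h.on_left θ hθ, he, h1])⟩
    rcases h2.eq_or_lt with h2 | h2
    · obtain ⟨θ, hθ, he⟩ := h.surj_right hF hx
      exact ⟨_, circ_mem_closedBall θ, Complex.ext he (by rw [h.on_right θ hθ, he, h2])⟩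
    have hx' : w.re ∈ Ioo A B := by
      constructor
      · refine lt_of_le_of_ne hx.1 fun he => ?_
        rw [← he, h.eq_left] at h1
        rw [← he] at h2
        exact h1.not_gt h2
      · refine lt_of_le_of_ne hx.2 fun he => ?_
        rw [he, h.eq_right] at h1
        rw [he] at h2
        exact h1.not_gt h2
    -- The open vertical segment through `w` between the graphs avoids the image of the boundary
    -- circle, so the open image of the open disc and the open complement of the closed image cover
    -- it. It meets the former, and by connectedness it cannot meet the latter.
    let S : Set ℂ := (fun y : ℝ => (⟨w.re, y⟩ : ℂ)) '' Ioo (u w.re) (v w.re)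
    have hS : IsPreconnected S := by
      refine isPreconnected_Ioo.image _ (Continuous.continuousOn ?_)
      have : (fun y : ℝ => (⟨w.re, y⟩ : ℂ)) = fun y : ℝ => (w.re : ℂ) + y * Complex.I := by
        funext y
        exact Complex.mk_eq_add_mul_I _ _
      rw [this]
      fun_prop
    have hop : IsOpen (F '' ball 0 1) := by
      rw [isOpen_iff_mem_nhds]
      rintro _ ⟨z, hz, rfl⟩
      exact hI.nhds_le_map hF hz (image_mem_map (isOpen_ball.mem_nhds hz))
    have hcl : IsOpen (F '' closedBall 0 1)ᶜ :=
      ((isCompact_closedBall (0 : ℂ) 1).image_of_continuousOn hF).isClosed.isOpen_compl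
    obtain ⟨z, hz, hzx⟩ := h.exists_interior hF hx'
    have hzS : F z ∈ S := by
      obtain ⟨hz1, hz2, hz3⟩ := h.interior_mem hF hI hu hv hz
      rw [min_eq_left (hlt _ hz1).le] at hz2
      rw [max_eq_right (hlt _ hz1).le] at hz3
      exact ⟨(F z).im, by rw [← hzx]; exact ⟨hz2, hz3⟩, Complex.ext hzx.symm rfl⟩
    have hwS : w ∈ S := ⟨w.im, ⟨h1, h2⟩, rfl⟩
    by_contra hcon
    have hsub : S ⊆ F '' ball 0 1 ∪ (F '' closedBall 0 1)ᶜ := by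
      rintro _ ⟨y, hy, rfl⟩
      by_cases hmem : (⟨w.re, y⟩ : ℂ) ∈ F '' closedBall 0 1
      · left
        obtain ⟨q, hq, he⟩ := hmem
        refine ⟨q, mem_ball_zero_iff.2 (lt_of_le_of_ne (mem_closedBall_zero_iff.1 hq) fun h1 => ?_),
          he⟩
        have h2 := (h.boundary h1).2
        rw [he] at h2
        rcases h2 with h2 | h2
        · exact hy.1.ne' h2
        · exact hy.2.ne h2
      · right
        exact hmem
    obtain ⟨p, hp, ⟨q, hq, hqp⟩, hp'⟩ := hS _ _ hop hcl hsub
      ⟨F z, hzS, mem_image_of_mem F hz⟩ ⟨w, hwS, hcon⟩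
    exact hp' ⟨q, ball_subset_closedBall hq, hqp⟩

end GraphBoundary

/-! ### Discs filling the region between two graphs -/

/-- The increasing piecewise linear map which takes `-1, 0, 1` to `A, c, B`. -/
def stretch (A c B x : ℝ) : ℝ := c + (c - A) * min x 0 + (B - c) * max x 0

section stretch

variable {A c B : ℝ}

@[fun_prop]
theorem continuous_stretch : Continuous (stretch A c B) := by
  unfold stretch
  fun_prop

@[simp] theorem stretch_zero : stretch A c B 0 = c := by simp [stretch]
@[simp] theorem stretch_one : stretch A c B 1 = B := by simp [stretch]
@[simp] theorem stretch_neg_one : stretch A c B (-1) = A := by simp [stretch]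

theorem strictMono_stretch (h1 : A < c) (h2 : c < B) : StrictMono (stretch A c B) := by
  intro x y hxy
  have k1 : min x 0 ≤ min y 0 := min_le_min_right 0 hxy.le
  have k2 : max x 0 ≤ max y 0 := max_le_max_right 0 hxy.le
  have k3 : min x 0 + max x 0 < min y 0 + max y 0 := by
    rw [min_add_max, min_add_max]
    linarith
  unfold stretch
  rcases k1.lt_or_eq with h | h
  · have := mul_lt_mul_of_pos_left h (sub_pos.2 h1)
    have := mul_le_mul_of_nonneg_left k2 (sub_pos.2 h2).le
    linarith
  · have := mul_lt_mul_of_pos_left (show max x 0 < max y 0 by linarith) (sub_pos.2 h2)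
    rw [h]
    linarith

end stretch

/-- The map of the disc to the region between the graphs of `lo` and `hi` over `[A, B]` which
preserves vertical lines and is affine on them. -/
def fill (A c B : ℝ) (lo hi : ℝ → ℝ) (z : ℂ) : ℂ :=
  ⟨stretch A c B z.re, (lo (stretch A c B z.re) + hi (stretch A c B z.re)) / 2 +
    z.im / √(1 - z.re ^ 2) * ((hi (stretch A c B z.re) - lo (stretch A c B z.re)) / 2)⟩

theorem sq_add_sq_le_one {z : ℂ} (hz : z ∈ closedBall (0 : ℂ) 1) : z.re ^ 2 + z.im ^ 2 ≤ 1 := by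
  have h := mem_closedBall_zero_iff.1 hz
  have h1 := Complex.sq_norm z
  rw [Complex.normSq_apply] at h1
  nlinarith [norm_nonneg z]

theorem sq_add_sq_eq_one {z : ℂ} (hz : ‖z‖ = 1) : z.re ^ 2 + z.im ^ 2 = 1 := by
  have h1 := Complex.sq_norm z
  rw [Complex.normSq_apply, hz] at h1
  linarith

theorem abs_im_div_sqrt_le {z : ℂ} (hz : z ∈ closedBall (0 : ℂ) 1) :
    |z.im / √(1 - z.re ^ 2)| ≤ 1 := by
  have := sq_add_sq_le_one hz
  rw [abs_div, abs_of_nonneg (Real.sqrt_nonneg _)]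
  refine div_le_one_of_le₀ (Real.abs_le_sqrt ?_) (Real.sqrt_nonneg _)
  linarith

section fill

variable {A c B : ℝ} {lo hi : ℝ → ℝ}

theorem fill_eq (z : ℂ) : fill A c B lo hi z = (stretch A c B z.re : ℝ) +
    (((lo (stretch A c B z.re) + hi (stretch A c B z.re)) / 2 +
    z.im / √(1 - z.re ^ 2) * ((hi (stretch A c B z.re) - lo (stretch A c B z.re)) / 2) : ℝ) : ℂ) *
      Complex.I :=
  Complex.mk_eq_add_mul_I _ _

/-- The quotient by the square root is not continuous at `± 1`, but it is bounded by `1` and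
multiplied by half the gap between the graphs, which vanishes there. -/
theorem continuousOn_fill (hlo : Continuous lo) (hhi : Continuous hi) (eA : lo A = hi A)
    (eB : lo B = hi B) : ContinuousOn (fill A c B lo hi) (closedBall 0 1) := by
  rw [funext fill_eq]
  have key : ContinuousOn (fun z : ℂ => z.im / √(1 - z.re ^ 2) *
      ((hi (stretch A c B z.re) - lo (stretch A c B z.re)) / 2)) (closedBall 0 1) := by
    intro z hz
    have hle := sq_add_sq_le_one hz
    have hh : Continuous fun z : ℂ =>
        (hi (stretch A c B z.re) - lo (stretch A c B z.re)) / 2 := by fun_prop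
    rcases (show z.re ^ 2 ≤ 1 by nlinarith).lt_or_eq with h | h
    · refine ContinuousAt.continuousWithinAt (ContinuousAt.mul ?_ hh.continuousAt)
      refine ContinuousAt.div (by fun_prop) (by fun_prop) ?_
      exact (Real.sqrt_pos.2 (by linarith)).ne'
    · have h0 : (hi (stretch A c B z.re) - lo (stretch A c B z.re)) / 2 = 0 := by
        rcases sq_eq_sq_iff_eq_or_eq_neg.1 (h.trans (one_pow 2).symm) with h | h <;> simp [h, eA, eB]
      rw [ContinuousWithinAt, h0, mul_zero]
      refine squeeze_zero_norm' (a := fun z : ℂ =>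
        |(hi (stretch A c B z.re) - lo (stretch A c B z.re)) / 2|) ?_ ?_
      · filter_upwards [self_mem_nhdsWithin] with w hw
        rw [norm_mul, Real.norm_eq_abs, Real.norm_eq_abs]
        exact mul_le_of_le_one_left (abs_nonneg _) (abs_im_div_sqrt_le hw)
      · have := (hh.abs.tendsto z).mono_left (nhdsWithin_le_nhds (s := closedBall 0 1))
        rwa [h0, abs_zero] at this
  have k1 : Continuous fun z : ℂ => (lo (stretch A c B z.re) + hi (stretch A c B z.re)) / 2 := by
    fun_prop
  have k2 : Continuous fun z : ℂ => ((stretch A c B z.re : ℝ) : ℂ) := by fun_prop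
  exact k2.continuousOn.add ((Complex.continuous_ofReal.comp_continuousOn
    (k1.continuousOn.add key)).mul continuousOn_const)

theorem injOn_fill (h1 : A < c) (h2 : c < B) (hlt : ∀ x ∈ Ioo A B, lo x < hi x) :
    InjOn (fill A c B lo hi) (closedBall 0 1) := by
  intro z hz w hw he
  have hre : z.re = w.re := (strictMono_stretch h1 h2).injective (congrArg Complex.re he)
  refine Complex.ext hre ?_
  have him := congrArg Complex.im he
  simp only [fill, ← hre, add_right_inj] at him
  have hz' := sq_add_sq_le_one hz
  have hw' := sq_add_sq_le_one hw
  rw [← hre] at hw'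
  rcases (show z.re ^ 2 ≤ 1 by nlinarith).lt_or_eq with h | h
  · have hs := (strictMono_stretch h1 h2)
    have h3 := abs_lt.1 ((sq_lt_one_iff_abs_lt_one _).1 h)
    have h4 := hlt (stretch A c B z.re) ⟨by simpa using hs h3.1, by simpa using hs h3.2⟩
    have h5 : (hi (stretch A c B z.re) - lo (stretch A c B z.re)) / 2 ≠ 0 := by linarith
    have h6 := mul_right_cancel₀ h5 him
    exact (div_left_inj' (Real.sqrt_pos.2 (by linarith)).ne').1 h6
  · have e1 : z.im = 0 := by nlinarith
    have e2 : w.im = 0 := by nlinarith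
    rw [e1, e2]

/-- On the upper semicircle the square root equals `z.im`, so the affine parameter is `1`. At `± 1`
it is `0 / 0 = 0`, which does no harm because the graphs meet there. -/
theorem fill_im_of_nonneg (eA : lo A = hi A) (eB : lo B = hi B) {z : ℂ} (hz : ‖z‖ = 1)
    (h : 0 ≤ z.im) : (fill A c B lo hi z).im = hi (fill A c B lo hi z).re := by
  have hz' := sq_add_sq_eq_one hz
  simp only [fill]
  rcases h.eq_or_lt with h | h
  · have : z.re ^ 2 = 1 := by nlinarith
    rcases sq_eq_sq_iff_eq_or_eq_neg.1 (this.trans (one_pow 2).symm) with h' | h' <;> simp [h', eA, eB]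
  · rw [show 1 - z.re ^ 2 = z.im ^ 2 by linarith, Real.sqrt_sq h.le, div_self h.ne']
    ring

theorem fill_im_of_nonpos (eA : lo A = hi A) (eB : lo B = hi B) {z : ℂ} (hz : ‖z‖ = 1)
    (h : z.im ≤ 0) : (fill A c B lo hi z).im = lo (fill A c B lo hi z).re := by
  have hz' := sq_add_sq_eq_one hz
  simp only [fill]
  rcases h.eq_or_lt with h | h
  · have : z.re ^ 2 = 1 := by nlinarith
    rcases sq_eq_sq_iff_eq_or_eq_neg.1 (this.trans (one_pow 2).symm) with h' | h' <;> simp [h', eA, eB]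
  · rw [show 1 - z.re ^ 2 = (-z.im) ^ 2 by linarith, Real.sqrt_sq (by linarith), div_neg,
      div_self h.ne]
    ring

/-- The straight line homotopy to the identity loop avoids `0`: the real parts of both loops have
the same sign, so a zero can only occur over the centre, and there the imaginary parts have the same
sign too. -/
theorem winds_fill (hlo : Continuous lo) (hhi : Continuous hi) (eA : lo A = hi A)
    (eB : lo B = hi B) (h1 : A < c) (h2 : c < B) (hlt : ∀ x ∈ Ioo A B, lo x < hi x) :
    Winds (fun t => fill A c B lo hi (circ t) - fill A c B lo hi 0) 1 := by
  have : PreconnectedSpace (Icc (0 : ℝ) 1) := Subtype.preconnectedSpace isPreconnected_Icc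
  have hc : Continuous fun t => fill A c B lo hi (circ t) :=
    (continuousOn_fill hlo hhi eA eB).comp_continuous continuous_circ circ_mem_closedBall
  let H : Icc (0 : ℝ) 1 → ℝ → ℂ := fun l t =>
    ((1 - l.1 : ℝ) : ℂ) * (fill A c B lo hi (circ t) - fill A c B lo hi 0) + (l.1 : ℂ) * circ t
  have h0 : Winds (H ⟨1, by simp⟩) 1 := by simpa [H] using winds_circ
  have : Winds (H ⟨0, by simp⟩) 1 := by
    refine Winds.homotopy ?_ ?_ ?_ h0
    · have := hc.comp (continuous_snd (X := Icc (0 : ℝ) 1))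
      refine Continuous.add (Continuous.mul (by fun_prop) ?_) (by fun_prop)
      exact this.sub continuous_const
    · intro p t
      simp [H]
    · rintro ⟨l, hl0, hl1⟩ t h
      have hz' := sq_add_sq_eq_one (norm_circ t)
      have hs := strictMono_stretch h1 h2
      have hre := congrArg Complex.re h
      have him := congrArg Complex.im h
      simp only [H, Complex.add_re, Complex.add_im, Complex.re_ofReal_mul, Complex.im_ofReal_mul,
        Complex.sub_re, Complex.sub_im, Complex.zero_re, Complex.zero_im] at hre him
      have f0 : (fill A c B lo hi 0).re = c := by simp [fill]
      have ft : (fill A c B lo hi (circ t)).re = stretch A c B (circ t).re := rfl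
      rw [f0, ft] at hre
      have hz : (circ t).re = 0 := by
        rcases lt_trichotomy (circ t).re 0 with hneg | h0 | hpos
        · have := hs hneg
          rw [stretch_zero] at this
          exfalso
          rcases hl0.eq_or_lt with rfl | hl0
          · linarith
          · nlinarith [mul_nonneg (sub_nonneg.2 hl1) (sub_nonneg.2 this.le), mul_pos hl0 (neg_pos.2 hneg)]
        · exact h0
        · have := hs hpos
          rw [stretch_zero] at this
          exfalso
          rcases hl0.eq_or_lt with rfl | hl0
          · linarith
          · nlinarith [mul_nonneg (sub_nonneg.2 hl1) (sub_nonneg.2 this.le), mul_pos hl0 hpos]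
      have hlt' := hlt c ⟨h1, h2⟩
      have e0 : (fill A c B lo hi 0).im = (lo c + hi c) / 2 := by simp [fill]
      have et : (fill A c B lo hi (circ t)).im =
          (lo c + hi c) / 2 + (circ t).im * ((hi c - lo c) / 2) := by simp [fill, hz]
      rw [e0, et] at him
      have h3 : (circ t).im * ((1 - l) * ((hi c - lo c) / 2) + l) = 0 := by linarith
      have h4 : 0 < (1 - l) * ((hi c - lo c) / 2) + l := by
        rcases hl0.eq_or_lt with rfl | hl0
        · linarith
        · have := mul_nonneg (sub_nonneg.2 hl1) (show 0 ≤ (hi c - lo c) / 2 by linarith)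
          linarith
      have h5 := (mul_eq_zero.1 h3).resolve_right h4.ne'
      rw [hz, h5] at hz'
      norm_num at hz'
  simpa [H] using this

end fill

/-! ### Moving the marked points -/

/-- A one parameter group of automorphisms of the disc fixing `± i`. -/
def mobius (τ : ℝ) (w : ℂ) : ℂ := (w + Complex.I * τ) / (1 - Complex.I * τ * w)

theorem mobius_denom_ne_zero {τ : ℝ} (hτ : τ ∈ Ioo (-1 : ℝ) 1) {w : ℂ}
    (hw : w ∈ closedBall (0 : ℂ) 1) : 1 - Complex.I * τ * w ≠ 0 := by
  intro h
  have h1 : ‖Complex.I * τ * w‖ = 1 := by rw [← sub_eq_zero.1 h]; simp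
  have hw' := mem_closedBall_zero_iff.1 hw
  rw [norm_mul, norm_mul, Complex.norm_I, one_mul, Complex.norm_real, Real.norm_eq_abs] at h1
  nlinarith [abs_lt.2 hτ, abs_nonneg τ, norm_nonneg w]

theorem mobius_mem {τ : ℝ} (hτ : τ ∈ Ioo (-1 : ℝ) 1) {w : ℂ} (hw : w ∈ closedBall (0 : ℂ) 1) :
    mobius τ w ∈ closedBall (0 : ℂ) 1 := by
  have h0 := mobius_denom_ne_zero hτ hw
  rw [mem_closedBall_zero_iff, mobius, norm_div, div_le_one (norm_pos_iff.2 h0)]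
  refine le_of_sq_le_sq ?_ (norm_nonneg _)
  have hw' := sq_add_sq_le_one hw
  rw [Complex.sq_norm, Complex.sq_norm, Complex.normSq_apply, Complex.normSq_apply]
  simp
  nlinarith [mul_nonneg (sub_nonneg.2 hw') (show 0 ≤ 1 - τ ^ 2 by nlinarith [hτ.1, hτ.2])]

theorem mobius_neg_mobius {τ : ℝ} (hτ : τ ∈ Ioo (-1 : ℝ) 1) {w : ℂ}
    (hw : w ∈ closedBall (0 : ℂ) 1) : mobius (-τ) (mobius τ w) = w := by
  have h0 := mobius_denom_ne_zero hτ hw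
  have h1 : (1 - τ ^ 2 : ℂ) ≠ 0 := by
    have : (1 - τ ^ 2 : ℝ) ≠ 0 := by nlinarith [hτ.1, hτ.2]
    exact_mod_cast this
  have hI : Complex.I ^ 2 = -1 := Complex.I_sq
  have e1 : w + Complex.I * τ + Complex.I * (-τ : ℝ) * (1 - Complex.I * τ * w) =
      w * (1 - τ ^ 2) := by
    push_cast
    linear_combination (τ ^ 2 * w : ℂ) * hI
  have e2 : (1 - Complex.I * τ * w) - Complex.I * (-τ : ℝ) * (w + Complex.I * τ) =
      1 - τ ^ 2 := by
    push_cast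
    linear_combination (τ ^ 2 : ℂ) * hI
  rw [mobius, mobius, div_add' _ _ _ h0, mul_div_assoc', one_sub_div h0, e1, e2,
    div_div_div_cancel_right₀ h0, mul_div_cancel_right₀ _ h1]

/-- The positive factor `a` is the inverse square norm of the denominator. It is left unspecified
because on the circle only the signs of the coordinates are needed to locate the images of the arcs.
-/
theorem mobius_of_norm_eq_one {τ : ℝ} (hτ : τ ∈ Ioo (-1 : ℝ) 1) {w : ℂ} (hw : ‖w‖ = 1) :
    ‖mobius τ w‖ = 1 ∧ ∃ a : ℝ, 0 < a ∧ (mobius τ w).re = a * ((1 - τ ^ 2) * w.re) ∧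
      (mobius τ w).im = a * ((1 + τ ^ 2) * w.im + 2 * τ) := by
  have hw1 : w ∈ closedBall (0 : ℂ) 1 := mem_closedBall_zero_iff.2 hw.le
  have h0 := mobius_denom_ne_zero hτ hw1
  have hw' := sq_add_sq_eq_one hw
  constructor
  · rw [mobius, norm_div, div_eq_one_iff_eq (norm_ne_zero_iff.2 h0)]
    refine (sq_eq_sq₀ (norm_nonneg _) (norm_nonneg _)).1 ?_
    rw [Complex.sq_norm, Complex.sq_norm, Complex.normSq_apply, Complex.normSq_apply]
    simp
    linear_combination (1 - τ ^ 2) * hw'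
  · refine ⟨(Complex.normSq (1 - Complex.I * τ * w))⁻¹, inv_pos.2 (Complex.normSq_pos.2 h0), ?_, ?_⟩
    · rw [mobius, Complex.div_re, ← add_div, div_eq_inv_mul]
      congr 1
      simp
      ring
    · rw [mobius, Complex.div_im, ← sub_div, div_eq_inv_mul]
      congr 1
      simp
      linear_combination τ * hw'

theorem circ_mul_mem (φ : ℝ) {z : ℂ} (hz : z ∈ closedBall (0 : ℂ) 1) :
    circ φ * z ∈ closedBall (0 : ℂ) 1 := by
  rw [mem_closedBall_zero_iff] at hz ⊢
  simpa using hz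

theorem continuousOn_mobius_circ {τ : ℝ} (hτ : τ ∈ Ioo (-1 : ℝ) 1) (φ : ℝ) :
    ContinuousOn (fun z => mobius τ (circ φ * z)) (closedBall 0 1) := by
  unfold mobius
  exact ContinuousOn.div (by fun_prop) (by fun_prop) fun z hz =>
    mobius_denom_ne_zero hτ (circ_mul_mem φ hz)

theorem injOn_mobius_circ {τ : ℝ} (hτ : τ ∈ Ioo (-1 : ℝ) 1) (φ : ℝ) :
    InjOn (fun z => mobius τ (circ φ * z)) (closedBall 0 1) := by
  intro z hz w hw he
  have := congrArg (mobius (-τ)) he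
  simp only [mobius_neg_mobius hτ (circ_mul_mem φ hz), mobius_neg_mobius hτ (circ_mul_mem φ hw)]
    at this
  exact mul_left_cancel₀ (circ_ne_zero φ) this

/-- Precomposition with automorphisms of the disc. -/
theorem isImmersedDisc_comp_mobius {H : ℂ → ℂ} (hH : ContinuousOn H (closedBall 0 1))
    (hinj : InjOn H (closedBall 0 1)) (hw : Winds (fun t => H (circ t) - H 0) 1)
    {τ : ℝ} (hτ : τ ∈ Ioo (-1 : ℝ) 1) (φ : ℝ) :
    ContinuousOn (fun z => H (mobius τ (circ φ * z))) (closedBall 0 1) ∧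
      IsImmersedDisc fun z => H (mobius τ (circ φ * z)) := by
  have hm : ∀ {τ : ℝ}, τ ∈ Ioo (-1 : ℝ) 1 → ∀ φ, MapsTo (fun z => mobius τ (circ φ * z))
      (closedBall 0 1) (closedBall 0 1) :=
    fun hτ φ z hz => mobius_mem hτ (circ_mul_mem φ hz)
  have hc := hH.comp (continuousOn_mobius_circ hτ φ) (hm hτ φ)
  refine ⟨hc, isImmersedDisc_of_injOn hc (hinj.comp (injOn_mobius_circ hτ φ) (hm hτ φ)) ?_⟩
  have : PreconnectedSpace (Ioo (-1 : ℝ) 1) := Subtype.preconnectedSpace isPreconnected_Ioo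
  -- The automorphisms form a connected family with the identity at `(0, 0)`, so the winding number
  -- is that of `H` itself.
  let K : Ioo (-1 : ℝ) 1 × ℝ → ℝ → ℂ := fun p t =>
    H (mobius p.1.1 (circ p.2 * circ t)) - H (mobius p.1.1 0)
  have h0 : Winds (K (⟨0, by norm_num⟩, 0)) 1 := by simpa [K, mobius] using hw
  have h1 : Winds (K (⟨τ, hτ⟩, φ)) 1 := by
    refine Winds.homotopy ?_ ?_ ?_ h0
    · refine Continuous.sub (hH.comp_continuous ?_ fun x =>
        hm x.1.1.2 x.1.2 (circ_mem_closedBall _)) (hH.comp_continuous ?_ fun x =>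
        mobius_mem x.1.1.2 (by simp))
      · unfold mobius
        exact Continuous.div (by fun_prop) (by fun_prop) fun x =>
          mobius_denom_ne_zero x.1.1.2 (circ_mul_mem _ (circ_mem_closedBall _))
      · unfold mobius
        exact Continuous.div (by fun_prop) (by fun_prop) fun x =>
          mobius_denom_ne_zero x.1.1.2 (by simp)
    · intro p t
      simp [K]
    · intro p t h
      have e1 := hinj (hm p.1.2 p.2 (circ_mem_closedBall t)) (mobius_mem p.1.2 (by simp))
        (sub_eq_zero.1 h)
      have e2 := congrArg (mobius (-p.1.1)) e1
      simp only [mobius_neg_mobius p.1.2 (circ_mul_mem p.2 (circ_mem_closedBall t)),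
        mobius_neg_mobius p.1.2 (show (0 : ℂ) ∈ closedBall (0 : ℂ) 1 by simp)] at e2
      exact mul_ne_zero (circ_ne_zero _) (circ_ne_zero _) e2
  simpa [K] using h1

/-! ### Immersed polygons with sides on graphs -/

/-- A continuous function on an interval which is locally injective is injective. -/
theorem injOn_of_locally_injOn {x : ℝ → ℝ} {a b : ℝ} (hx : ContinuousOn x (Icc a b))
    (h : ∀ t ∈ Icc a b, ∃ U ∈ 𝓝 t, InjOn x (U ∩ Icc a b)) : InjOn x (Icc a b) := by
  have key : ∀ s ∈ Icc a b, ∀ t ∈ Icc a b, s < t → x s ≠ x t := by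
    intro s hs t ht hst he
    -- Equal values at two points produce a local extremum in between, which is incompatible with
    -- strict monotonicity near it.
    obtain ⟨c, hc, hext⟩ := exists_isLocalExtr_Ioo hst (hx.mono (Icc_subset_Icc hs.1 ht.2)) he
    have hcab : c ∈ Ioo a b := ⟨hs.1.trans_lt hc.1, hc.2.trans_le ht.2⟩
    obtain ⟨U, hU, hinj⟩ := h c ⟨hcab.1.le, hcab.2.le⟩
    obtain ⟨δ, hδ, hδU⟩ := Metric.nhds_basis_closedBall.mem_iff.1
      (inter_mem hU (Icc_mem_nhds hcab.1 hcab.2))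
    rw [Real.closedBall_eq_Icc] at hδU
    have hle : c - δ ≤ c + δ := by linarith
    have hmono := (hx.mono (hδU.trans inter_subset_right)).strictMonoOn_of_injOn_Icc' hle
      (hinj.mono hδU)
    have hl : ∀ᶠ y in 𝓝[<] c, y ∈ Icc (c - δ) (c + δ) ∧ y < c := by
      filter_upwards [self_mem_nhdsWithin,
        mem_nhdsWithin_of_mem_nhds (Icc_mem_nhds (show c - δ < c by linarith)
          (show c < c + δ by linarith))] with y h1 h2
      exact ⟨h2, h1⟩
    have hr : ∀ᶠ y in 𝓝[>] c, y ∈ Icc (c - δ) (c + δ) ∧ c < y := by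
      filter_upwards [self_mem_nhdsWithin,
        mem_nhdsWithin_of_mem_nhds (Icc_mem_nhds (show c - δ < c by linarith)
          (show c < c + δ by linarith))] with y h1 h2
      exact ⟨h2, h1⟩
    have hcm : c ∈ Icc (c - δ) (c + δ) := ⟨by linarith, by linarith⟩
    rcases hext with hext | hext <;> rcases hmono with hm | hm
    · obtain ⟨y, ⟨hy1, hy2⟩, hy3⟩ := (hl.and (hext.filter_mono nhdsWithin_le_nhds)).exists
      exact absurd (hm hy1 hcm hy2) (not_lt.2 hy3)
    · obtain ⟨y, ⟨hy1, hy2⟩, hy3⟩ := (hr.and (hext.filter_mono nhdsWithin_le_nhds)).exists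
      exact absurd (hm hcm hy1 hy2) (not_lt.2 hy3)
    · obtain ⟨y, ⟨hy1, hy2⟩, hy3⟩ := (hr.and (hext.filter_mono nhdsWithin_le_nhds)).exists
      exact absurd (hm hcm hy1 hy2) (not_lt.2 hy3)
    · obtain ⟨y, ⟨hy1, hy2⟩, hy3⟩ := (hl.and (hext.filter_mono nhdsWithin_le_nhds)).exists
      exact absurd (hm hy1 hcm hy2) (not_lt.2 hy3)
  intro s hs t ht he
  rcases lt_trichotomy s t with h1 | h1 | h1
  · exact absurd he (key s hs t ht h1)
  · exact h1
  · exact absurd he.symm (key t ht s hs h1)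

/-- `F` is an immersed `N`-gon whose `j`-th side lies on the graph of `f j`, and whose `j`-th corner
has first coordinate `X j`; indices are read modulo `N`. -/
structure Sides (N : ℕ) (f : ℕ → ℝ → ℝ) (X : ℕ → ℝ) (F : ℂ → ℂ) : Prop where
  cont : ContinuousOn F (closedBall 0 1)
  imm : IsImmersedDisc F
  side : ∀ (j : ℕ) (θ : ℝ), θ ∈ Icc ((j : ℝ) / N) ((j + 1 : ℝ) / N) →
    (F (circ θ)).im = f j (F (circ θ)).re
  corner : ∀ j : ℕ, (F (circ ((j : ℝ) / N))).re = X j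

namespace Sides

variable {N : ℕ} {f : ℕ → ℝ → ℝ} {X : ℕ → ℝ} {F : ℂ → ℂ}

theorem corner' (h : Sides N f X F) (j : ℕ) : (F (circ ((j + 1 : ℝ) / N))).re = X (j + 1) := by
  have := h.corner (j + 1)
  push_cast at this
  exact this

theorem lt_add_one (hN : 0 < N) (j : ℕ) : (j : ℝ) / N < (j + 1 : ℝ) / N := by
  have : (0 : ℝ) < N := by exact_mod_cast hN
  gcongr
  linarith

theorem agree (h : Sides N f X F) (hN : 0 < N) (j : ℕ) : f j (X (j + 1)) = f (j + 1) (X (j + 1)) := by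
  have hlt := lt_add_one hN j
  have h1 := h.side j _ ⟨hlt.le, le_rfl⟩
  have h2 := h.side (j + 1) ((j + 1 : ℝ) / N) (by
    push_cast
    have := lt_add_one hN (j + 1)
    push_cast at this
    exact ⟨le_rfl, this.le⟩)
  rw [h.corner'] at h1 h2
  rw [← h1, h2]

theorem cont_circ (h : Sides N f X F) : Continuous fun θ => (F (circ θ)).re :=
  Complex.continuous_re.comp (GraphBoundary.continuous_circ_comp h.cont)

/-- Since a side lies on a graph, the abscissa determines the point; local injectivity of `F`
therefore passes to the abscissa, a real function of one variable. -/
theorem injOn_side (h : Sides N f X F) (j : ℕ) :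
    InjOn (fun θ => (F (circ θ)).re) (Icc ((j : ℝ) / N) ((j + 1 : ℝ) / N)) := by
  refine injOn_of_locally_injOn h.cont_circ.continuousOn fun t ht => ?_
  obtain ⟨U, hU, hinj⟩ := h.imm.1 (circ t) (circ_mem_closedBall t)
  have hpre := continuous_circ.continuousAt.preimage_mem_nhds hU
  -- A window of length `1` makes `circ` injective on it.
  refine ⟨circ ⁻¹' U ∩ Ioo (t - 1 / 2) (t + 1 / 2),
    inter_mem hpre (Ioo_mem_nhds (by linarith) (by linarith)), ?_⟩
  rintro s ⟨⟨hs, hs1, hs2⟩, hs3⟩ s' ⟨⟨hs', hs1', hs2'⟩, hs3'⟩ he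
  have he' : F (circ s) = F (circ s') := Complex.ext he (by
    rw [h.side j s hs3, h.side j s' hs3']
    exact congrArg _ he)
  have := hinj ⟨hs, circ_mem_closedBall s⟩ ⟨hs', circ_mem_closedBall s'⟩ he'
  obtain ⟨n, hn⟩ := circ_eq_circ.1 this
  have h1 : (-1 : ℝ) < n := by linarith
  have h2 : (n : ℝ) < 1 := by linarith
  have h3 : -1 < n := by exact_mod_cast h1
  have h4 : n < 1 := by exact_mod_cast h2
  have : n = 0 := by omega
  rw [hn, this]
  simp

theorem ne (h : Sides N f X F) (hN : 0 < N) (j : ℕ) : X j ≠ X (j + 1) := by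
  intro he
  have hlt := lt_add_one hN j
  rw [← h.corner, ← h.corner'] at he
  exact hlt.ne (h.injOn_side j ⟨le_rfl, hlt.le⟩ ⟨hlt.le, le_rfl⟩ he)

theorem mono (h : Sides N f X F) (hN : 0 < N) {j : ℕ} (hX : X j < X (j + 1)) :
    StrictMonoOn (fun θ => (F (circ θ)).re) (Icc ((j : ℝ) / N) ((j + 1 : ℝ) / N)) := by
  have hlt := lt_add_one hN j
  rcases h.cont_circ.continuousOn.strictMonoOn_of_injOn_Icc' hlt.le (h.injOn_side j) with h1 | h1
  · exact h1
  · have := h1 ⟨le_rfl, hlt.le⟩ ⟨hlt.le, le_rfl⟩ hlt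
    simp only [h.corner, h.corner'] at this
    exact absurd this hX.not_gt

theorem anti (h : Sides N f X F) (hN : 0 < N) {j : ℕ} (hX : X (j + 1) < X j) :
    StrictAntiOn (fun θ => (F (circ θ)).re) (Icc ((j : ℝ) / N) ((j + 1 : ℝ) / N)) := by
  have hlt := lt_add_one hN j
  rcases h.cont_circ.continuousOn.strictMonoOn_of_injOn_Icc' hlt.le (h.injOn_side j) with h1 | h1
  · have := h1 ⟨le_rfl, hlt.le⟩ ⟨hlt.le, le_rfl⟩ hlt
    simp only [h.corner, h.corner'] at this
    exact absurd this hX.not_gt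
  · exact h1

theorem image_side (h : Sides N f X F) (hN : 0 < N) (j : ℕ) :
    (fun θ => (F (circ θ)).re) '' (Icc ((j : ℝ) / N) ((j + 1 : ℝ) / N)) =
      uIcc (X j) (X (j + 1)) := by
  have hlt := lt_add_one hN j
  refine Subset.antisymm ?_ ?_
  · rintro _ ⟨θ, hθ, rfl⟩
    rcases lt_or_gt_of_ne (h.ne hN j) with h1 | h1
    · have hm := (h.mono hN h1).monotoneOn
      rw [uIcc_of_le h1.le, ← h.corner, ← h.corner']
      exact ⟨hm ⟨le_rfl, hlt.le⟩ hθ hθ.1, hm hθ ⟨hlt.le, le_rfl⟩ hθ.2⟩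
    · have hm := (h.anti hN h1).antitoneOn
      rw [uIcc_of_ge h1.le, ← h.corner', ← h.corner j]
      exact ⟨hm hθ ⟨hlt.le, le_rfl⟩ hθ.2, hm ⟨le_rfl, hlt.le⟩ hθ hθ.1⟩
  · have := intermediate_value_uIcc (a := (j : ℝ) / N) (b := (j + 1 : ℝ) / N)
      (f := fun θ => (F (circ θ)).re) h.cont_circ.continuousOn
    simp only [h.corner, h.corner'] at this
    rwa [uIcc_of_le hlt.le] at this

theorem image_arc (h : Sides N f X F) (hN : 0 < N) (j : ℕ) :
    F '' (circ '' (Icc ((j : ℝ) / N) ((j + 1 : ℝ) / N))) =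
      {w | w.re ∈ uIcc (X j) (X (j + 1)) ∧ w.im = f j w.re} := by
  rw [← h.image_side hN]
  ext w
  constructor
  · rintro ⟨_, ⟨θ, hθ, rfl⟩, rfl⟩
    exact ⟨⟨θ, hθ, rfl⟩, h.side j θ hθ⟩
  · rintro ⟨⟨θ, hθ, he⟩, hw⟩
    have he' : (F (circ θ)).re = w.re := he
    exact ⟨_, ⟨θ, hθ, rfl⟩, Complex.ext he (by rw [h.side j θ hθ, he', hw])⟩

end Sides

theorem IsImmersedDisc.sub_const {F : ℂ → ℂ} (h : IsImmersedDisc F) (c : ℂ) :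
    IsImmersedDisc fun z => F z - c := by
  have hi : ∀ S : Set ℂ, InjOn F S → InjOn (fun z => F z - c) S := fun S hS z hz w hw he =>
    hS hz hw (sub_left_injective he)
  refine ⟨fun z hz => ?_, fun z hz => ?_⟩
  · obtain ⟨U, hU, hinj⟩ := h.1 z hz
    exact ⟨U, hU, hi _ hinj⟩
  · obtain ⟨r, hr, hs, hinj, hw⟩ := h.2 z hz
    exact ⟨r, hr, hs, hi _ hinj, by simpa only [sub_sub_sub_cancel_right] using hw⟩

/-- For comparing two lifts of polygons whose corners agree only up to a lattice translation `c`. -/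
theorem Sides.sub_const {N : ℕ} {f f' : ℕ → ℝ → ℝ} {X X' : ℕ → ℝ} {F : ℂ → ℂ}
    (h : Sides N f' X' F) (c : ℂ) (hX : ∀ j, X' j = X j + c.re)
    (hf : ∀ j x, f' j (x + c.re) = f j x + c.im) : Sides N f X fun z => F z - c where
  cont := h.cont.sub continuousOn_const
  imm := h.imm.sub_const c
  side j θ hθ := by
    have := hf j ((F (circ θ)).re - c.re)
    rw [sub_add_cancel] at this
    rw [Complex.sub_im, h.side j θ hθ, this, Complex.sub_re, add_sub_cancel_right]
  corner j := by rw [Complex.sub_re, h.corner, hX, add_sub_cancel_right]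

/-! ### Bigons -/

section Bigon

variable {f : ℕ → ℝ → ℝ} {X : ℕ → ℝ} {F : ℂ → ℂ}

theorem Sides.graphBoundary_bigon (h : Sides 2 f X F) (hX : ∀ j, X (j + 2) = X j) {k : ℕ}
    (hlt : X k < X (k + 1)) :
    GraphBoundary F (f k) (f (k + 1)) (X k) (X (k + 1)) ((k : ℝ) / 2) ((k + 1 : ℝ) / 2) where
  lt := by linarith
  lt' := by linarith
  left := h.corner k
  right := h.corner' k
  mono := h.mono two_pos hlt
  anti := by
    have := h.anti (j := k + 1) two_pos (by rwa [hX])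
    push_cast at this
    rwa [show (k : ℝ) / 2 + 1 = (k + 1 + 1 : ℝ) / 2 by ring]
  on_left := h.side k
  on_right θ hθ := by
    refine h.side (k + 1) θ ?_
    push_cast
    rwa [show (k + 1 + 1 : ℝ) / 2 = (k : ℝ) / 2 + 1 by ring]

/-- The rotation by `1/2 - k/2` turns moves the marked points `k` and `k + 1` to `-1` and `1`, so
that side `k` becomes the lower semicircle and `fill` sends it to the lower graph. -/
theorem exists_sides_bigon (hfc : ∀ j, Continuous (f j)) (hf : ∀ j, f (j + 2) = f j)
    (hX : ∀ j, X (j + 2) = X j) {k : ℕ} (hlt : X k < X (k + 1))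
    (h1 : f k (X k) = f (k + 1) (X k)) (h2 : f k (X (k + 1)) = f (k + 1) (X (k + 1)))
    (hff : ∀ x ∈ Ioo (X k) (X (k + 1)), f k x < f (k + 1) x) : ∃ F, Sides 2 f X F := by
  have hm1 : X k < (X k + X (k + 1)) / 2 := by linarith
  have hm2 : (X k + X (k + 1)) / 2 < X (k + 1) := by linarith
  obtain ⟨hc, hi⟩ := isImmersedDisc_comp_mobius
    (continuousOn_fill (hfc k) (hfc (k + 1)) h1 h2 (c := (X k + X (k + 1)) / 2))
    (injOn_fill hm1 hm2 hff) (winds_fill (hfc k) (hfc (k + 1)) h1 h2 hm1 hm2 hff)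
    (τ := 0) (by norm_num) (1 / 2 - k / 2)
  have hcirc : ∀ θ, mobius 0 (circ (1 / 2 - k / 2) * circ θ) = circ (1 / 2 - k / 2 + θ) := by
    intro θ
    simp [mobius, circ_add]
  -- This is `r = j - k` modulo `2`, written without subtraction; multiples of the period stand on
  -- both sides.
  have hred : ∀ j : ℕ, ∃ (r M : ℕ) (M' : ℕ), r < 2 ∧ j + 2 * M = k + r + 2 * M' := fun j =>
    ⟨(j + k) % 2, k, (j + k) / 2, Nat.mod_lt _ two_pos, by omega⟩
  have hper : ∀ {Y : Type} (g : ℕ → Y), (∀ j, g (j + 2) = g j) → ∀ j M, g (j + 2 * M) = g j := by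
    intro Y g hg j M
    induction M with
    | zero => rfl
    | succ M ih => rw [← ih, ← hg (j + 2 * M)]; congr 1
  refine ⟨_, hc, hi, fun j θ hθ => ?_, fun j => ?_⟩
  · rw [hcirc]
    obtain ⟨r, M, M', hr, he⟩ := hred j
    have he' : (j : ℝ) + 2 * M = k + r + 2 * M' := by exact_mod_cast he
    have e1 : f j = f (k + r) := by rw [← hper f hf j M, he, hper f hf]
    have e2 : circ (1 / 2 - k / 2 + θ) = circ (1 / 2 - k / 2 + (θ + M - M')) :=
      circ_eq_circ.2 ⟨M' - M, by push_cast; ring⟩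
    rw [e1, e2]
    obtain ⟨t1, t2⟩ := hθ
    push_cast at t1 t2
    have hpi := Real.pi_pos
    interval_cases r
    · refine fill_im_of_nonpos h1 h2 (norm_circ _) ?_
      rw [circ_im, show 2 * Real.pi * (1 / 2 - (k : ℝ) / 2 + (θ + M - M')) =
        2 * Real.pi * ((θ + M - M') - k / 2) + Real.pi by ring, Real.sin_add_pi]
      push_cast at he'
      refine neg_nonpos.2 (Real.sin_nonneg_of_nonneg_of_le_pi ?_ ?_)
      · exact mul_nonneg (by positivity) (by linarith)
      · nlinarith
    · refine fill_im_of_nonneg h1 h2 (norm_circ _) ?_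
      rw [circ_im, show 2 * Real.pi * (1 / 2 - (k : ℝ) / 2 + (θ + M - M')) =
        2 * Real.pi * ((θ + M - M') - k / 2 - 1 / 2) + 2 * Real.pi by ring, Real.sin_add_two_pi]
      push_cast at he'
      refine Real.sin_nonneg_of_nonneg_of_le_pi ?_ ?_
      · exact mul_nonneg (by positivity) (by linarith)
      · nlinarith
  · rw [hcirc]
    obtain ⟨r, M, M', hr, he⟩ := hred j
    have he' : (j : ℝ) + 2 * M = k + r + 2 * M' := by exact_mod_cast he
    have e1 : X j = X (k + r) := by rw [← hper X hX j M, he, hper X hX]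
    have e2 : circ (1 / 2 - k / 2 + (j : ℝ) / (2 : ℕ)) = circ (1 / 2 + (r : ℝ) / 2) :=
      circ_eq_circ.2 ⟨M' - M, by push_cast; linarith⟩
    rw [e1, e2]
    interval_cases r
    · have : (circ (1 / 2 + ((0 : ℕ) : ℝ) / 2)).re = -1 := by
        rw [circ_re, show 2 * Real.pi * (1 / 2 + ((0 : ℕ) : ℝ) / 2) = Real.pi by push_cast; ring,
          Real.cos_pi]
      simp only [fill, this, stretch_neg_one, add_zero]
    · have : (circ (1 / 2 + ((1 : ℕ) : ℝ) / 2)).re = 1 := by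
        rw [circ_re, show 2 * Real.pi * (1 / 2 + ((1 : ℕ) : ℝ) / 2) = 2 * Real.pi by
          push_cast; ring, Real.cos_two_pi]
      simp only [fill, this, stretch_one]

theorem Sides.bigon (h : Sides 2 f X F) (hfc : ∀ j, Continuous (f j))
    (hX : ∀ j, X (j + 2) = X j) {k : ℕ} (hlt : X k < X (k + 1)) :
    (∀ x ∈ Ioo (X k) (X (k + 1)), f k x < f (k + 1) x) ∧ InjOn F (closedBall 0 1) ∧
      F '' closedBall 0 1 = {w | w.re ∈ Icc (X k) (X (k + 1)) ∧
        w.im ∈ Icc (f k w.re) (f (k + 1) w.re)} := by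
  have hb := h.graphBoundary_bigon hX hlt
  exact ⟨fun x hx => hb.lower_lt_upper h.cont h.imm (hfc _) (hfc _) hx,
    hb.injOn h.cont h.imm (hfc _) (hfc _), hb.image_eq h.cont h.imm (hfc _) (hfc _)⟩

theorem Sides.bigon_unique {G : ℂ → ℂ} (h : Sides 2 f X F) (h' : Sides 2 f X G)
    (hfc : ∀ j, Continuous (f j)) (hX : ∀ j, X (j + 2) = X j) :
    InjOn F (closedBall 0 1) ∧ InjOn G (closedBall 0 1) ∧
      F '' closedBall 0 1 = G '' closedBall 0 1 := by
  have key : ∀ k, X k < X (k + 1) → InjOn F (closedBall 0 1) ∧ InjOn G (closedBall 0 1) ∧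
      F '' closedBall 0 1 = G '' closedBall 0 1 := by
    intro k hlt
    obtain ⟨-, h1, h2⟩ := h.bigon hfc hX hlt
    obtain ⟨-, h1', h2'⟩ := h'.bigon hfc hX hlt
    exact ⟨h1, h1', h2.trans h2'.symm⟩
  rcases lt_or_gt_of_ne (h.ne two_pos 0) with h1 | h1
  · exact key 0 h1
  · exact key 1 (by rwa [← hX 0] at h1)

end Bigon

/-! ### Triangles -/

section Triangle

variable {f : ℕ → ℝ → ℝ} {X : ℕ → ℝ} {F : ℂ → ℂ}

/-- The function which is `g` up to `c`, and `h` afterwards. -/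
def glue (g h : ℝ → ℝ) (c x : ℝ) : ℝ := if x ≤ c then g x else h x

theorem continuous_glue {g h : ℝ → ℝ} {c : ℝ} (hg : Continuous g) (hh : Continuous h)
    (he : g c = h c) : Continuous (glue g h c) :=
  Continuous.if_le hg hh continuous_id continuous_const fun x hx => by
    rw [show x = c from hx, he]

theorem glue_of_le {g h : ℝ → ℝ} {c x : ℝ} (hx : x ≤ c) : glue g h c x = g x := if_pos hx

theorem glue_of_ge {g h : ℝ → ℝ} {c x : ℝ} (he : g c = h c) (hx : c ≤ x) :
    glue g h c x = h x := by
  rcases hx.eq_or_lt with rfl | hx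
  · rw [glue_of_le le_rfl, he]
  · exact if_neg hx.not_ge

theorem cos_two_pi_mul_ge {x : ℝ} (hx : |x| ≤ 1 / 3) : -(1 / 2) ≤ Real.cos (2 * Real.pi * x) := by
  have hpi := Real.pi_pos
  have h0 : Real.cos (2 * Real.pi * (1 / 3)) = -(1 / 2) := by
    rw [show 2 * Real.pi * (1 / 3) = Real.pi - Real.pi / 3 by ring, Real.cos_pi_sub,
      Real.cos_pi_div_three]
  rw [← h0, ← Real.cos_abs (2 * Real.pi * x), abs_mul, abs_of_pos (by positivity : 0 < 2 * Real.pi)]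
  exact Real.cos_le_cos_of_nonneg_of_le_pi (by positivity) (by linarith) (by gcongr)

theorem cos_two_pi_mul_le {x : ℝ} (hx : |x - 1 / 2| ≤ 1 / 6) :
    Real.cos (2 * Real.pi * x) ≤ -(1 / 2) := by
  have hpi := Real.pi_pos
  have h : Real.cos (Real.pi / 3) ≤ Real.cos (2 * Real.pi * (x - 1 / 2)) := by
    rw [← Real.cos_abs (2 * Real.pi * (x - 1 / 2)), abs_mul,
      abs_of_pos (by positivity : 0 < 2 * Real.pi)]
    refine Real.cos_le_cos_of_nonneg_of_le_pi (by positivity) (by linarith) ?_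
    nlinarith
  rw [Real.cos_pi_div_three] at h
  rw [show 2 * Real.pi * x = 2 * Real.pi * (x - 1 / 2) + Real.pi by ring, Real.cos_add_pi]
  linarith

/-- The automorphism of the disc which takes the marked points `k, k + 1, k + 2` of a triangle
to `ε i, - ε, ε`, where `ε = ± 1`. -/
theorem exists_mobius_marks (ε : ℝ) (hε : ε = 1 ∨ ε = -1) : ∃ τ ∈ Ioo (-1 : ℝ) 1, ∀ ψ : ℝ,
    ‖mobius τ (circ (ψ + ε / 4))‖ = 1 ∧ ∃ a b : ℝ, 0 < a ∧ 0 < b ∧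
      (mobius τ (circ (ψ + ε / 4))).re = -(ε * (a * Real.sin (2 * Real.pi * ψ))) ∧
      (mobius τ (circ (ψ + ε / 4))).im = ε * (b * (Real.cos (2 * Real.pi * ψ) + 1 / 2)) := by
  have h3 : √3 ^ 2 = 3 := Real.sq_sqrt (by norm_num)
  have h1 : 1 < √3 := by nlinarith [Real.sqrt_nonneg 3]
  have h2 : √3 < 2 := by nlinarith [Real.sqrt_nonneg 3]
  -- For `ε = 1` the last two marked points have imaginary part `-1/2`; sending them to the real
  -- axis requires `τ ^ 2 - 4 * τ + 1 = 0`, whose root in the unit interval is `2 - √3`. The case `ε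
  -- = -1` is its mirror image.
  have hτ : ε * (2 - √3) ∈ Ioo (-1 : ℝ) 1 := by
    rcases hε with rfl | rfl <;> constructor <;> linarith
  have hε2 : ε ^ 2 = 1 := by rcases hε with rfl | rfl <;> norm_num
  refine ⟨_, hτ, fun ψ => ?_⟩
  obtain ⟨hn, a, ha, hre, him⟩ := mobius_of_norm_eq_one hτ (norm_circ (ψ + ε / 4))
  refine ⟨hn, a * (1 - (2 - √3) ^ 2), a * (4 * (2 - √3)), mul_pos ha (by nlinarith),
    mul_pos ha (by linarith), ?_, ?_⟩
  · rw [hre, circ_re]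
    have : Real.cos (2 * Real.pi * (ψ + ε / 4)) = -(ε * Real.sin (2 * Real.pi * ψ)) := by
      rcases hε with rfl | rfl
      · rw [show 2 * Real.pi * (ψ + 1 / 4) = 2 * Real.pi * ψ + Real.pi / 2 by ring,
          Real.cos_add_pi_div_two, one_mul]
      · rw [show 2 * Real.pi * (ψ + -1 / 4) = 2 * Real.pi * ψ - Real.pi / 2 by ring,
          Real.cos_sub_pi_div_two, neg_one_mul, neg_neg]
    rw [this]
    linear_combination (a * (2 - √3) ^ 2 * (ε * Real.sin (2 * Real.pi * ψ))) * hε2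
  · rw [him, circ_im]
    have : Real.sin (2 * Real.pi * (ψ + ε / 4)) = ε * Real.cos (2 * Real.pi * ψ) := by
      rcases hε with rfl | rfl
      · rw [show 2 * Real.pi * (ψ + 1 / 4) = 2 * Real.pi * ψ + Real.pi / 2 by ring,
          Real.sin_add_pi_div_two, one_mul]
      · rw [show 2 * Real.pi * (ψ + -1 / 4) = 2 * Real.pi * ψ - Real.pi / 2 by ring,
          Real.sin_sub_pi_div_two, neg_one_mul]
    rw [this]
    linear_combination (a * (2 - √3) ^ 2 * ε * Real.cos (2 * Real.pi * ψ)) * hε2 +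
      (a * ε * Real.cos (2 * Real.pi * ψ)) * h3

/-- Corner `k` has the middle abscissa, hence the stretching centre `X k`. For `ε = 1` it lies on
the upper graph, made of sides `k` and `k + 2`, and side `k + 1` is the lower graph; for `ε = -1`
the roles of top and bottom are exchanged. -/
theorem exists_sides_triangle (hf : ∀ j, f (j + 3) = f j) (hX : ∀ j, X (j + 3) = X j) (k : ℕ)
    {ε : ℝ} (hε : ε = 1 ∨ ε = -1) {A B : ℝ} {lo hi : ℝ → ℝ} (hA : A < X k) (hB : X k < B)
    (hlo : Continuous lo) (hhi : Continuous hi) (eA : lo A = hi A) (eB : lo B = hi B)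
    (hlt : ∀ x ∈ Ioo A B, lo x < hi x)
    (hpos : ε = 1 → X (k + 1) = A ∧ X (k + 2) = B ∧ f (k + 1) = lo ∧
      (∀ x ≤ X k, hi x = f k x) ∧ ∀ x, X k ≤ x → hi x = f (k + 2) x)
    (hneg : ε = -1 → X (k + 1) = B ∧ X (k + 2) = A ∧ f (k + 1) = hi ∧
      (∀ x ≤ X k, lo x = f (k + 2) x) ∧ ∀ x, X k ≤ x → lo x = f k x) :
    ∃ F, Sides 3 f X F := by
  obtain ⟨τ, hτ, hm⟩ := exists_mobius_marks ε hε
  obtain ⟨hc, hi'⟩ := isImmersedDisc_comp_mobius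
    (continuousOn_fill hlo hhi eA eB (c := X k))
    (injOn_fill hA hB hlt) (winds_fill hlo hhi eA eB hA hB hlt)
    hτ (ε / 4 - k / 3)
  have hcirc : ∀ θ, circ (ε / 4 - k / 3) * circ θ = circ (θ - k / 3 + ε / 4) := by
    intro θ
    rw [← circ_add]
    congr 1
    ring
  have hred : ∀ j : ℕ, ∃ (r M : ℕ) (M' : ℕ), r < 3 ∧ j + 3 * M = k + r + 3 * M' := fun j =>
    ⟨(j + 2 * k) % 3, k, (j + 2 * k) / 3, Nat.mod_lt _ three_pos, by omega⟩
  have hper : ∀ {Y : Type} (g : ℕ → Y), (∀ j, g (j + 3) = g j) → ∀ j M, g (j + 3 * M) = g j := by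
    intro Y g hg j M
    induction M with
    | zero => rfl
    | succ M ih => rw [← ih, ← hg (j + 3 * M)]; congr 1
  have hpi := Real.pi_pos
  have hre : ∀ z, (fill A (X k) B lo hi z).re = stretch A (X k) B z.re := fun z => rfl
  have hsm := (strictMono_stretch hA hB).monotone
  have hle : ∀ {z : ℂ}, z.re ≤ 0 → (fill A (X k) B lo hi z).re ≤ X k := by
    intro z hz
    simpa [hre] using hsm hz
  have hge : ∀ {z : ℂ}, 0 ≤ z.re → X k ≤ (fill A (X k) B lo hi z).re := by
    intro z hz
    simpa [hre] using hsm hz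
  refine ⟨_, hc, hi', fun j θ hθ => ?_, fun j => ?_⟩
  · rw [hcirc]
    obtain ⟨r, M, M', hr, he⟩ := hred j
    have he' : (j : ℝ) + 3 * M = k + r + 3 * M' := by exact_mod_cast he
    have e1 : f j = f (k + r) := by rw [← hper f hf j M, he, hper f hf]
    obtain ⟨ψ, hψ⟩ : ∃ ψ : ℝ, ψ = θ + M - M' - k / 3 := ⟨_, rfl⟩
    have e2 : circ (θ - k / 3 + ε / 4) = circ (ψ + ε / 4) :=
      circ_eq_circ.2 ⟨M' - M, by rw [hψ]; push_cast; ring⟩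
    rw [e1, e2]
    obtain ⟨t1, t2⟩ := hθ
    push_cast at t1 t2
    obtain ⟨hn, a, b, ha, hb, h1, h2⟩ := hm ψ
    have u1 : (r : ℝ) / 3 ≤ ψ := by linarith
    have u2 : ψ ≤ (r + 1 : ℝ) / 3 := by linarith
    interval_cases r
    · push_cast at u1 u2
      have s1 : 0 ≤ a * Real.sin (2 * Real.pi * ψ) := mul_nonneg ha.le
        (Real.sin_nonneg_of_nonneg_of_le_pi (mul_nonneg (by positivity) (by linarith))
          (by nlinarith))
      have s2 : 0 ≤ b * (Real.cos (2 * Real.pi * ψ) + 1 / 2) := mul_nonneg hb.le (by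
        linarith [cos_two_pi_mul_ge (x := ψ) (by rw [abs_le]; constructor <;> linarith)])
      rcases hε with rfl | rfl
      · obtain ⟨-, -, -, h3, -⟩ := hpos rfl
        rw [fill_im_of_nonneg eA eB hn (by rw [h2]; linarith)]
        exact h3 _ (hle (by rw [h1]; linarith))
      · obtain ⟨-, -, -, -, h3⟩ := hneg rfl
        rw [fill_im_of_nonpos eA eB hn (by rw [h2]; linarith)]
        exact h3 _ (hge (by rw [h1]; linarith))
    · push_cast at u1 u2
      have s2 : b * (Real.cos (2 * Real.pi * ψ) + 1 / 2) ≤ 0 := mul_nonpos_of_nonneg_of_nonpos hb.le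
        (by linarith [cos_two_pi_mul_le (x := ψ) (by rw [abs_le]; constructor <;> linarith)])
      rcases hε with rfl | rfl
      · obtain ⟨-, -, h3, -, -⟩ := hpos rfl
        rw [fill_im_of_nonpos eA eB hn (by rw [h2]; linarith), h3]
      · obtain ⟨-, -, h3, -, -⟩ := hneg rfl
        rw [fill_im_of_nonneg eA eB hn (by rw [h2]; linarith), h3]
    · push_cast at u1 u2
      have s1 : a * Real.sin (2 * Real.pi * ψ) ≤ 0 := by
        refine mul_nonpos_of_nonneg_of_nonpos ha.le ?_
        rw [← Real.sin_sub_two_pi]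
        exact Real.sin_nonpos_of_nonpos_of_neg_pi_le (by nlinarith) (by nlinarith)
      have s2 : 0 ≤ b * (Real.cos (2 * Real.pi * ψ) + 1 / 2) := by
        refine mul_nonneg hb.le ?_
        rw [← Real.cos_sub_two_pi, show 2 * Real.pi * ψ - 2 * Real.pi = 2 * Real.pi * (ψ - 1) by
          ring]
        linarith [cos_two_pi_mul_ge (x := ψ - 1) (by rw [abs_le]; constructor <;> linarith)]
      rcases hε with rfl | rfl
      · obtain ⟨-, -, -, -, h3⟩ := hpos rfl
        rw [fill_im_of_nonneg eA eB hn (by rw [h2]; linarith)]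
        exact h3 _ (hge (by rw [h1]; linarith))
      · obtain ⟨-, -, -, h3, -⟩ := hneg rfl
        rw [fill_im_of_nonpos eA eB hn (by rw [h2]; linarith)]
        exact h3 _ (hle (by rw [h1]; linarith))
  · rw [hcirc]
    obtain ⟨r, M, M', hr, he⟩ := hred j
    have he' : (j : ℝ) + 3 * M = k + r + 3 * M' := by exact_mod_cast he
    have e1 : X j = X (k + r) := by rw [← hper X hX j M, he, hper X hX]
    have e2 : circ ((j : ℝ) / (3 : ℕ) - k / 3 + ε / 4) = circ ((r : ℝ) / 3 + ε / 4) :=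
      circ_eq_circ.2 ⟨M' - M, by push_cast; linarith⟩
    rw [e1, e2]
    obtain ⟨hn, a, b, ha, hb, h1, h2⟩ := hm ((r : ℝ) / 3)
    have hsq := sq_add_sq_eq_one hn
    rw [hre]
    have c3 : Real.cos (2 * Real.pi / 3) = -(1 / 2) := by
      rw [show 2 * Real.pi / 3 = Real.pi - Real.pi / 3 by ring, Real.cos_pi_sub,
        Real.cos_pi_div_three]
    have s3 : 0 < Real.sin (2 * Real.pi / 3) :=
      Real.sin_pos_of_pos_of_lt_pi (by positivity) (by linarith)
    have hsign : ∀ {w : ℂ}, w.re ^ 2 + w.im ^ 2 = 1 → w.im = 0 → w.re = 1 ∨ w.re = -1 := by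
      intro w h h0
      rw [h0] at h
      exact sq_eq_sq_iff_eq_or_eq_neg.1 (by linarith)
    interval_cases r
    · rw [h1]
      simp
    · rw [show 2 * Real.pi * (((1 : ℕ) : ℝ) / 3) = 2 * Real.pi / 3 by push_cast; ring] at h1 h2
      have hs := mul_pos ha s3
      rcases hε with rfl | rfl
      · rcases hsign hsq (by rw [h2, c3]; ring) with h | h
        · linarith
        · rw [h, stretch_neg_one, (hpos rfl).1]
      · rcases hsign hsq (by rw [h2, c3]; ring) with h | h
        · rw [h, stretch_one, (hneg rfl).1]
        · linarith
    · have e3 : 2 * Real.pi * (((2 : ℕ) : ℝ) / 3) = 2 * Real.pi - 2 * Real.pi / 3 := by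
        push_cast; ring
      rw [e3, Real.sin_two_pi_sub] at h1
      rw [e3, Real.cos_two_pi_sub] at h2
      have hs := mul_pos ha s3
      rcases hε with rfl | rfl
      · rcases hsign hsq (by rw [h2, c3]; ring) with h | h
        · rw [h, stretch_one, (hpos rfl).2.1]
        · linarith
      · rcases hsign hsq (by rw [h2, c3]; ring) with h | h
        · linarith
        · rw [h, stretch_neg_one, (hneg rfl).2.1]

theorem exists_sides_triangle_pos (hfc : ∀ j, Continuous (f j)) (hf : ∀ j, f (j + 3) = f j)
    (hX : ∀ j, X (j + 3) = X j) (k : ℕ) (h1 : X (k + 1) < X k) (h2 : X k < X (k + 2))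
    (e0 : f k (X k) = f (k + 2) (X k)) (e1 : f k (X (k + 1)) = f (k + 1) (X (k + 1)))
    (e2 : f (k + 1) (X (k + 2)) = f (k + 2) (X (k + 2)))
    (l1 : ∀ x ∈ Ioc (X (k + 1)) (X k), f (k + 1) x < f k x)
    (l2 : ∀ x ∈ Ico (X k) (X (k + 2)), f (k + 1) x < f (k + 2) x) : ∃ F, Sides 3 f X F := by
  refine exists_sides_triangle hf hX k (.inl rfl) h1 h2 (hfc (k + 1))
    (continuous_glue (hfc k) (hfc (k + 2)) e0) ?_ ?_ ?_ (fun _ => ⟨rfl, rfl, rfl,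
      fun x hx => glue_of_le hx, fun x hx => glue_of_ge e0 hx⟩) (fun h => by norm_num at h)
  · rw [glue_of_le h1.le, e1]
  · rw [glue_of_ge e0 h2.le, e2]
  · intro x hx
    rcases le_total x (X k) with h | h
    · rw [glue_of_le h]
      exact l1 x ⟨hx.1, h⟩
    · rw [glue_of_ge e0 h]
      exact l2 x ⟨h, hx.2⟩

theorem exists_sides_triangle_neg (hfc : ∀ j, Continuous (f j)) (hf : ∀ j, f (j + 3) = f j)
    (hX : ∀ j, X (j + 3) = X j) (k : ℕ) (h1 : X (k + 2) < X k) (h2 : X k < X (k + 1))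
    (e0 : f k (X k) = f (k + 2) (X k)) (e1 : f k (X (k + 1)) = f (k + 1) (X (k + 1)))
    (e2 : f (k + 1) (X (k + 2)) = f (k + 2) (X (k + 2)))
    (l1 : ∀ x ∈ Ioc (X (k + 2)) (X k), f (k + 2) x < f (k + 1) x)
    (l2 : ∀ x ∈ Ico (X k) (X (k + 1)), f k x < f (k + 1) x) : ∃ F, Sides 3 f X F := by
  refine exists_sides_triangle hf hX k (.inr rfl) h1 h2
    (continuous_glue (hfc (k + 2)) (hfc k) e0.symm) (hfc (k + 1)) ?_ ?_ ?_
      (fun h => by norm_num at h) (fun _ => ⟨rfl, rfl, rfl,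
      fun x hx => glue_of_le hx, fun x hx => glue_of_ge e0.symm hx⟩)
  · rw [glue_of_le h1.le, e2]
  · rw [glue_of_ge e0.symm h2.le, e1]
  · intro x hx
    rcases le_total x (X k) with h | h
    · rw [glue_of_le h]
      exact l1 x ⟨hx.1, h⟩
    · rw [glue_of_ge e0.symm h]
      exact l2 x ⟨h, hx.2⟩

namespace Sides

theorem agree_triangle (h : Sides 3 f X F) (hf : ∀ j, f (j + 3) = f j) (hX : ∀ j, X (j + 3) = X j)
    (k : ℕ) : f k (X k) = f (k + 2) (X k) := by
  have := h.agree three_pos (k + 2)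
  rw [show k + 2 + 1 = k + 3 by ring, hf, hX] at this
  exact this.symm

/-- Sides `k + 2` and `k` are both traversed to the left and follow each other at corner `k`, so
together they form the upper graph; the loop is started at corner `k + 1`. -/
theorem graphBoundary_pos (h : Sides 3 f X F) (hf : ∀ j, f (j + 3) = f j)
    (hX : ∀ j, X (j + 3) = X j) {k : ℕ} (h1 : X (k + 1) < X k) (h2 : X k < X (k + 2)) :
    GraphBoundary F (f (k + 1)) (glue (f k) (f (k + 2)) (X k)) (X (k + 1)) (X (k + 2))
      ((k + 1 : ℝ) / 3) ((k + 2 : ℝ) / 3) := by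
  have a1 := h.anti (j := k + 2) three_pos (by rwa [show k + 2 + 1 = k + 3 by ring, hX])
  -- Side `k` is read as side `k + 3`, so that its parameter interval continues that of side `k +
  -- 2`.
  have a2 := h.anti (j := k + 3) three_pos (by
    rw [show k + 3 + 1 = k + 1 + 3 by ring, hX, hX]; exact h1)
  have m1 := h.mono (j := k + 1) three_pos (h1.trans h2)
  have s1 := h.side (k + 1)
  have s2 := h.side (k + 2)
  have s3 := h.side (k + 3)
  have c1 := h.corner (k + 1)
  have c2 := h.corner (k + 2)
  have c3 := h.corner (k + 3)
  push_cast at a1 a2 m1 s1 s2 s3 c1 c2 c3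
  rw [show (k + 1 + 1 : ℝ) = k + 2 by ring] at m1 s1
  rw [show (k + 2 + 1 : ℝ) = k + 3 by ring] at a1 s2
  have e4 : (k + 1 : ℝ) / 3 + 1 = (k + 3 + 1 : ℝ) / 3 := by ring
  have i1 : (k + 2 : ℝ) / 3 ≤ (k + 3 : ℝ) / 3 := by linarith
  have i2 : (k + 3 : ℝ) / 3 ≤ (k + 3 + 1 : ℝ) / 3 := by linarith
  rw [hX] at c3
  have e0 := h.agree_triangle hf hX k
  refine ⟨by linarith, by linarith, c1, c2, m1, ?_, s1, fun θ hθ => ?_⟩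
  · rw [e4, ← Icc_union_Icc_eq_Icc i1 i2]
    exact a1.union a2 (isGreatest_Icc i1) (isLeast_Icc i2)
  · rw [e4] at hθ
    rcases le_total θ ((k + 3 : ℝ) / 3) with ht | ht
    · have := a1.antitoneOn ⟨hθ.1, ht⟩ ⟨i1, le_rfl⟩ ht
      simp only [c3] at this
      rw [glue_of_ge e0 this]
      exact s2 θ ⟨hθ.1, ht⟩
    · have := a2.antitoneOn ⟨le_rfl, i2⟩ ⟨ht, hθ.2⟩ ht
      simp only [c3] at this
      rw [glue_of_le this, ← hf k]
      exact s3 θ ⟨ht, hθ.2⟩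

theorem graphBoundary_neg (h : Sides 3 f X F) (hf : ∀ j, f (j + 3) = f j)
    (hX : ∀ j, X (j + 3) = X j) {k : ℕ} (h1 : X (k + 2) < X k) (h2 : X k < X (k + 1)) :
    GraphBoundary F (glue (f (k + 2)) (f k) (X k)) (f (k + 1)) (X (k + 2)) (X (k + 1))
      ((k + 2 : ℝ) / 3) ((k + 4 : ℝ) / 3) := by
  have a1 := h.mono (j := k + 2) three_pos (by rwa [show k + 2 + 1 = k + 3 by ring, hX])
  have a2 := h.mono (j := k + 3) three_pos (by
    rw [show k + 3 + 1 = k + 1 + 3 by ring, hX, hX]; exact h2)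
  have m1 := h.anti (j := k + 4) three_pos (by
    rw [show k + 4 + 1 = k + 2 + 3 by ring, hX, show k + 4 = k + 1 + 3 by ring, hX]
    exact h1.trans h2)
  have s1 := h.side (k + 4)
  have s2 := h.side (k + 2)
  have s3 := h.side (k + 3)
  have c1 := h.corner (k + 4)
  have c2 := h.corner (k + 2)
  have c3 := h.corner (k + 3)
  push_cast at a1 a2 m1 s1 s2 s3 c1 c2 c3
  rw [show (k + 2 + 1 : ℝ) = k + 3 by ring] at a1 s2
  rw [show (k + 3 + 1 : ℝ) = k + 4 by ring] at a2 s3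
  have e4 : (k + 2 : ℝ) / 3 + 1 = (k + 4 + 1 : ℝ) / 3 := by ring
  have i1 : (k + 2 : ℝ) / 3 ≤ (k + 3 : ℝ) / 3 := by linarith
  have i2 : (k + 3 : ℝ) / 3 ≤ (k + 4 : ℝ) / 3 := by linarith
  rw [hX] at c3
  rw [show k + 4 = k + 1 + 3 by ring, hX] at c1
  rw [show k + 4 = k + 1 + 3 by ring, hf] at s1
  have e0 := (h.agree_triangle hf hX k).symm
  refine ⟨by linarith, by linarith, c2, c1, ?_, by rwa [e4], fun θ hθ => ?_, by rwa [e4]⟩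
  · rw [← Icc_union_Icc_eq_Icc i1 i2]
    exact a1.union a2 (isGreatest_Icc i1) (isLeast_Icc i2)
  · rcases le_total θ ((k + 3 : ℝ) / 3) with ht | ht
    · have := a1.monotoneOn ⟨hθ.1, ht⟩ ⟨i1, le_rfl⟩ ht
      simp only [c3] at this
      rw [glue_of_le this]
      exact s2 θ ⟨hθ.1, ht⟩
    · have := a2.monotoneOn ⟨le_rfl, i2⟩ ⟨ht, hθ.2⟩ ht
      simp only [c3] at this
      rw [glue_of_ge e0 this, ← hf k]
      exact s3 θ ⟨ht, hθ.2⟩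

theorem triangle_pos (h : Sides 3 f X F) (hfc : ∀ j, Continuous (f j)) (hf : ∀ j, f (j + 3) = f j)
    (hX : ∀ j, X (j + 3) = X j) {k : ℕ} (h1 : X (k + 1) < X k) (h2 : X k < X (k + 2)) :
    (∀ x ∈ Ioc (X (k + 1)) (X k), f (k + 1) x < f k x) ∧
      ∀ x ∈ Ico (X k) (X (k + 2)), f (k + 1) x < f (k + 2) x := by
  have hb := h.graphBoundary_pos hf hX h1 h2
  have e0 := h.agree_triangle hf hX k
  have hlt := fun x hx => hb.lower_lt_upper h.cont h.imm (hfc _)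
    (continuous_glue (hfc k) (hfc (k + 2)) e0) (x := x) hx
  constructor
  · intro x hx
    have := hlt x ⟨hx.1, hx.2.trans_lt h2⟩
    rwa [glue_of_le hx.2] at this
  · intro x hx
    have := hlt x ⟨h1.trans_le hx.1, hx.2⟩
    rwa [glue_of_ge e0 hx.1] at this

theorem triangle_neg (h : Sides 3 f X F) (hfc : ∀ j, Continuous (f j)) (hf : ∀ j, f (j + 3) = f j)
    (hX : ∀ j, X (j + 3) = X j) {k : ℕ} (h1 : X (k + 2) < X k) (h2 : X k < X (k + 1)) :
    (∀ x ∈ Ioc (X (k + 2)) (X k), f (k + 2) x < f (k + 1) x) ∧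
      ∀ x ∈ Ico (X k) (X (k + 1)), f k x < f (k + 1) x := by
  have hb := h.graphBoundary_neg hf hX h1 h2
  have e0 := (h.agree_triangle hf hX k).symm
  have hlt := fun x hx => hb.lower_lt_upper h.cont h.imm
    (continuous_glue (hfc (k + 2)) (hfc k) e0) (hfc _) (x := x) hx
  constructor
  · intro x hx
    have := hlt x ⟨hx.1, hx.2.trans_lt h2⟩
    rwa [glue_of_le hx.2] at this
  · intro x hx
    have := hlt x ⟨h1.trans_le hx.1, hx.2⟩
    rwa [glue_of_ge e0 hx.1] at this

/-- Consecutive corners have different abscissae, so exactly one of the three is in the middle; the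
two alternatives are the two orders of its neighbours. -/
theorem triangle_cases (h : Sides 3 f X F) (hX : ∀ j, X (j + 3) = X j) :
    ∃ k < 3, (X (k + 1) < X k ∧ X k < X (k + 2)) ∨ (X (k + 2) < X k ∧ X k < X (k + 1)) := by
  have h0 := h.ne three_pos 0
  have h1 := h.ne three_pos 1
  have h2 := h.ne three_pos 2
  have x3 := hX 0
  have x4 := hX 1
  norm_num at h0 h1 h2 x3 x4
  rw [x3] at h2
  rcases lt_or_gt_of_ne h0 with a | a <;> rcases lt_or_gt_of_ne h1 with b | b <;>
    rcases lt_or_gt_of_ne h2 with c | c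
  · exact absurd (a.trans b) c.not_gt
  · exact ⟨1, by norm_num, .inr (by norm_num; rw [x3]; exact ⟨a, b⟩)⟩
  · exact ⟨0, by norm_num, .inr ⟨c, a⟩⟩
  · exact ⟨2, by norm_num, .inl (by norm_num; rw [x3, x4]; exact ⟨c, b⟩)⟩
  · exact ⟨2, by norm_num, .inr (by norm_num; rw [x3, x4]; exact ⟨b, c⟩)⟩
  · exact ⟨0, by norm_num, .inl ⟨a, c⟩⟩
  · exact ⟨1, by norm_num, .inl (by norm_num; rw [x3]; exact ⟨b, a⟩)⟩
  · exact absurd (b.trans a) c.not_gt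

theorem triangle_unique {G : ℂ → ℂ} (h : Sides 3 f X F) (h' : Sides 3 f X G)
    (hfc : ∀ j, Continuous (f j)) (hf : ∀ j, f (j + 3) = f j) (hX : ∀ j, X (j + 3) = X j) :
    InjOn F (closedBall 0 1) ∧ InjOn G (closedBall 0 1) ∧
      F '' closedBall 0 1 = G '' closedBall 0 1 := by
  obtain ⟨k, -, ⟨h1, h2⟩ | ⟨h1, h2⟩⟩ := h.triangle_cases hX
  · have hc := continuous_glue (hfc k) (hfc (k + 2)) (h.agree_triangle hf hX k)
    have hb := h.graphBoundary_pos hf hX h1 h2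
    have hb' := h'.graphBoundary_pos hf hX h1 h2
    exact ⟨hb.injOn h.cont h.imm (hfc _) hc, hb'.injOn h'.cont h'.imm (hfc _) hc,
      (hb.image_eq h.cont h.imm (hfc _) hc).trans (hb'.image_eq h'.cont h'.imm (hfc _) hc).symm⟩
  · have hc := continuous_glue (hfc (k + 2)) (hfc k) (h.agree_triangle hf hX k).symm
    have hb := h.graphBoundary_neg hf hX h1 h2
    have hb' := h'.graphBoundary_neg hf hX h1 h2
    exact ⟨hb.injOn h.cont h.imm hc (hfc _), hb'.injOn h'.cont h'.imm hc (hfc _),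
      (hb.image_eq h.cont h.imm hc (hfc _)).trans (hb'.image_eq h'.cont h'.imm hc (hfc _)).symm⟩

end Sides

end Triangle

/-! ### The possible corners of immersed triangles -/

/-- The function `cos (2 π x)`. -/
def cs (x : ℝ) : ℝ := Real.cos (2 * Real.pi * x)

@[fun_prop]
theorem continuous_cs : Continuous cs := by
  unfold cs
  fun_prop

theorem cs_add_int (x : ℝ) (m : ℤ) : cs (x + m) = cs x := by
  rw [cs, cs, show 2 * Real.pi * (x + m) = 2 * Real.pi * x + m * (2 * Real.pi) by ring,
    Real.cos_add_int_mul_two_pi]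

theorem cs_neg (x : ℝ) : cs (-x) = cs x := by
  rw [cs, cs, mul_neg, Real.cos_neg]

theorem cs_lt_cs {x y : ℝ} (hx : 0 ≤ x) (hy : y ≤ 1 / 2) (hxy : x < y) : cs y < cs x := by
  have hpi := Real.pi_pos
  exact Real.cos_lt_cos_of_nonneg_of_le_pi (by positivity) (by nlinarith) (by nlinarith)

theorem cs_lt_iff {x y : ℝ} (hx : x ∈ Ioo (0 : ℝ) (1 / 2)) (hy : y ∈ Ioo (0 : ℝ) (1 / 2)) :
    cs x < cs y ↔ y < x := by
  constructor
  · intro h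
    by_contra! hle
    rcases hle.eq_or_lt with rfl | h1
    · exact lt_irrefl _ h
    · exact lt_asymm h (cs_lt_cs hx.1.le hy.2.le h1)
  · exact cs_lt_cs hy.1.le hx.2.le

/-- After removing the period, the symmetry of the cosine about `1/2` reduces everything to the half
period on which it decreases. -/
theorem cs_lt_of_mem {δ : ℝ} (hδ : δ ∈ Ioo (0 : ℝ) (1 / 2)) (m : ℤ) {x : ℝ}
    (hx : x ∈ Ioo (δ + m) (1 - δ + m)) : cs x < cs δ := by
  rw [← sub_add_cancel x (m : ℝ), cs_add_int]
  obtain ⟨h1, h2⟩ := hx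
  rcases le_total (x - m) (1 / 2) with h | h
  · exact cs_lt_cs hδ.1.le h (by linarith)
  · have : cs (x - m) = cs (1 - (x - m)) := by
      rw [← cs_neg (x - m), ← cs_add_int (-(x - m)) 1]
      push_cast
      congr 1
      ring
    rw [this]
    exact cs_lt_cs hδ.1.le (by linarith) (by linarith)

theorem cs_gt_of_mem {δ : ℝ} (hδ : δ ∈ Ioo (0 : ℝ) (1 / 2)) (m : ℤ) {x : ℝ}
    (hx : x ∈ Ioo (-δ + m) (δ + m)) : cs δ < cs x := by
  rw [← sub_add_cancel x (m : ℝ), cs_add_int]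
  obtain ⟨h1, h2⟩ := hx
  rcases le_total 0 (x - m) with h | h
  · exact cs_lt_cs h hδ.2.le (by linarith)
  · rw [← cs_neg (x - m)]
    exact cs_lt_cs (by linarith) hδ.2.le (by linarith)

/-- The cosine decreases through its level at `δ + m` and increases through it at `-δ + m`. This and
the next three lemmas exclude a triangle by the wrong sign of a difference of sides right next to a
corner. -/
theorem not_ge_right {δ X' : ℝ} (hδ : δ ∈ Ioo (0 : ℝ) (1 / 2)) (m : ℤ) (h : δ + m < X') :
    ¬ ∀ x ∈ Ioo (δ + m) X', cs δ ≤ cs x := by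
  intro hall
  obtain ⟨x, h1, h2⟩ := exists_between (lt_min h (by linarith [hδ.2] : δ + m < 1 - δ + m))
  obtain ⟨h3, h4⟩ := lt_min_iff.1 h2
  exact (hall x ⟨h1, h3⟩).not_gt (cs_lt_of_mem hδ m ⟨h1, h4⟩)

theorem not_le_left {δ X' : ℝ} (hδ : δ ∈ Ioo (0 : ℝ) (1 / 2)) (m : ℤ) (h : X' < δ + m) :
    ¬ ∀ x ∈ Ioo X' (δ + m), cs x ≤ cs δ := by
  intro hall
  obtain ⟨x, h1, h2⟩ := exists_between (max_lt h (by linarith [hδ.1] : -δ + m < δ + m))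
  obtain ⟨h3, h4⟩ := max_lt_iff.1 h1
  exact (hall x ⟨h3, h2⟩).not_gt (cs_gt_of_mem hδ m ⟨h4, h2⟩)

theorem not_le_right {δ X' : ℝ} (hδ : δ ∈ Ioo (0 : ℝ) (1 / 2)) (m : ℤ) (h : -δ + m < X') :
    ¬ ∀ x ∈ Ioo (-δ + m) X', cs x ≤ cs δ := by
  intro hall
  obtain ⟨x, h1, h2⟩ := exists_between (lt_min h (by linarith [hδ.1] : -δ + m < δ + m))
  obtain ⟨h3, h4⟩ := lt_min_iff.1 h2
  exact (hall x ⟨h1, h3⟩).not_gt (cs_gt_of_mem hδ m ⟨h1, h4⟩)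

theorem not_ge_left {δ X' : ℝ} (hδ : δ ∈ Ioo (0 : ℝ) (1 / 2)) (m : ℤ) (h : X' < -δ + m) :
    ¬ ∀ x ∈ Ioo X' (-δ + m), cs δ ≤ cs x := by
  intro hall
  obtain ⟨x, h1, h2⟩ := exists_between
    (max_lt h (by push_cast; linarith [hδ.2] : δ + ((m - 1 : ℤ) : ℝ) < -δ + m))
  obtain ⟨h3, h4⟩ := max_lt_iff.1 h1
  refine (hall x ⟨h3, h2⟩).not_gt (cs_lt_of_mem hδ (m - 1) ⟨h4, ?_⟩)
  push_cast
  linarith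

/-- The conditions on the corners `X 0, X 1, X 2` of an immersed triangle with sides
`y = - (s + s') cos (2 π x) + n₀`, `y = - s cos (2 π x) + n₁`, `y = n₂`; here
`α, β, γ` are the values of `cos (2 π x)` at the corners `2, 1, 0`. -/
def TriangleCorners (α β γ X₀ X₁ X₂ : ℝ) : Prop :=
  (X₁ < X₀ ∧ X₀ < X₂ ∧ (∀ x ∈ Ioc X₁ X₀, cs x < β) ∧ ∀ x ∈ Ico X₀ X₂, α < cs x) ∨
  (X₂ < X₀ ∧ X₀ < X₁ ∧ (∀ x ∈ Ioc X₂ X₀, cs x < α) ∧ ∀ x ∈ Ico X₀ X₁, β < cs x) ∨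
  (X₂ < X₁ ∧ X₁ < X₀ ∧ (∀ x ∈ Ioc X₂ X₁, cs x < α) ∧ ∀ x ∈ Ico X₁ X₀, cs x < γ) ∨
  (X₀ < X₁ ∧ X₁ < X₂ ∧ (∀ x ∈ Ioc X₀ X₁, γ < cs x) ∧ ∀ x ∈ Ico X₁ X₂, α < cs x) ∨
  (X₀ < X₂ ∧ X₂ < X₁ ∧ (∀ x ∈ Ioc X₀ X₂, γ < cs x) ∧ ∀ x ∈ Ico X₂ X₁, β < cs x) ∨
  (X₁ < X₂ ∧ X₂ < X₀ ∧ (∀ x ∈ Ioc X₁ X₂, cs x < β) ∧ ∀ x ∈ Ico X₂ X₀, cs x < γ)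

theorem int_eq_of_lt_of_lt {m n : ℤ} (h1 : (m : ℝ) < n + 1) (h2 : (n : ℝ) < m + 1) : m = n := by
  have h3 : m < n + 1 := by exact_mod_cast h1
  have h4 : n < m + 1 := by exact_mod_cast h2
  omega

theorem cs_one_sub_add_int (x : ℝ) (m : ℤ) : cs (1 - x + m) = cs x := by
  rw [show 1 - x + m = -x + ((1 + m : ℤ) : ℝ) by push_cast; ring, cs_add_int, cs_neg]

theorem cs_neg_add_int (x : ℝ) (m : ℤ) : cs (-x + m) = cs x := by
  rw [cs_add_int, cs_neg]

section corners

variable {α β γ : ℝ}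

/-- Next to corner `0` the cosine has the wrong sign in all alternatives where that corner is
extreme. In the other two, the cosine returns to the level of an outer corner within a period, which
bounds the width and makes the integers agree. -/
theorem triangleCorners_zz (hα : α ∈ Ioo (0 : ℝ) (1 / 2)) (hβ : β ∈ Ioo (0 : ℝ) (1 / 2))
    (hγ : γ ∈ Ioo (0 : ℝ) (1 / 2)) {m₀ m₁ m₂ : ℤ}
    (h : TriangleCorners (cs α) (cs β) (cs γ) (γ + m₀) (β + m₁) (α + m₂)) :
    m₁ = m₀ ∧ m₂ = m₀ ∧ α ≠ β := by
  have ha := hα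
  have hb := hβ
  have hc := hγ
  obtain ⟨a1, a2⟩ := ha
  obtain ⟨b1, b2⟩ := hb
  obtain ⟨c1, c2⟩ := hc
  rcases h with ⟨h1, h2, h3, h4⟩ | ⟨h1, h2, h3, h4⟩ | ⟨h1, h2, h3, h4⟩ | ⟨h1, h2, h3, h4⟩ |
    ⟨h1, h2, h3, h4⟩ | ⟨h1, h2, h3, h4⟩
  · have k1 : γ + m₀ < 1 - β + m₁ := by
      by_contra! hle
      exact (h3 _ ⟨by linarith, hle⟩).ne (cs_one_sub_add_int β m₁)
    have k2 : -α + m₂ < γ + m₀ := by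
      by_contra! hle
      exact (h4 _ ⟨hle, by linarith⟩).ne' (cs_neg_add_int α m₂)
    have e1 : m₁ = m₀ := int_eq_of_lt_of_lt (by linarith) (by linarith)
    have e2 : m₂ = m₀ := int_eq_of_lt_of_lt (by linarith) (by linarith)
    subst e1 e2
    exact ⟨rfl, rfl, ne_of_gt (by linarith)⟩
  · have k1 : γ + m₀ < 1 - α + m₂ := by
      by_contra! hle
      exact (h3 _ ⟨by linarith, hle⟩).ne (cs_one_sub_add_int α m₂)
    have k2 : -β + m₁ < γ + m₀ := by
      by_contra! hle
      exact (h4 _ ⟨hle, by linarith⟩).ne' (cs_neg_add_int β m₁)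
    have e1 : m₁ = m₀ := int_eq_of_lt_of_lt (by linarith) (by linarith)
    have e2 : m₂ = m₀ := int_eq_of_lt_of_lt (by linarith) (by linarith)
    subst e1 e2
    exact ⟨rfl, rfl, ne_of_lt (by linarith)⟩
  · exact absurd (fun x hx => (h4 x ⟨hx.1.le, hx.2⟩).le) (not_le_left hγ m₀ h2)
  · exact absurd (fun x hx => (h3 x ⟨hx.1, hx.2.le⟩).le) (not_ge_right hγ m₀ h1)
  · exact absurd (fun x hx => (h3 x ⟨hx.1, hx.2.le⟩).le) (not_ge_right hγ m₀ h1)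
  · exact absurd (fun x hx => (h4 x ⟨hx.1.le, hx.2⟩).le) (not_le_left hγ m₀ h2)

/-- Here corner `1` has to be the middle one. The triangle then lies around a half integer or around
an integer, and the order of `α` and `β` decides between the two. -/
theorem triangleCorners_zx (hα : α ∈ Ioo (0 : ℝ) (1 / 2)) (hβ : β ∈ Ioo (0 : ℝ) (1 / 2))
    (hγ : γ ∈ Ioo (0 : ℝ) (1 / 2)) {m₀ m₁ m₂ : ℤ}
    (h : TriangleCorners (cs α) (cs β) (cs γ) (-γ + m₀) (-β + m₁) (α + m₂)) :
    (α < β ∧ m₁ = m₀ ∧ m₀ = m₂ + 1) ∨ (β < α ∧ m₁ = m₀ ∧ m₀ = m₂) := by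
  have ha := hα
  have hb := hβ
  have hc := hγ
  obtain ⟨a1, a2⟩ := ha
  obtain ⟨b1, b2⟩ := hb
  obtain ⟨c1, c2⟩ := hc
  rcases h with ⟨h1, h2, h3, h4⟩ | ⟨h1, h2, h3, h4⟩ | ⟨h1, h2, h3, h4⟩ | ⟨h1, h2, h3, h4⟩ |
    ⟨h1, h2, h3, h4⟩ | ⟨h1, h2, h3, h4⟩
  · exact absurd (fun x hx => (h3 x ⟨hx.1, hx.2.le⟩).le) (not_le_right hβ m₁ h1)
  · exact absurd (fun x hx => (h4 x ⟨hx.1.le, hx.2⟩).le) (not_ge_left hβ m₁ h2)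
  · have k1 : -β + m₁ < 1 - α + m₂ := by
      by_contra! hle
      exact (h3 _ ⟨by linarith, hle⟩).ne (cs_one_sub_add_int α m₂)
    have k2 : γ + ((m₀ - 1 : ℤ) : ℝ) < -β + m₁ := by
      by_contra! hle
      exact (h4 _ ⟨hle, by push_cast; linarith⟩).ne (cs_add_int γ _)
    push_cast at k2
    have e1 : m₁ = m₂ + 1 := int_eq_of_lt_of_lt (by push_cast; linarith) (by push_cast; linarith)
    have e2 : m₁ = m₀ := int_eq_of_lt_of_lt (by linarith) (by linarith)
    refine .inl ⟨?_, e2, by omega⟩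
    rw [e1] at k1
    push_cast at k1
    linarith
  · have k1 : -β + m₁ < γ + m₀ := by
      by_contra! hle
      exact (h3 _ ⟨by linarith, hle⟩).ne' (cs_add_int γ m₀)
    have k2 : -α + m₂ < -β + m₁ := by
      by_contra! hle
      exact (h4 _ ⟨hle, by linarith⟩).ne' (cs_neg_add_int α m₂)
    have e1 : m₁ = m₀ := int_eq_of_lt_of_lt (by linarith) (by linarith)
    have e2 : m₂ = m₁ := int_eq_of_lt_of_lt (by linarith) (by linarith)
    subst e1 e2
    exact .inr ⟨by linarith, rfl, rfl⟩
  · exact absurd (fun x hx => (h4 x ⟨hx.1.le, hx.2⟩).le) (not_ge_left hβ m₁ h2)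
  · exact absurd (fun x hx => (h3 x ⟨hx.1, hx.2.le⟩).le) (not_le_right hβ m₁ h1)

/-- Now corner `2` has to be the middle one, and the smaller of `α` and `β` decides again: around an
integer if `α < β`, around a half integer otherwise. -/
theorem triangleCorners_xz (hα : α ∈ Ioo (0 : ℝ) (1 / 2)) (hβ : β ∈ Ioo (0 : ℝ) (1 / 2))
    (hγ : γ ∈ Ioo (0 : ℝ) (1 / 2)) {m₀ m₁ m₂ : ℤ}
    (h : TriangleCorners (cs α) (cs β) (cs γ) (-γ + m₀) (β + m₁) (-α + m₂)) :
    (α < β ∧ m₂ = m₀ ∧ m₀ = m₁) ∨ (β < α ∧ m₂ = m₀ ∧ m₀ = m₁ + 1) := by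
  have ha := hα
  have hb := hβ
  have hc := hγ
  obtain ⟨a1, a2⟩ := ha
  obtain ⟨b1, b2⟩ := hb
  obtain ⟨c1, c2⟩ := hc
  rcases h with ⟨h1, h2, h3, h4⟩ | ⟨h1, h2, h3, h4⟩ | ⟨h1, h2, h3, h4⟩ | ⟨h1, h2, h3, h4⟩ |
    ⟨h1, h2, h3, h4⟩ | ⟨h1, h2, h3, h4⟩
  · exact absurd (fun x hx => (h4 x ⟨hx.1.le, hx.2⟩).le) (not_ge_left hα m₂ h2)
  · exact absurd (fun x hx => (h3 x ⟨hx.1, hx.2.le⟩).le) (not_le_right hα m₂ h1)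
  · exact absurd (fun x hx => (h3 x ⟨hx.1, hx.2.le⟩).le) (not_le_right hα m₂ h1)
  · exact absurd (fun x hx => (h4 x ⟨hx.1.le, hx.2⟩).le) (not_ge_left hα m₂ h2)
  · have k1 : -α + m₂ < γ + m₀ := by
      by_contra! hle
      exact (h3 _ ⟨by linarith, hle⟩).ne' (cs_add_int γ m₀)
    have k2 : -β + m₁ < -α + m₂ := by
      by_contra! hle
      exact (h4 _ ⟨hle, by linarith⟩).ne' (cs_neg_add_int β m₁)
    have e1 : m₂ = m₀ := int_eq_of_lt_of_lt (by linarith) (by linarith)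
    have e2 : m₂ = m₁ := int_eq_of_lt_of_lt (by linarith) (by linarith)
    refine .inl ⟨?_, e1, by omega⟩
    rw [e2] at k2
    linarith
  · have k1 : -α + m₂ < 1 - β + m₁ := by
      by_contra! hle
      exact (h3 _ ⟨by linarith, hle⟩).ne (cs_one_sub_add_int β m₁)
    have k2 : γ + ((m₀ - 1 : ℤ) : ℝ) < -α + m₂ := by
      by_contra! hle
      exact (h4 _ ⟨hle, by push_cast; linarith⟩).ne (cs_add_int γ _)
    push_cast at k2
    have e1 : m₂ = m₁ + 1 := int_eq_of_lt_of_lt (by push_cast; linarith) (by push_cast; linarith)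
    have e2 : m₂ = m₀ := int_eq_of_lt_of_lt (by linarith) (by linarith)
    refine .inr ⟨?_, e2, by omega⟩
    rw [e1] at k1
    push_cast at k1
    linarith

theorem triangleCorners_zz_of_lt (hα : α ∈ Ioo (0 : ℝ) (1 / 2)) (hβ : β ∈ Ioo (0 : ℝ) (1 / 2))
    (hγ : γ ∈ Ioo (0 : ℝ) (1 / 2))
    (l1 : α < γ) (l2 : γ < β) :
    TriangleCorners (cs α) (cs β) (cs γ) γ β α := by
  obtain ⟨a1, a2⟩ := hα
  obtain ⟨b1, b2⟩ := hβ
  obtain ⟨c1, c2⟩ := hγ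
  exact .inr (.inl ⟨by linarith, by linarith, fun x hx => cs_lt_of_mem ⟨a1, a2⟩ 0 ⟨by push_cast; linarith [hx.1, hx.2], by push_cast; linarith [hx.1, hx.2]⟩, fun x hx => cs_gt_of_mem ⟨b1, b2⟩ 0 ⟨by push_cast; linarith [hx.1, hx.2], by push_cast; linarith [hx.1, hx.2]⟩⟩)

theorem triangleCorners_zz_of_gt (hα : α ∈ Ioo (0 : ℝ) (1 / 2)) (hβ : β ∈ Ioo (0 : ℝ) (1 / 2))
    (hγ : γ ∈ Ioo (0 : ℝ) (1 / 2))
    (l1 : β < γ) (l2 : γ < α) :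
    TriangleCorners (cs α) (cs β) (cs γ) γ β α := by
  obtain ⟨a1, a2⟩ := hα
  obtain ⟨b1, b2⟩ := hβ
  obtain ⟨c1, c2⟩ := hγ
  exact .inl ⟨by linarith, by linarith, fun x hx => cs_lt_of_mem ⟨b1, b2⟩ 0 ⟨by push_cast; linarith [hx.1, hx.2], by push_cast; linarith [hx.1, hx.2]⟩, fun x hx => cs_gt_of_mem ⟨a1, a2⟩ 0 ⟨by push_cast; linarith [hx.1, hx.2], by push_cast; linarith [hx.1, hx.2]⟩⟩

theorem triangleCorners_zx_of_lt (hα : α ∈ Ioo (0 : ℝ) (1 / 2)) (hβ : β ∈ Ioo (0 : ℝ) (1 / 2))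
    (hγ : γ ∈ Ioo (0 : ℝ) (1 / 2))
    (l1 : α < γ) (l2 : γ < β) :
    TriangleCorners (cs α) (cs β) (cs γ) (1 - γ) (1 - β) α := by
  obtain ⟨a1, a2⟩ := hα
  obtain ⟨b1, b2⟩ := hβ
  obtain ⟨c1, c2⟩ := hγ
  exact .inr (.inr (.inl ⟨by linarith, by linarith, fun x hx => cs_lt_of_mem ⟨a1, a2⟩ 0 ⟨by push_cast; linarith [hx.1, hx.2], by push_cast; linarith [hx.1, hx.2]⟩, fun x hx => cs_lt_of_mem ⟨c1, c2⟩ 0 ⟨by push_cast; linarith [hx.1, hx.2], by push_cast; linarith [hx.1, hx.2]⟩⟩))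

theorem triangleCorners_zx_of_gt (hα : α ∈ Ioo (0 : ℝ) (1 / 2)) (hβ : β ∈ Ioo (0 : ℝ) (1 / 2))
    (hγ : γ ∈ Ioo (0 : ℝ) (1 / 2))
    (l1 : β < γ) (l2 : γ < α) :
    TriangleCorners (cs α) (cs β) (cs γ) (-γ) (-β) α := by
  obtain ⟨a1, a2⟩ := hα
  obtain ⟨b1, b2⟩ := hβ
  obtain ⟨c1, c2⟩ := hγ
  exact .inr (.inr (.inr (.inl ⟨by linarith, by linarith, fun x hx => cs_gt_of_mem ⟨c1, c2⟩ 0 ⟨by push_cast; linarith [hx.1, hx.2], by push_cast; linarith [hx.1, hx.2]⟩, fun x hx => cs_gt_of_mem ⟨a1, a2⟩ 0 ⟨by push_cast; linarith [hx.1, hx.2], by push_cast; linarith [hx.1, hx.2]⟩⟩)))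

theorem triangleCorners_xz_of_lt (hα : α ∈ Ioo (0 : ℝ) (1 / 2)) (hβ : β ∈ Ioo (0 : ℝ) (1 / 2))
    (hγ : γ ∈ Ioo (0 : ℝ) (1 / 2))
    (l1 : α < γ) (l2 : γ < β) :
    TriangleCorners (cs α) (cs β) (cs γ) (-γ) β (-α) := by
  obtain ⟨a1, a2⟩ := hα
  obtain ⟨b1, b2⟩ := hβ
  obtain ⟨c1, c2⟩ := hγ
  exact .inr (.inr (.inr (.inr (.inl ⟨by linarith, by linarith, fun x hx => cs_gt_of_mem ⟨c1, c2⟩ 0 ⟨by push_cast; linarith [hx.1, hx.2], by push_cast; linarith [hx.1, hx.2]⟩, fun x hx => cs_gt_of_mem ⟨b1, b2⟩ 0 ⟨by push_cast; linarith [hx.1, hx.2], by push_cast; linarith [hx.1, hx.2]⟩⟩))))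

theorem triangleCorners_xz_of_gt (hα : α ∈ Ioo (0 : ℝ) (1 / 2)) (hβ : β ∈ Ioo (0 : ℝ) (1 / 2))
    (hγ : γ ∈ Ioo (0 : ℝ) (1 / 2))
    (l1 : β < γ) (l2 : γ < α) :
    TriangleCorners (cs α) (cs β) (cs γ) (1 - γ) β (1 - α) := by
  obtain ⟨a1, a2⟩ := hα
  obtain ⟨b1, b2⟩ := hβ
  obtain ⟨c1, c2⟩ := hγ
  exact .inr (.inr (.inr (.inr (.inr ⟨by linarith, by linarith, fun x hx => cs_lt_of_mem ⟨b1, b2⟩ 0 ⟨by push_cast; linarith [hx.1, hx.2], by push_cast; linarith [hx.1, hx.2]⟩, fun x hx => cs_lt_of_mem ⟨c1, c2⟩ 0 ⟨by push_cast; linarith [hx.1, hx.2], by push_cast; linarith [hx.1, hx.2]⟩⟩))))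

end corners

/-! ### Polygons in the torus and their lifts -/

theorem coe_eq_coe_iff {x y : ℝ} : (x : UnitAddCircle) = y ↔ ∃ n : ℤ, x = y + n := by
  rw [← sub_eq_zero, ← AddCircle.coe_sub, AddCircle.coe_eq_zero_iff]
  refine exists_congr fun n => ?_
  rw [zsmul_eq_mul, mul_one]
  constructor <;> intro h <;> linarith

theorem coe_add_int (x : ℝ) (n : ℤ) : ((x + n : ℝ) : UnitAddCircle) = x :=
  coe_eq_coe_iff.2 ⟨n, rfl⟩

theorem cosT_coe' (x : ℝ) : cosT (x : UnitAddCircle) = cs x := cosT_coe x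

theorem proj_mem_Lag {a : ℝ} {w : ℂ} : proj w ∈ Lag a ↔ ∃ n : ℤ, w.im = n - a * cs w.re := by
  rw [mem_Lag, proj, ← AddCircle.coe_neg, coe_eq_coe_iff, cosT_coe']
  refine exists_congr fun n => ?_
  constructor <;> intro h <;> linarith

/-- Each `Lag a` is a graph over the first circle, so membership reduces an equality of points to
one of first coordinates. -/
theorem proj_eq_iff {a : ℝ} {w : ℂ} {p : Torus} (hw : proj w ∈ Lag a) (hp : p ∈ Lag a) :
    proj w = p ↔ (w.re : UnitAddCircle) = p.1 := by
  constructor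
  · rintro rfl
    rfl
  · intro h
    have h1 := mem_Lag.1 hw
    have h2 := mem_Lag.1 hp
    refine Prod.ext h ?_
    rw [h1, h2]
    simp only [proj, h]

theorem starPt_mem (a : ℝ) : starPt a ∈ Lag a := by
  rw [starPt]
  split_ifs with h
  · rw [h, proj_mem_Lag]
    exact ⟨0, by simp⟩
  · exact ⟨_, rfl, rfl⟩

/-- The number of stars on a segment of `φ^a L_(0)`. -/
def starCount (a p q : ℝ) : ℕ := Set.ncard {x ∈ uIcc p q | (x : UnitAddCircle) = (starPt a).1}

theorem starPt_zero_fst : (starPt 0).1 = ((0 : ℝ) : UnitAddCircle) := by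
  simp [starPt, proj]

theorem starPt_fst {a : ℝ} (ha : a ≠ 0) : (starPt a).1 = ((1 / 2 : ℝ) : UnitAddCircle) := by
  rw [starPt, if_neg ha]
  rfl

theorem starCount_eq_zero {a p q c : ℝ} (hc : (starPt a).1 = (c : UnitAddCircle)) (m : ℤ)
    (hp : p ∈ Ioo (c + m) (c + m + 1)) (hq : q ∈ Ioo (c + m) (c + m + 1)) :
    starCount a p q = 0 := by
  have : {x ∈ uIcc p q | (x : UnitAddCircle) = (starPt a).1} = ∅ := by
    rw [Set.eq_empty_iff_forall_notMem]
    rintro x ⟨hx, he⟩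
    have h1 := ordConnected_Ioo.uIcc_subset hp hq hx
    rw [hc] at he
    obtain ⟨n, rfl⟩ := coe_eq_coe_iff.1 he
    have h2 : m < n := by exact_mod_cast (by linarith [h1.1] : (m : ℝ) < n)
    have h3 : n < m + 1 := by exact_mod_cast (by linarith [h1.2] : (n : ℝ) < m + 1)
    omega
  rw [starCount, this, Set.ncard_empty]

theorem starCount_eq_one {a p q c : ℝ} (hc : (starPt a).1 = (c : UnitAddCircle)) (m : ℤ)
    (hm : c + m ∈ uIcc p q) (hp : p ∈ Ioo (c + m - 1) (c + m + 1))
    (hq : q ∈ Ioo (c + m - 1) (c + m + 1)) : starCount a p q = 1 := by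
  have : {x ∈ uIcc p q | (x : UnitAddCircle) = (starPt a).1} = {c + m} := by
    rw [Set.eq_singleton_iff_unique_mem]
    refine ⟨⟨hm, by rw [hc, coe_add_int]⟩, ?_⟩
    rintro x ⟨hx, he⟩
    have h1 := ordConnected_Ioo.uIcc_subset hp hq hx
    rw [hc] at he
    obtain ⟨n, rfl⟩ := coe_eq_coe_iff.1 he
    have : n = m := int_eq_of_lt_of_lt (by linarith [h1.2]) (by linarith [h1.1])
    rw [this]
  rw [starCount, this, Set.ncard_singleton]

section Lift

variable {N : ℕ} [NeZero N] {a : Fin N → ℝ} {x : Fin N → Torus}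

/-- The graph on which the `j`-th side of a lifted polygon lies. -/
def sideFun (a : Fin N → ℝ) (n : Fin N → ℤ) (j : ℕ) (x : ℝ) : ℝ :=
  n (Fin.ofNat N j) - a (Fin.ofNat N j) * cs x

theorem continuous_sideFun (a : Fin N → ℝ) (n : Fin N → ℤ) (j : ℕ) :
    Continuous (sideFun a n j) := by
  unfold sideFun
  fun_prop

theorem ofNat_add_self (j : ℕ) : Fin.ofNat N (j + N) = Fin.ofNat N j := by
  ext
  simp [Fin.ofNat]

theorem sideFun_add (a : Fin N → ℝ) (n : Fin N → ℤ) (j : ℕ) :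
    sideFun a n (j + N) = sideFun a n j := by
  funext x
  rw [sideFun, sideFun, ofNat_add_self]

theorem ofNat_coe (k : Fin N) : Fin.ofNat N (k : ℕ) = k := by
  ext
  simp [Fin.ofNat, Nat.mod_eq_of_lt k.2]

theorem corner_eq (N k : ℕ) : corner N k = circ ((k : ℝ) / N) := rfl

theorem arc_eq (N k : ℕ) : arc N k = circ '' Icc ((k : ℝ) / N) ((k + 1 : ℝ) / N) := rfl

theorem corner_add_self (j : ℕ) : corner N (j + N) = corner N j := by
  have : (N : ℝ) ≠ 0 := by exact_mod_cast NeZero.ne N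
  rw [corner_eq, corner_eq]
  push_cast
  rw [add_div, div_self this, circ_add_one]

theorem corner_mem (N k : ℕ) : corner N k ∈ closedBall (0 : ℂ) 1 := circ_mem_closedBall _

namespace Polygon

theorem cornerX_add_self (u : Polygon a x) (j : ℕ) : u.cornerX (j + N) = u.cornerX j := by
  rw [cornerX, corner_add_self, cornerX]

theorem coe_cornerX {N : ℕ} {a : Fin N → ℝ} {x : Fin N → Torus} (u : Polygon a x)
    (k : Fin N) : (u.cornerX k : UnitAddCircle) = (x k).1 := by
  rw [← u.map_corner k]
  rfl

/-- Along a side `im + a * cs re` is continuous and integer valued, hence constant; this is the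
integer `n k`. -/
theorem exists_sides (u : Polygon a x) (h : IsImmersedDisc u.lift) :
    ∃ n : Fin N → ℤ, Sides N (sideFun a n) u.cornerX u.lift := by
  have hN : (0 : ℝ) < N := by exact_mod_cast NeZero.pos N
  have hside : ∀ k : Fin N, ∃ n : ℤ, ∀ θ ∈ Icc ((k : ℝ) / N) ((k + 1 : ℝ) / N),
      (u.lift (circ θ)).im = n - a k * cs (u.lift (circ θ)).re := by
    intro k
    have hint : ∀ θ ∈ Icc ((k : ℝ) / N) ((k + 1 : ℝ) / N), ∃ n : ℤ,
        (u.lift (circ θ)).im + a k * cs (u.lift (circ θ)).re = n := by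
      intro θ hθ
      obtain ⟨n, hn⟩ := proj_mem_Lag.1 (u.map_side k (circ θ) ⟨θ, hθ, rfl⟩)
      exact ⟨n, by linarith⟩
    have hc := GraphBoundary.continuous_circ_comp u.continuousOn_lift
    have h0 : ((k : ℕ) : ℝ) / N ∈ Icc ((k : ℝ) / N) ((k + 1 : ℝ) / N) :=
      ⟨le_rfl, (Sides.lt_add_one (NeZero.pos N) k).le⟩
    obtain ⟨n, hn⟩ := hint _ h0
    refine ⟨n, fun θ hθ => ?_⟩
    have := isPreconnected_Icc.eq_of_int_valued
      (f := fun θ => (u.lift (circ θ)).im + a k * cs (u.lift (circ θ)).re)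
      (by fun_prop) hint hθ h0
    simp only [hn] at this
    linarith
  choose n hn using hside
  refine ⟨n, u.continuousOn_lift, h, fun j θ hθ => ?_, fun j => rfl⟩
  have hdm : ((j % N : ℕ) : ℝ) = j - N * (j / N : ℕ) := by
    have : ((j % N + N * (j / N) : ℕ) : ℝ) = j := by rw [Nat.mod_add_div]
    push_cast at this ⊢
    linarith
  -- Sides with `j ≥ N` repeat earlier ones after `j / N` full turns.
  have h1 := hn (Fin.ofNat N j) (θ - (j / N : ℕ)) (by
    have e : ((Fin.ofNat N j : ℕ) : ℝ) = j - N * (j / N : ℕ) := hdm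
    rw [e, sub_div, mul_div_cancel_left₀ _ hN.ne', show (j : ℝ) - N * (j / N : ℕ) + 1 =
      (j + 1 : ℝ) - N * (j / N : ℕ) by ring, sub_div, mul_div_cancel_left₀ _ hN.ne']
    exact ⟨by linarith [hθ.1], by linarith [hθ.2]⟩)
  have h2 : circ (θ - (j / N : ℕ)) = circ θ :=
    circ_eq_circ.2 ⟨-((j / N : ℕ) : ℤ), by rw [Int.cast_neg, Int.cast_natCast]; ring⟩
  rw [h2] at h1
  exact h1

theorem exists_of_sides {n : Fin N → ℤ} {X : ℕ → ℝ} {F : ℂ → ℂ} (h : Sides N (sideFun a n) X F)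
    (hx : ∀ k, x k ∈ Lag (a k)) (hX : ∀ k : Fin N, (X k : UnitAddCircle) = (x k).1) :
    ∃ u : Polygon a x, IsImmersedDisc u.lift ∧ ∀ j, u.cornerX j = X j := by
  have hs : ∀ k : Fin N, ∀ ζ ∈ arc N k, proj (F ζ) ∈ Lag (a k) := by
    rintro k _ ⟨θ, hθ, rfl⟩
    have := h.side k θ hθ
    rw [sideFun, ofNat_coe] at this
    exact proj_mem_Lag.2 ⟨_, this⟩
  refine ⟨⟨F, h.cont, fun k => ?_, hs, .inr h.imm⟩, h.imm, h.corner⟩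
  have hc : corner N k ∈ arc N k :=
    ⟨_, ⟨le_rfl, (Sides.lt_add_one (NeZero.pos N) k).le⟩, rfl⟩
  rw [proj_eq_iff (hs k _ hc) (hx k), ← hX]
  exact congrArg _ (h.corner k)

/-- After translation by the lattice vector `c` both lifts are embeddings of a compact disc with the
same image, and the reparametrization is one followed by the inverse of the other. It respects
marked points and arcs because their images are dictated by the graphs and the corner abscissae. -/
theorem equiv_of_sides {u v : Polygon a x} {n m : Fin N → ℤ}
    (hu : Sides N (sideFun a n) u.cornerX u.lift) (hv : Sides N (sideFun a m) v.cornerX v.lift)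
    (M K : ℤ) (hM : ∀ j, v.cornerX j = u.cornerX j + M) (hK : ∀ k, m k = n k + K)
    (huniq : ∀ G, Sides N (sideFun a n) u.cornerX G → InjOn u.lift (closedBall 0 1) ∧
      InjOn G (closedBall 0 1) ∧ u.lift '' closedBall 0 1 = G '' closedBall 0 1) : u ≈ v := by
  let c : ℂ := ⟨M, K⟩
  have hG : Sides N (sideFun a n) u.cornerX fun z => v.lift z - c := by
    refine hv.sub_const c hM fun j x => ?_
    simp only [sideFun, c, cs_add_int, hK]
    push_cast
    ring
  obtain ⟨iF, iG, him⟩ := huniq _ hG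
  have cF : Continuous fun ζ : Disc => u.lift ζ := continuousOn_iff_continuous_domRestrict.1 hu.cont
  have cG : Continuous fun ζ : Disc => v.lift ζ - c := continuousOn_iff_continuous_domRestrict.1 hG.cont
  have : CompactSpace Disc := isCompact_iff_compactSpace.1 (isCompact_closedBall _ _)
  have jF : Function.Injective fun ζ : Disc => u.lift ζ := fun ζ ζ' he =>
    Subtype.ext (iF ζ.2 ζ'.2 he)
  have jG : Function.Injective fun ζ : Disc => v.lift ζ - c := fun ζ ζ' he =>
    Subtype.ext (iG ζ.2 ζ'.2 he)
  let eF := (cF.isClosedEmbedding jF).toIsEmbedding.toHomeomorph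
  let eG := (cG.isClosedEmbedding jG).toIsEmbedding.toHomeomorph
  have hr : range (fun ζ : Disc => u.lift ζ) = range fun ζ : Disc => v.lift ζ - c := by
    rw [image_eq_range, image_eq_range] at him
    exact him
  let φ : Disc ≃ₜ Disc := (eF.trans (Homeomorph.setCongr hr)).trans eG.symm
  have hφ : ∀ ζ : Disc, v.lift (φ ζ) - c = u.lift ζ := by
    intro ζ
    have := eG.apply_symm_apply ((Homeomorph.setCongr hr) (eF ζ))
    exact congrArg Subtype.val this
  have hcor : ∀ (k : Fin N), v.lift (corner N k) - c = u.lift (corner N k) := by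
    intro k
    have h1 := hG.side k _ ⟨le_rfl, (Sides.lt_add_one (NeZero.pos N) k).le⟩
    have h2 := hu.side k _ ⟨le_rfl, (Sides.lt_add_one (NeZero.pos N) k).le⟩
    have h3 := hG.corner k
    have h4 := hu.corner k
    exact Complex.ext (h3.trans h4.symm) (by
      rw [corner_eq, h1, h2, h3, h4])
  refine ⟨φ, fun k ζ => ?_, fun k ζ => ?_, fun ζ => ?_⟩
  · constructor
    · intro h
      refine iG (φ ζ).2 (corner_mem N k) ?_
      simp only [hφ, hcor, h]
    · intro h
      refine iF ζ.2 (corner_mem N k) ?_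
      rw [← hφ, ← hcor, h]
  · have himg : u.lift '' arc N k = (fun z => v.lift z - c) '' arc N k := by
      rw [arc_eq, hu.image_arc (NeZero.pos N), hG.image_arc (NeZero.pos N)]
    have hsub : arc N k ⊆ closedBall 0 1 := by
      rintro _ ⟨θ, -, rfl⟩
      exact circ_mem_closedBall θ
    constructor
    · intro h
      obtain ⟨z, hz, he⟩ := himg.subset ⟨ζ, h, rfl⟩
      have : z = φ ζ := iG (hsub hz) (φ ζ).2 (he.trans (hφ ζ).symm)
      exact this ▸ hz
    · intro h
      obtain ⟨z, hz, he⟩ := himg.superset ⟨φ ζ, h, rfl⟩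
      have : z = ζ := iF (hsub hz) ζ.2 (he.trans (hφ ζ))
      exact this ▸ hz
  · rw [← hφ ζ]
    refine Prod.ext ?_ ?_
    · refine coe_eq_coe_iff.2 ⟨M, ?_⟩
      simp [c]
    · refine coe_eq_coe_iff.2 ⟨K, ?_⟩
      simp [c]

/-- The two lifts, compared through the homeomorphism, differ horizontally by a continuous integer
valued function on the connected disc. Corner abscissae up to a common integer are thus invariants
of a class, and they tell the two bigons apart. -/
theorem cornerX_of_equiv {N : ℕ} {a : Fin N → ℝ} {x : Fin N → Torus} {u v : Polygon a x}
    (h : u ≈ v) :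
    ∃ M : ℤ, ∀ k : Fin N, v.cornerX k = u.cornerX k + M := by
  obtain ⟨φ, h1, -, h3⟩ := h
  have hint : ∀ ζ : Disc, ∃ n : ℤ, (v.lift (φ ζ)).re - (u.lift ζ).re = n := by
    intro ζ
    obtain ⟨n, hn⟩ := coe_eq_coe_iff.1 (congrArg Prod.fst (h3 ζ))
    exact ⟨n, by linarith⟩
  have : PreconnectedSpace Disc :=
    Subtype.preconnectedSpace (convex_closedBall (0 : ℂ) 1).isPreconnected
  have cu : Continuous fun ζ : Disc => u.lift ζ :=
    continuousOn_iff_continuous_domRestrict.1 u.continuousOn_lift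
  have cv : Continuous fun ζ : Disc => v.lift ζ :=
    continuousOn_iff_continuous_domRestrict.1 v.continuousOn_lift
  have hc : Continuous fun ζ : Disc => (v.lift (φ ζ)).re - (u.lift ζ).re :=
    (Complex.continuous_re.comp (cv.comp φ.continuous)).sub (Complex.continuous_re.comp cu)
  obtain ⟨M, hM⟩ := hint ⟨0, by simp⟩
  refine ⟨M, fun k => ?_⟩
  have h4 := isPreconnected_univ.eq_of_int_valued hc.continuousOn (fun ζ _ => hint ζ)
    (mem_univ (⟨corner N k, corner_mem N k⟩ : Disc)) (mem_univ ⟨0, by simp⟩)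
  simp only [hM, (h1 k ⟨corner N k, corner_mem N k⟩).1 rfl] at h4
  rw [cornerX, cornerX]
  linarith

/-- The abscissa is injective on a side and determines the point of the curve, so stars can be
counted on intervals of the real line. -/
theorem numStars_eq {u : Polygon a x} {n : Fin N → ℤ}
    (hu : Sides N (sideFun a n) u.cornerX u.lift) :
    u.numStars = ∑ k : Fin N, starCount (a k) (u.cornerX k) (u.cornerX (k + 1)) := by
  refine Finset.sum_congr rfl fun k _ => ?_
  have hinj : InjOn (fun ζ => (u.lift ζ).re) (arc N k) := by
    rintro _ ⟨θ, hθ, rfl⟩ _ ⟨θ', hθ', rfl⟩ he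
    rw [hu.injOn_side k hθ hθ' he]
  rw [starCount, ← hu.image_side (NeZero.pos N) k,
    ← (hinj.mono fun z hz => hz.1).ncard_image (f := fun ζ => (u.lift ζ).re)]
  congr 1
  ext y
  constructor
  · rintro ⟨ζ, ⟨⟨θ, hθ, rfl⟩, he⟩, rfl⟩
    exact ⟨⟨θ, hθ, rfl⟩, congrArg Prod.fst he⟩
  · rintro ⟨⟨θ, hθ, rfl⟩, he⟩
    refine ⟨circ θ, ⟨⟨θ, hθ, rfl⟩, ?_⟩, rfl⟩
    exact (proj_eq_iff (u.map_side k _ ⟨θ, hθ, rfl⟩) (starPt_mem _)).2 he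

end Polygon

end Lift

/-- A sum over a moduli space with one element. -/
theorem finsum_moduli_eq {N : ℕ} {a : Fin N → ℝ} {x : Fin N → Torus} {C : Type*}
    [AddCommMonoid C] (hne : Nonempty (Polygon a x)) (hs : ∀ u v : Polygon a x, u ≈ v)
    {W : Polygon a x → C} {w : C} (hW : ∀ u, W u = w) : ∑ᶠ q : Moduli a x, W q.out = w := by
  obtain ⟨u⟩ := hne
  have : Unique (Moduli a x) :=
    ⟨⟨⟦u⟧⟩, fun q => Quotient.inductionOn q fun v => Quotient.sound (hs v u)⟩
  rw [finsum_unique, hW]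

/-- A sum over a moduli space with two elements. -/
theorem finsum_moduli_eq_add {N : ℕ} {a : Fin N → ℝ} {x : Fin N → Torus} {C : Type*}
    [AddCommMonoid C] {u v : Polygon a x} (huv : ¬ u ≈ v)
    (hs : ∀ w : Polygon a x, w ≈ u ∨ w ≈ v) {W : Polygon a x → C} {b c : C}
    (hu : ∀ w, w ≈ u → W w = b) (hv : ∀ w, w ≈ v → W w = c) :
    ∑ᶠ q : Moduli a x, W q.out = b + c := by
  classical
  have hne : (⟦u⟧ : Moduli a x) ≠ ⟦v⟧ := fun h => huv (Quotient.exact h)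
  have hsub : Function.support (fun q : Moduli a x => W q.out) ⊆
      (({⟦u⟧, ⟦v⟧} : Finset (Moduli a x)) : Set (Moduli a x)) := by
    intro q _
    induction q using Quotient.inductionOn with
    | h w =>
      rcases hs w with h | h
      · simp [show (⟦w⟧ : Moduli a x) = ⟦u⟧ from Quotient.sound h]
      · simp [show (⟦w⟧ : Moduli a x) = ⟦v⟧ from Quotient.sound h]
  rw [finsum_eq_sum_of_support_subset _ hsub, Finset.sum_pair hne, hu _ (Quotient.mk_out u),
    hv _ (Quotient.mk_out v)]

/-! ### The intersection points -/

/-- The first coordinate `arccos (i / s) / (2 π)` of `z_i^{(s)}`. -/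
def ang (s : ℝ) (i : ℤ) : ℝ := Real.arccos (i / s) / (2 * Real.pi)

theorem mul_cs_ang {s : ℝ} {i : ℤ} (h : |(i : ℝ)| ≤ s) : s * cs (ang s i) = i := mul_cos_arccos h

theorem ang_mem {s : ℝ} {i : ℤ} (h : |(i : ℝ)| < s) : ang s i ∈ Ioo (0 : ℝ) (1 / 2) := by
  have hs : 0 < s := (abs_nonneg _).trans_lt h
  obtain ⟨h1, h2⟩ := abs_lt.1 h
  have hpi := Real.pi_pos
  have k1 : 0 < Real.arccos (i / s) := Real.arccos_pos.2 (by rw [div_lt_one hs]; exact h2)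
  have k2 : Real.arccos (i / s) < Real.pi := by
    refine lt_of_le_of_ne (Real.arccos_le_pi _) fun h => ?_
    have := Real.arccos_eq_pi.1 h
    rw [div_le_iff₀ hs] at this
    linarith
  rw [ang]
  exact ⟨by positivity, by rw [div_lt_iff₀ (by positivity)]; linarith⟩

theorem sinT_ang {s : ℝ} {i : ℤ} (h : |(i : ℝ)| < s) : 0 < sinT (ang s i : UnitAddCircle) := by
  obtain ⟨h1, h2⟩ := ang_mem h
  have hpi := Real.pi_pos
  rw [sinT_coe]
  exact Real.sin_pos_of_pos_of_lt_pi (by positivity) (by nlinarith)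

theorem sinT_one_sub_ang {s : ℝ} {i : ℤ} (h : |(i : ℝ)| < s) :
    sinT ((1 - ang s i : ℝ) : UnitAddCircle) < 0 := by
  have := sinT_ang h
  rw [sinT_coe] at this ⊢
  rw [mul_sub, mul_one, Real.sin_two_pi_sub]
  linarith

theorem mas_eq_zero {a b : ℝ} (hab : b < a) {p : Torus} (hp : 0 < sinT p.1) : mas a b p = 0 :=
  if_pos (mul_pos (sub_pos.2 hab) hp)

theorem mas_eq_one {a b : ℝ} (hab : b < a) {p : Torus} (hp : sinT p.1 < 0) : mas a b p = 1 :=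
  if_neg (mul_neg_of_pos_of_neg (sub_pos.2 hab) hp).not_gt

theorem zPt_fst {s : ℝ} {i : ℤ} (h : |(i : ℝ)| ≤ s) :
    (zPt s i h).1.1 = (ang s i : UnitAddCircle) := rfl

theorem xiPt_fst {s : ℝ} {i : ℤ} (h : |(i : ℝ)| ≤ s) :
    (xiPt s i h).1.1 = ((1 - ang s i : ℝ) : UnitAddCircle) := rfl

theorem snd_eq_zero {s : ℝ} (p : InterPt s 0) : p.1.2 = 0 := by
  have := mem_Lag.1 p.2.2
  simpa using this

theorem interPt_ext {s : ℝ} {p q : InterPt s 0} (h : p.1.1 = q.1.1) : p = q :=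
  Subtype.ext (Prod.ext h ((snd_eq_zero p).trans (snd_eq_zero q).symm))

theorem label_zPt {s : ℝ} {i : ℤ} (h : |(i : ℝ)| ≤ s) : label (zPt s i h) = i := by
  have := label_eq (zPt s i h)
  rw [zPt_fst, cosT_coe', mul_cs_ang h] at this
  exact_mod_cast this

theorem label_xiPt {s : ℝ} {i : ℤ} (h : |(i : ℝ)| ≤ s) : label (xiPt s i h) = i := by
  have := label_eq (xiPt s i h)
  rw [xiPt_fst, cosT_coe', ← add_zero (1 - ang s i), ← Int.cast_zero, cs_one_sub_add_int,
    mul_cs_ang h] at this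
  exact_mod_cast this

/-- With the abscissa represented in `[-1/2, 1/2)`, the arccosine recovers its absolute value from
the label, and its sign separates `z` from `ξ`. -/
theorem eq_zPt_or_eq_xiPt {s : ℝ} (hs : 0 < s) (p : InterPt s 0) :
    p = zPt s (label p) (abs_label_le hs.le p) ∨ p = xiPt s (label p) (abs_label_le hs.le p) := by
  have hpi := Real.pi_pos
  obtain ⟨t, ht⟩ : ∃ t : ℝ, (t : UnitAddCircle) = p.1.1 := QuotientAddGroup.mk_surjective _
  obtain ⟨r, hr, he⟩ : ∃ r ∈ Ico (-(1 / 2) : ℝ) (1 / 2), (r : UnitAddCircle) = p.1.1 := by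
    refine ⟨toIcoMod one_pos (-(1 / 2)) t, ?_, ?_⟩
    · have := toIcoMod_mem_Ico (one_pos (α := ℝ)) (-(1 / 2)) t
      exact ⟨this.1, by linarith [this.2]⟩
    · rw [← ht, coe_eq_coe_iff]
      exact ⟨-toIcoDiv one_pos (-(1 / 2)) t, by rw [toIcoMod]; simp [sub_eq_add_neg]⟩
  have hl := label_eq p
  rw [← he, cosT_coe'] at hl
  have hang : ∀ x : ℝ, 0 ≤ x → x ≤ 1 / 2 → cs x = cs r → ang s (label p) = x := by
    intro x h0 h1 hx
    rw [ang, hl, ← hx, mul_div_cancel_left₀ _ hs.ne', cs,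
      Real.arccos_cos (by positivity) (by nlinarith)]
    field_simp
  rcases le_total 0 r with h | h
  · left
    refine interPt_ext ?_
    rw [zPt_fst, hang r h hr.2.le rfl, he]
  · right
    refine interPt_ext ?_
    rw [xiPt_fst, hang (-r) (by linarith) (by linarith [hr.1]) (cs_neg r), ← he]
    exact coe_eq_coe_iff.2 ⟨-1, by push_cast; ring⟩

/-! ### The differential -/

theorem finsum_prop {M : Type*} [AddCommMonoid M] {p : Prop} {v : M} (hp : p) :
    ∑ᶠ _ : p, v = v := by
  simp [hp]

section Bigon

variable {s : ℝ} {i : ℤ}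

theorem sideFun_two (n : Fin 2 → ℤ) (s x : ℝ) : sideFun ![s, 0] n 0 x = n 0 - s * cs x ∧
    sideFun ![s, 0] n 1 x = n 1 ∧ sideFun ![s, 0] n 2 x = n 0 - s * cs x := by
  refine ⟨rfl, ?_, rfl⟩
  have : sideFun ![s, 0] n 1 x = n 1 - 0 * cs x := rfl
  rw [this]
  ring

theorem Polygon.bigon_constant_or {s : ℝ} {y x : Torus} (u : Polygon ![s, 0] ![y, x]) :
    y = x ∨ ∃ n : Fin 2 → ℤ, Sides 2 (sideFun ![s, 0] n) u.cornerX u.lift ∧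
      s * cs (u.cornerX 0) = n 0 - n 1 ∧ s * cs (u.cornerX 1) = n 0 - n 1 := by
  rcases u.constant_or_immersed with ⟨c, hc⟩ | h
  · left
    have h0 := u.map_corner 0
    have h1 := u.map_corner 1
    rw [hc _ (corner_mem _ _)] at h0 h1
    exact h0.symm.trans h1
  · right
    obtain ⟨n, hn⟩ := u.exists_sides h
    refine ⟨n, hn, ?_, ?_⟩
    · have := hn.agree two_pos 1
      rw [show 1 + 1 = 0 + 2 from rfl, u.cornerX_add_self 0, (sideFun_two n s _).2.1,
        (sideFun_two n s _).2.2] at this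
      linarith
    · have := hn.agree two_pos 0
      rw [(sideFun_two n s _).1, zero_add, (sideFun_two n s _).2.1] at this
      linarith

/-- The lower graph is the one traversed to the right, and comparing `n 0 - s * cs x` with `n 1`
means comparing `cs x` with its value at the corners. -/
theorem sides_bigon_iff {n : Fin 2 → ℤ} {X : ℕ → ℝ} (hX : ∀ j, X (j + 2) = X j) (hs : 0 < s)
    {α : ℝ} (hα : s * cs α = n 0 - n 1) (h0 : cs (X 0) = cs α) (h1 : cs (X 1) = cs α) :
    (∃ F, Sides 2 (sideFun ![s, 0] n) X F) ↔
      (X 0 < X 1 ∧ ∀ x ∈ Ioo (X 0) (X 1), cs α < cs x) ∨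
      (X 1 < X 0 ∧ ∀ x ∈ Ioo (X 1) (X 0), cs x < cs α) := by
  have hper : ∀ j, sideFun ![s, 0] n (j + 2) = sideFun ![s, 0] n j := sideFun_add _ n
  have hc := continuous_sideFun ![s, 0] n
  have x2 : X 2 = X 0 := hX 0
  constructor
  · rintro ⟨F, hF⟩
    rcases lt_or_gt_of_ne (hF.ne two_pos 0) with h | h
    · refine .inl ⟨h, fun x hx => ?_⟩
      have := (hF.bigon hc hX (k := 0) h).1 x hx
      rw [(sideFun_two n s x).1, zero_add, (sideFun_two n s x).2.1] at this
      exact lt_of_mul_lt_mul_left (by linarith) hs.le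
    · refine .inr ⟨h, fun x hx => ?_⟩
      have := (hF.bigon hc hX (k := 1) (by rw [show 1 + 1 = 2 from rfl, x2]; exact h)).1 x
        (by rw [show 1 + 1 = 2 from rfl, x2]; exact hx)
      rw [(sideFun_two n s x).2.1, show 1 + 1 = 2 from rfl, (sideFun_two n s x).2.2] at this
      exact lt_of_mul_lt_mul_left (by linarith) hs.le
  · rintro (⟨h, hlt⟩ | ⟨h, hlt⟩)
    · refine exists_sides_bigon hc hper hX (k := 0) h ?_ ?_ fun x hx => ?_
      · rw [(sideFun_two n s _).1, zero_add, (sideFun_two n s _).2.1, h0]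
        linarith
      · rw [(sideFun_two n s _).1, zero_add, (sideFun_two n s _).2.1, h1]
        linarith
      · rw [(sideFun_two n s _).1, zero_add, (sideFun_two n s _).2.1]
        have := mul_lt_mul_of_pos_left (hlt x hx) hs
        linarith
    · refine exists_sides_bigon hc hper hX (k := 1) ?_ ?_ ?_ fun x hx => ?_ <;>
        rw [show 1 + 1 = 2 from rfl, x2] at *
      · exact h
      · rw [(sideFun_two n s _).2.1, (sideFun_two n s _).2.2, h1]
        linarith
      · rw [(sideFun_two n s _).2.1, (sideFun_two n s _).2.2, h0]
        linarith
      · rw [(sideFun_two n s _).2.1, (sideFun_two n s _).2.2]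
        have := mul_lt_mul_of_pos_left (hlt x hx) hs
        linarith

/-- The corners of the bigons from `z_i` to `ξ_i`, up to a common translation. -/
theorem Polygon.bigon_corners (hi : |(i : ℝ)| < s)
    (u : Polygon ![s, 0] ![(xiPt s i hi.le).1, (zPt s i hi.le).1]) :
    ∃ n : Fin 2 → ℤ, Sides 2 (sideFun ![s, 0] n) u.cornerX u.lift ∧ (n 0 - n 1 = i) ∧ ∃ m : ℤ,
      (u.cornerX 0 = -ang s i + m ∧ u.cornerX 1 = ang s i + m) ∨
      (u.cornerX 0 = 1 - ang s i + m ∧ u.cornerX 1 = ang s i + m) := by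
  have hs : 0 < s := (abs_nonneg _).trans_lt hi
  obtain ⟨a1, a2⟩ := ang_mem hi
  rcases u.bigon_constant_or with h | ⟨n, hn, e0, e1⟩
  · have h1 := sinT_ang hi
    have h2 := sinT_one_sub_ang hi
    rw [← zPt_fst hi.le, ← h] at h1
    rw [← xiPt_fst hi.le] at h2
    exact absurd h1 h2.not_gt
  obtain ⟨m₀, hm₀⟩ := coe_eq_coe_iff.1 (u.coe_cornerX 0)
  obtain ⟨m₁, hm₁⟩ := coe_eq_coe_iff.1 (u.coe_cornerX 1)
  change u.cornerX 0 = 1 - ang s i + m₀ at hm₀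
  change u.cornerX 1 = ang s i + m₁ at hm₁
  have c0 : cs (u.cornerX 0) = cs (ang s i) := by rw [hm₀, cs_one_sub_add_int]
  have c1 : cs (u.cornerX 1) = cs (ang s i) := by rw [hm₁, cs_add_int]
  rw [c1] at e1
  refine ⟨n, hn, ?_, m₁, ?_⟩
  · have := mul_cs_ang hi.le
    rw [e1] at this
    exact_mod_cast this
  rcases (sides_bigon_iff u.cornerX_add_self hs e1 c0 c1).1 ⟨_, hn⟩ with ⟨h, hlt⟩ | ⟨h, hlt⟩
  · left
    rw [hm₀, hm₁] at h hlt
    -- Otherwise the next point at the same level lies strictly inside the interval, where the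
    -- cosine should exceed that level.
    have k : ang s i + ((m₀ + 1 : ℤ) : ℝ) ≥ ang s i + m₁ := by
      by_contra! hcon
      exact (hlt _ ⟨by push_cast; linarith, hcon⟩).ne' (cs_add_int _ _)
    push_cast at k
    have : m₁ = m₀ + 1 := int_eq_of_lt_of_lt (by push_cast; linarith) (by push_cast; linarith)
    refine ⟨?_, hm₁⟩
    rw [hm₀, this]
    push_cast
    ring
  · right
    rw [hm₀, hm₁] at h hlt
    have k : 1 - ang s i + (m₁ : ℝ) ≥ 1 - ang s i + m₀ := by
      by_contra! hcon
      exact (hlt _ ⟨by linarith, hcon⟩).ne (cs_one_sub_add_int _ _)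
    have : m₁ = m₀ := int_eq_of_lt_of_lt (by linarith) (by linarith)
    rw [this]
    exact ⟨hm₀, hm₁.trans (by rw [this])⟩

theorem Polygon.bigon_equiv {y x : Torus} {u v : Polygon ![s, 0] ![y, x]} {n m : Fin 2 → ℤ}
    (hu : Sides 2 (sideFun ![s, 0] n) u.cornerX u.lift)
    (hv : Sides 2 (sideFun ![s, 0] m) v.cornerX v.lift) (hnm : n 0 - n 1 = m 0 - m 1) {M : ℤ}
    (h0 : v.cornerX 0 = u.cornerX 0 + M) (h1 : v.cornerX 1 = u.cornerX 1 + M) : u ≈ v := by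
  refine equiv_of_sides hu hv M (m 0 - n 0) ?_ ?_ fun G hG =>
    hu.bigon_unique hG (continuous_sideFun _ _) u.cornerX_add_self
  · intro j
    induction j using Nat.twoStepInduction with
    | zero => exact h0
    | one => exact h1
    | more j ih _ => rw [v.cornerX_add_self, u.cornerX_add_self, ih]
  · intro k
    fin_cases k
    · simp
    · simp
      omega

theorem exists_bigon (hi : |(i : ℝ)| < s) {x₀ x₁ : ℝ}
    (h0 : (x₀ : UnitAddCircle) = ((1 - ang s i : ℝ) : UnitAddCircle))
    (h1 : (x₁ : UnitAddCircle) = (ang s i : UnitAddCircle))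
    (h : (x₀ < x₁ ∧ ∀ x ∈ Ioo x₀ x₁, cs (ang s i) < cs x) ∨
      (x₁ < x₀ ∧ ∀ x ∈ Ioo x₁ x₀, cs x < cs (ang s i))) :
    ∃ u : Polygon ![s, 0] ![(xiPt s i hi.le).1, (zPt s i hi.le).1],
      u.cornerX 0 = x₀ ∧ u.cornerX 1 = x₁ := by
  have hs : 0 < s := (abs_nonneg _).trans_lt hi
  let X : ℕ → ℝ := fun j => ![x₀, x₁] (Fin.ofNat 2 j)
  have hX : ∀ j, X (j + 2) = X j := fun j => congrArg ![x₀, x₁] (ofNat_add_self j)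
  have c0 : cs x₀ = cs (ang s i) := by
    obtain ⟨m, rfl⟩ := coe_eq_coe_iff.1 h0
    rw [cs_one_sub_add_int]
  have c1 : cs x₁ = cs (ang s i) := by
    obtain ⟨m, rfl⟩ := coe_eq_coe_iff.1 h1
    rw [cs_add_int]
  obtain ⟨F, hF⟩ := (sides_bigon_iff (n := ![i, 0]) hX hs
    (by rw [mul_cs_ang hi.le]; simp) c0 c1).2 h
  obtain ⟨u, -, hu⟩ := Polygon.exists_of_sides hF
    (x := ![(xiPt s i hi.le).1, (zPt s i hi.le).1]) (by
      intro k
      fin_cases k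
      · exact (xiPt s i hi.le).2.1
      · exact (zPt s i hi.le).2.2) (by
      intro k
      fin_cases k
      · exact h0
      · exact h1)
  exact ⟨u, hu 0, hu 1⟩

theorem floor_ang (hi : |(i : ℝ)| < s) (m : ℤ) : ⌊ang s i + m⌋ = m := by
  obtain ⟨a1, a2⟩ := ang_mem hi
  rw [Int.floor_eq_iff]
  constructor <;> linarith

theorem floor_neg_ang (hi : |(i : ℝ)| < s) (m : ℤ) : ⌊-ang s i + m⌋ = m - 1 := by
  obtain ⟨a1, a2⟩ := ang_mem hi
  rw [Int.floor_eq_iff]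
  push_cast
  constructor <;> linarith

theorem floor_one_sub_ang (hi : |(i : ℝ)| < s) (m : ℤ) : ⌊1 - ang s i + m⌋ = m := by
  obtain ⟨a1, a2⟩ := ang_mem hi
  rw [Int.floor_eq_iff]
  constructor <;> linarith

variable {C : Type*} [CommRing C] (σ : C ≃+* C)

/-- The bigon over an interval around `0` has the star of `L` on its backward side, so its two signs
cancel, and that side crosses `x = 0` to the left, giving `σ c`. The bigon around `1/2` has the star
of the other curve, no backward sign and no crossing on the side along `L`, giving `-c`. -/
theorem finsum_bigons (hi : |(i : ℝ)| < s) (c : C) :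
    ∑ᶠ u : Moduli ![s, 0] ![(xiPt s i hi.le).1, (zPt s i hi.le).1],
      bigonSign u.out • u.out.nabla σ 1 (c * u.out.nabla σ 0 1) = σ c + -c := by
  have hs : 0 < s := (abs_nonneg _).trans_lt hi
  obtain ⟨a1, a2⟩ := ang_mem hi
  have hz : mas s 0 (zPt s i hi.le).1 = 0 := mas_eq_zero hs (sinT_ang hi)
  have hx : mas s 0 (xiPt s i hi.le).1 = 1 := mas_eq_one hs (sinT_one_sub_ang hi)
  obtain ⟨u, u0, u1⟩ := exists_bigon hi (x₀ := -ang s i) (x₁ := ang s i)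
    (coe_eq_coe_iff.2 ⟨-1, by push_cast; ring⟩) rfl
    (.inl ⟨by linarith, fun x hx => cs_gt_of_mem ⟨a1, a2⟩ 0 (by simpa using hx)⟩)
  obtain ⟨v, v0, v1⟩ := exists_bigon hi (x₀ := 1 - ang s i) (x₁ := ang s i) rfl rfl
    (.inr ⟨by linarith, fun x hx => cs_lt_of_mem ⟨a1, a2⟩ 0 (by simpa using hx)⟩)
  obtain ⟨n, hn, hni, -⟩ := u.bigon_corners hi
  obtain ⟨m, hm, hmi, -⟩ := v.bigon_corners hi
  have star0 := starPt_zero_fst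
  have star1 := starPt_fst hs.ne'
  have x2 : ∀ w : Polygon ![s, 0] ![(xiPt s i hi.le).1, (zPt s i hi.le).1],
    w.cornerX 2 = w.cornerX 0 := fun w => w.cornerX_add_self 0
  refine finsum_moduli_eq_add (u := u) (v := v) ?_ ?_
    (W := fun w => bigonSign w • w.nabla σ 1 (c * w.nabla σ 0 1)) ?_ ?_
  · intro h
    obtain ⟨M, hM⟩ := Polygon.cornerX_of_equiv h
    have e0 := hM 0
    have e1 := hM 1
    simp only [Fin.val_zero, Fin.val_one, u0, u1, v0, v1] at e0 e1
    linarith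
  · intro w
    obtain ⟨l, hl, hli, M, ⟨w0, w1⟩ | ⟨w0, w1⟩⟩ := w.bigon_corners hi
    · left
      exact Setoid.symm (Polygon.bigon_equiv hn hl (hni.trans hli.symm) (w0.trans (by rw [u0]))
        (w1.trans (by rw [u1])))
    · right
      exact Setoid.symm (Polygon.bigon_equiv hm hl (hmi.trans hli.symm) (w0.trans (by rw [v0]))
        (w1.trans (by rw [v1])))
  · intro w hw
    obtain ⟨M, hM⟩ := Polygon.cornerX_of_equiv (Setoid.symm hw)
    obtain ⟨l, hl, -, -⟩ := w.bigon_corners hi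
    have e0 := hM 0
    have e1 := hM 1
    simp only [Fin.val_zero, Fin.val_one, u0, u1] at e0 e1
    have hst : w.numStars = 1 := by
      rw [Polygon.numStars_eq hl, Fin.sum_univ_two]
      simp only [Fin.val_zero, Fin.val_one, Matrix.cons_val_zero, Matrix.cons_val_one]
      rw [zero_add, show 1 + 1 = 2 from rfl, x2, e0, e1,
        starCount_eq_zero star1 (M - 1) (by push_cast; constructor <;> linarith)
          (by push_cast; constructor <;> linarith),
        starCount_eq_one star0 M (by
          rw [uIcc_of_ge (by linarith)]
          constructor <;> linarith) (by constructor <;> linarith) (by constructor <;> linarith)]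
    have hb : w.Backward 1 := by
      rw [Polygon.Backward, show 1 + 1 = 2 from rfl, x2, e0, e1]
      linarith
    have hsign : bigonSign w = 1 := by
      rw [bigonSign, hst, if_pos hb, hz, hx]
      norm_num
    simp only [hsign, Polygon.nabla, zero_add, show 1 + 1 = 2 from rfl, x2, e0, e1, floor_ang hi,
      floor_neg_ang hi, map_one, mul_one, one_smul, sub_sub_cancel, zpow_one]
  · intro w hw
    obtain ⟨M, hM⟩ := Polygon.cornerX_of_equiv (Setoid.symm hw)
    obtain ⟨l, hl, -, -⟩ := w.bigon_corners hi
    have e0 := hM 0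
    have e1 := hM 1
    simp only [Fin.val_zero, Fin.val_one, v0, v1] at e0 e1
    have hst : w.numStars = 1 := by
      rw [Polygon.numStars_eq hl, Fin.sum_univ_two]
      simp only [Fin.val_zero, Fin.val_one, Matrix.cons_val_zero, Matrix.cons_val_one]
      rw [zero_add, show 1 + 1 = 2 from rfl, x2, e0, e1,
        starCount_eq_one star1 M (by
          rw [uIcc_of_ge (by linarith)]
          constructor <;> linarith) (by constructor <;> linarith) (by constructor <;> linarith),
        starCount_eq_zero star0 M (by constructor <;> linarith)
          (by constructor <;> linarith)]
    have hb : ¬ w.Backward 1 := by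
      rw [Polygon.Backward, show 1 + 1 = 2 from rfl, x2, e0, e1]
      linarith
    have hsign : bigonSign w = -1 := by
      rw [bigonSign, hst, if_neg hb]
      norm_num
    simp only [hsign, Polygon.nabla, zero_add, show 1 + 1 = 2 from rfl, x2, e0, e1, floor_ang hi,
      floor_one_sub_ang hi, map_one, mul_one, sub_self, zpow_zero, RingAut.one_apply, neg_smul,
      one_smul]

end Bigon

/-! ### The triangle product -/

section Triangle

variable {s s' : ℝ}

theorem sideFun_three (n : Fin 3 → ℤ) (s s' x : ℝ) :
    sideFun ![s + s', s, 0] n 0 x = n 0 - (s + s') * cs x ∧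
    sideFun ![s + s', s, 0] n 1 x = n 1 - s * cs x ∧ sideFun ![s + s', s, 0] n 2 x = n 2 := by
  refine ⟨rfl, rfl, ?_⟩
  have : sideFun ![s + s', s, 0] n 2 x = n 2 - 0 * cs x := rfl
  rw [this]
  ring

/-- The six alternatives are the choice of the middle corner and of its orientation. The difference
of two sides is `s'`, `s` or `s + s'` times the difference of `cs x` and its value at the corner
shared by them, so the positive factor can be cancelled. -/
theorem sides_triangle_iff {n : Fin 3 → ℤ} {X : ℕ → ℝ} (hX : ∀ j, X (j + 3) = X j) (hs : 0 < s)
    (hs' : 0 < s') (e0 : (s + s') * cs (X 0) = n 0 - n 2) (e1 : s' * cs (X 1) = n 0 - n 1)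
    (e2 : s * cs (X 2) = n 1 - n 2) :
    (∃ F, Sides 3 (sideFun ![s + s', s, 0] n) X F) ↔
      TriangleCorners (cs (X 2)) (cs (X 1)) (cs (X 0)) (X 0) (X 1) (X 2) := by
  have hper : ∀ j, sideFun ![s + s', s, 0] n (j + 3) = sideFun ![s + s', s, 0] n j :=
    sideFun_add _ n
  have hc := continuous_sideFun ![s + s', s, 0] n
  have x3 : X 3 = X 0 := hX 0
  have x4 : X 4 = X 1 := hX 1
  have f0 := fun x => (sideFun_three n s s' x).1
  have f1 := fun x => (sideFun_three n s s' x).2.1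
  have f2 := fun x => (sideFun_three n s s' x).2.2
  have f3 : ∀ x, sideFun ![s + s', s, 0] n 3 x = n 0 - (s + s') * cs x := f0
  have f4 : ∀ x, sideFun ![s + s', s, 0] n 4 x = n 1 - s * cs x := f1
  have hss : 0 < s + s' := add_pos hs hs'
  constructor
  · rintro ⟨F, hF⟩
    obtain ⟨k, hk, h⟩ := hF.triangle_cases hX
    interval_cases k
    · rcases h with ⟨h1, h2⟩ | ⟨h1, h2⟩
      · obtain ⟨l1, l2⟩ := hF.triangle_pos hc hper hX h1 h2
        norm_num [f0, f1, f2] at l1 l2 h1 h2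
        exact .inl ⟨h1, h2,
          fun x hx => lt_of_mul_lt_mul_left (by linarith [l1 x hx.1 hx.2]) hs'.le,
          fun x hx => lt_of_mul_lt_mul_left (by linarith [l2 x hx.1 hx.2]) hs.le⟩
      · obtain ⟨l1, l2⟩ := hF.triangle_neg hc hper hX h1 h2
        norm_num [f0, f1, f2] at l1 l2 h1 h2
        exact .inr (.inl ⟨h1, h2,
          fun x hx => lt_of_mul_lt_mul_left (by linarith [l1 x hx.1 hx.2]) hs.le,
          fun x hx => lt_of_mul_lt_mul_left (by linarith [l2 x hx.1 hx.2]) hs'.le⟩)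
    · rcases h with ⟨h1, h2⟩ | ⟨h1, h2⟩
      · obtain ⟨l1, l2⟩ := hF.triangle_pos hc hper hX h1 h2
        norm_num [f0, f1, f2, f3, x3] at l1 l2 h1 h2
        exact .inr (.inr (.inl ⟨h1, h2,
          fun x hx => lt_of_mul_lt_mul_left (by linarith [l1 x hx.1 hx.2]) hs.le,
          fun x hx => lt_of_mul_lt_mul_left (by linarith [l2 x hx.1 hx.2]) hss.le⟩))
      · obtain ⟨l1, l2⟩ := hF.triangle_neg hc hper hX h1 h2
        norm_num [f0, f1, f2, f3, x3] at l1 l2 h1 h2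
        exact .inr (.inr (.inr (.inl ⟨h1, h2,
          fun x hx => lt_of_mul_lt_mul_left (by linarith [l1 x hx.1 hx.2]) hss.le,
          fun x hx => lt_of_mul_lt_mul_left (by linarith [l2 x hx.1 hx.2]) hs.le⟩)))
    · rcases h with ⟨h1, h2⟩ | ⟨h1, h2⟩
      · obtain ⟨l1, l2⟩ := hF.triangle_pos hc hper hX h1 h2
        norm_num [f0, f1, f2, f3, f4, x3, x4] at l1 l2 h1 h2
        exact .inr (.inr (.inr (.inr (.inl ⟨h1, h2,
          fun x hx => lt_of_mul_lt_mul_left (by linarith [l1 x hx.1 hx.2]) hss.le,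
          fun x hx => lt_of_mul_lt_mul_left (by linarith [l2 x hx.1 hx.2]) hs'.le⟩))))
      · obtain ⟨l1, l2⟩ := hF.triangle_neg hc hper hX h1 h2
        norm_num [f0, f1, f2, f3, f4, x3, x4] at l1 l2 h1 h2
        exact .inr (.inr (.inr (.inr (.inr ⟨h1, h2,
          fun x hx => lt_of_mul_lt_mul_left (by linarith [l1 x hx.1 hx.2]) hs'.le,
          fun x hx => lt_of_mul_lt_mul_left (by linarith [l2 x hx.1 hx.2]) hss.le⟩))))
  · have m : ∀ {t a b : ℝ}, 0 < t → a < b → t * a < t * b := fun ht h =>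
      mul_lt_mul_of_pos_left h ht
    rintro (⟨h1, h2, l1, l2⟩ | ⟨h1, h2, l1, l2⟩ | ⟨h1, h2, l1, l2⟩ | ⟨h1, h2, l1, l2⟩ |
      ⟨h1, h2, l1, l2⟩ | ⟨h1, h2, l1, l2⟩)
    · refine exists_sides_triangle_pos hc hper hX 0 h1 h2 ?_ ?_ ?_ (fun x hx => ?_) fun x hx => ?_
        <;> norm_num [f0, f1, f2]
      · linarith
      · linarith
      · linarith
      · linarith [m hs' (l1 x hx)]
      · linarith [m hs (l2 x hx)]
    · refine exists_sides_triangle_neg hc hper hX 0 h1 h2 ?_ ?_ ?_ (fun x hx => ?_) fun x hx => ?_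
        <;> norm_num [f0, f1, f2]
      · linarith
      · linarith
      · linarith
      · linarith [m hs (l1 x hx)]
      · linarith [m hs' (l2 x hx)]
    · have h := exists_sides_triangle_pos hc hper hX 1
      simp only [Nat.reduceAdd, f1, f2, f3, x3] at h
      exact h h1 h2 (by linarith) (by linarith) (by linarith)
        (fun x hx => by linarith [m hs (l1 x hx)]) fun x hx => by linarith [m hss (l2 x hx)]
    · have h := exists_sides_triangle_neg hc hper hX 1
      simp only [Nat.reduceAdd, f1, f2, f3, x3] at h
      exact h h1 h2 (by linarith) (by linarith) (by linarith)
        (fun x hx => by linarith [m hss (l1 x hx)]) fun x hx => by linarith [m hs (l2 x hx)]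
    · have h := exists_sides_triangle_pos hc hper hX 2
      simp only [Nat.reduceAdd, f2, f3, f4, x3, x4] at h
      exact h h1 h2 (by linarith) (by linarith) (by linarith)
        (fun x hx => by linarith [m hss (l1 x hx)]) fun x hx => by linarith [m hs' (l2 x hx)]
    · have h := exists_sides_triangle_neg hc hper hX 2
      simp only [Nat.reduceAdd, f2, f3, f4, x3, x4] at h
      exact h h1 h2 (by linarith) (by linarith) (by linarith)
        (fun x hx => by linarith [m hs' (l1 x hx)]) fun x hx => by linarith [m hss (l2 x hx)]

namespace Polygon

variable {y x₁ x₂ : Torus}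

theorem triangle_constant_or (hs : 0 < s) (hs' : 0 < s')
    (u : Polygon ![s + s', s, 0] ![y, x₁, x₂]) :
    (u.cornerX 0 = u.cornerX 2 ∧ u.cornerX 1 = u.cornerX 2 ∧
      ∃ c : ℂ, ∀ ζ ∈ closedBall (0 : ℂ) 1, u.lift ζ = c) ∨
    ∃ n : Fin 3 → ℤ, Sides 3 (sideFun ![s + s', s, 0] n) u.cornerX u.lift ∧
      (s + s') * cs (u.cornerX 0) = n 0 - n 2 ∧ s' * cs (u.cornerX 1) = n 0 - n 1 ∧
      s * cs (u.cornerX 2) = n 1 - n 2 ∧ TriangleCorners (cs (u.cornerX 2)) (cs (u.cornerX 1))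
        (cs (u.cornerX 0)) (u.cornerX 0) (u.cornerX 1) (u.cornerX 2) := by
  rcases u.constant_or_immersed with ⟨c, hc⟩ | h
  · left
    simp only [cornerX, hc _ (corner_mem _ _), true_and]
    exact ⟨c, hc⟩
  · right
    obtain ⟨n, hn⟩ := u.exists_sides h
    obtain ⟨f0, -, f2⟩ := sideFun_three n s s' (u.cornerX 0)
    obtain ⟨g0, g1, -⟩ := sideFun_three n s s' (u.cornerX 1)
    obtain ⟨-, k1, k2⟩ := sideFun_three n s s' (u.cornerX 2)
    have e1 := hn.agree three_pos 0
    have e2 := hn.agree three_pos 1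
    have e0 := hn.agree_triangle (sideFun_add _ n) u.cornerX_add_self 0
    rw [zero_add, g0, g1] at e1
    rw [show 1 + 1 = 2 from rfl, k1, k2] at e2
    rw [zero_add, f0, f2] at e0
    have e0' : (s + s') * cs (u.cornerX 0) = n 0 - n 2 := by linarith
    have e1' : s' * cs (u.cornerX 1) = n 0 - n 1 := by linarith
    have e2' : s * cs (u.cornerX 2) = n 1 - n 2 := by linarith
    exact ⟨n, hn, e0', e1', e2',
      (sides_triangle_iff u.cornerX_add_self hs hs' e0' e1' e2').1 ⟨_, hn⟩⟩

/-- The heights of the three graphs cancel when the relations at the corners are added. This is the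
source of the additivity of labels. -/
theorem triangle_cs (hs : 0 < s) (hs' : 0 < s') (u : Polygon ![s + s', s, 0] ![y, x₁, x₂]) :
    (s + s') * cs (u.cornerX 0) = s * cs (u.cornerX 2) + s' * cs (u.cornerX 1) := by
  rcases u.triangle_constant_or hs hs' with ⟨h0, h1, -⟩ | ⟨n, -, e0, e1, e2, -⟩
  · rw [h0, h1]
    ring
  · linarith

/-- Constant and immersed triangles cannot share corners, since consecutive corners of the latter
have distinct abscissae. For two immersed ones the cosines at the corners fix the differences of the
heights. -/
theorem triangle_equiv (hs : 0 < s) (hs' : 0 < s') {u v : Polygon ![s + s', s, 0] ![y, x₁, x₂]}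
    {M : ℤ} (h0 : v.cornerX 0 = u.cornerX 0 + M) (h1 : v.cornerX 1 = u.cornerX 1 + M)
    (h2 : v.cornerX 2 = u.cornerX 2 + M) : u ≈ v := by
  have hlt : ∀ {w : Polygon ![s + s', s, 0] ![y, x₁, x₂]} {n : Fin 3 → ℤ},
      Sides 3 (sideFun ![s + s', s, 0] n) w.cornerX w.lift → w.cornerX 0 ≠ w.cornerX 1 :=
    fun h => h.ne three_pos 0
  rcases u.triangle_constant_or hs hs' with ⟨a0, a1, c, hc⟩ | ⟨n, hn, e0, e1, e2, -⟩ <;>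
    rcases v.triangle_constant_or hs hs' with ⟨b0, b1, d, hd⟩ | ⟨m, hm, g0, g1, g2, -⟩
  · refine ⟨Homeomorph.refl _, fun _ _ => Iff.rfl, fun _ _ => Iff.rfl, fun ζ => ?_⟩
    have hu := u.map_corner 0
    have hv := v.map_corner 0
    rw [hc _ (corner_mem _ _)] at hu
    rw [hd _ (corner_mem _ _)] at hv
    change proj (v.lift ζ) = proj (u.lift ζ)
    rw [hc _ ζ.2, hu, hd _ ζ.2, hv]
  · exact absurd (by linarith) (hlt hm)
  · exact absurd (by linarith) (hlt hn)
  · rw [h0, cs_add_int] at g0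
    rw [h1, cs_add_int] at g1
    rw [h2, cs_add_int] at g2
    have q0 : n 0 - n 1 = m 0 - m 1 := by
      have : (n 0 : ℝ) - n 1 = m 0 - m 1 := by linarith
      exact_mod_cast this
    have q1 : n 1 - n 2 = m 1 - m 2 := by
      have : (n 1 : ℝ) - n 2 = m 1 - m 2 := by linarith
      exact_mod_cast this
    refine equiv_of_sides hn hm M (m 0 - n 0) ?_ ?_ fun G hG =>
      hn.triangle_unique hG (continuous_sideFun _ _) (sideFun_add _ n) u.cornerX_add_self
    · have hj : ∀ j, v.cornerX j = u.cornerX j + M ∧ v.cornerX (j + 1) = u.cornerX (j + 1) + M ∧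
          v.cornerX (j + 2) = u.cornerX (j + 2) + M := by
        intro j
        induction j with
        | zero => exact ⟨h0, h1, h2⟩
        | succ j ih =>
          refine ⟨ih.2.1, ih.2.2, ?_⟩
          rw [show j + 1 + 2 = j + 3 by ring, v.cornerX_add_self, u.cornerX_add_self, ih.1]
      exact fun j => (hj j).1
    · intro k
      fin_cases k
      · simp
      · simp
        omega
      · simp
        omega

end Polygon

theorem exists_triangle {y x₁ x₂ : Torus} (hs : 0 < s) (hs' : 0 < s') (hy : y ∈ Lag (s + s'))
    (h1 : x₁ ∈ Lag s) (h2 : x₂ ∈ Lag 0) {t₀ t₁ t₂ : ℝ} (e0 : (t₀ : UnitAddCircle) = y.1)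
    (e1 : (t₁ : UnitAddCircle) = x₁.1) (e2 : (t₂ : UnitAddCircle) = x₂.1) {i j : ℤ}
    (c0 : (s + s') * cs t₀ = (i + j : ℤ)) (c1 : s' * cs t₁ = j) (c2 : s * cs t₂ = i)
    (h : TriangleCorners (cs t₂) (cs t₁) (cs t₀) t₀ t₁ t₂) :
    ∃ u : Polygon ![s + s', s, 0] ![y, x₁, x₂],
      u.cornerX 0 = t₀ ∧ u.cornerX 1 = t₁ ∧ u.cornerX 2 = t₂ := by
  let X : ℕ → ℝ := fun j => ![t₀, t₁, t₂] (Fin.ofNat 3 j)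
  have hX : ∀ j, X (j + 3) = X j := fun j => congrArg ![t₀, t₁, t₂] (ofNat_add_self j)
  -- Up to a common vertical translation these heights are forced by the labels at the three
  -- corners.
  obtain ⟨F, hF⟩ := (sides_triangle_iff (n := ![i + j, i, 0]) hX hs hs'
    (show (s + s') * cs t₀ = ((i + j : ℤ) : ℝ) - ((0 : ℤ) : ℝ) by rw [c0]; simp)
    (show s' * cs t₁ = ((i + j : ℤ) : ℝ) - ((i : ℤ) : ℝ) by rw [c1]; push_cast; ring)
    (show s * cs t₂ = ((i : ℤ) : ℝ) - ((0 : ℤ) : ℝ) by rw [c2]; simp)).2 h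
  obtain ⟨u, -, hu⟩ := Polygon.exists_of_sides hF (x := ![y, x₁, x₂])
    (by
      intro k
      fin_cases k
      · exact hy
      · exact h1
      · exact h2)
    (by
      intro k
      fin_cases k
      · exact e0
      · exact e1
      · exact e2)
  exact ⟨u, hu 0, hu 1, hu 2⟩

end Triangle

/-! ### Signed counts of the triangles with given corners -/

section TriangleSums

theorem coe_neg_ang (s : ℝ) (i : ℤ) :
    ((-ang s i : ℝ) : UnitAddCircle) = ((1 - ang s i : ℝ) : UnitAddCircle) :=
  coe_eq_coe_iff.2 ⟨-1, by push_cast; ring⟩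

/-- The cosine at the output is the mean of those at the inputs with weights `s` and `s'`, and the
cosine decreases on the half period containing all three angles. -/
theorem ang_between {s s' : ℝ} {i j : ℤ} (hi : |(i : ℝ)| < s) (hj : |(j : ℝ)| < s')
    (hij : |((i + j : ℤ) : ℝ)| < s + s') :
    (ang s i < ang s' j → ang s i < ang (s + s') (i + j) ∧ ang (s + s') (i + j) < ang s' j) ∧
    (ang s' j < ang s i → ang s' j < ang (s + s') (i + j) ∧ ang (s + s') (i + j) < ang s i) ∧
    (ang s i = ang s' j → ang (s + s') (i + j) = ang s i) := by
  have hs : 0 < s := (abs_nonneg _).trans_lt hi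
  have hs' : 0 < s' := (abs_nonneg _).trans_lt hj
  have e0 := mul_cs_ang hij.le
  rw [Int.cast_add, ← mul_cs_ang hi.le, ← mul_cs_ang hj.le] at e0
  have ha := ang_mem hi
  have hb := ang_mem hj
  have hc := ang_mem hij
  rw [← cs_lt_iff ha hb, ← cs_lt_iff ha hc, ← cs_lt_iff hc hb, ← cs_lt_iff hb ha,
    ← cs_lt_iff hb hc, ← cs_lt_iff hc ha]
  refine ⟨fun h => ⟨?_, ?_⟩, fun h => ⟨?_, ?_⟩, fun h => ?_⟩
  · nlinarith
  · nlinarith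
  · nlinarith
  · nlinarith
  · have : cs (ang (s + s') (i + j)) = cs (ang s i) := by
      rw [← h, ← add_mul] at e0
      exact mul_left_cancel₀ (add_pos hs hs').ne' e0
    refine le_antisymm ?_ ?_ <;> refine not_lt.1 fun h => ?_
    · exact ((cs_lt_iff hc ha).2 h).ne this
    · exact ((cs_lt_iff ha hc).2 h).ne this.symm

namespace Polygon

/-- A constant polygon. -/
def const {N : ℕ} {a : Fin N → ℝ} {x : Fin N → Torus} (c : ℂ) (hx : ∀ k, proj c = x k)
    (ha : ∀ k, x k ∈ Lag (a k)) : Polygon a x where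
  lift _ := c
  continuousOn_lift := continuousOn_const
  map_corner := hx
  map_side k _ _ := by
    rw [hx k]
    exact ha k
  constant_or_immersed := .inl ⟨c, fun _ _ => rfl⟩

theorem numStars_triangle {s s' : ℝ} {y x₁ x₂ : Torus} {u : Polygon ![s + s', s, 0] ![y, x₁, x₂]}
    {n : Fin 3 → ℤ} (hu : Sides 3 (sideFun ![s + s', s, 0] n) u.cornerX u.lift) :
    u.numStars = starCount (s + s') (u.cornerX 0) (u.cornerX 1) +
      starCount s (u.cornerX 1) (u.cornerX 2) + starCount 0 (u.cornerX 2) (u.cornerX 0) := by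
  rw [numStars_eq hu, Fin.sum_univ_three]
  have : u.cornerX 3 = u.cornerX 0 := u.cornerX_add_self 0
  change _ + _ + starCount 0 (u.cornerX 2) (u.cornerX 3) = _
  rw [this]
  rfl

theorem numStars_of_constant {N : ℕ} {a : Fin N → ℝ} {x : Fin N → Torus} {u : Polygon a x} {c : ℂ}
    (hc : ∀ ζ ∈ closedBall (0 : ℂ) 1, u.lift ζ = c) (hx : ∀ k, (x k).1 ≠ (starPt (a k)).1) :
    u.numStars = 0 := by
  refine Finset.sum_eq_zero fun k _ => ?_
  have : {ζ : ℂ | ζ ∈ arc N k ∧ proj (u.lift ζ) = starPt (a k)} = ∅ := by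
    rw [Set.eq_empty_iff_forall_notMem]
    rintro _ ⟨⟨θ, -, rfl⟩, hζ⟩
    have hm : Complex.exp (2 * Real.pi * Complex.I * (θ : ℂ)) ∈ closedBall (0 : ℂ) 1 := by
      rw [mem_closedBall_zero_iff, show 2 * (Real.pi : ℂ) * Complex.I * (θ : ℂ) =
        ((2 * Real.pi * θ : ℝ) : ℂ) * Complex.I by push_cast; ring, Complex.norm_exp_ofReal_mul_I]
    rw [hc _ hm, ← hc _ (corner_mem N k), u.map_corner] at hζ
    exact hx k (congrArg Prod.fst hζ)
  rw [this, Set.ncard_empty]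

end Polygon

theorem finsum_triangles {s s' : ℝ} (hs : 0 < s) (hs' : 0 < s') {y x₁ x₂ : Torus} {t₀ t₁ t₂ : ℝ}
    (hne : ∃ u : Polygon ![s + s', s, 0] ![y, x₁, x₂],
      u.cornerX 0 = t₀ ∧ u.cornerX 1 = t₁ ∧ u.cornerX 2 = t₂)
    (hall : ∀ u : Polygon ![s + s', s, 0] ![y, x₁, x₂], ∃ M : ℤ,
      u.cornerX 0 = t₀ + M ∧ u.cornerX 1 = t₁ + M ∧ u.cornerX 2 = t₂ + M)
    {C : Type*} [AddCommMonoid C] {W : Polygon ![s + s', s, 0] ![y, x₁, x₂] → C} {w : C}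
    (hW : ∀ (u : Polygon ![s + s', s, 0] ![y, x₁, x₂]) (M : ℤ),
      u.cornerX 0 = t₀ + M → u.cornerX 1 = t₁ + M → u.cornerX 2 = t₂ + M → W u = w) :
    ∑ᶠ q : Moduli ![s + s', s, 0] ![y, x₁, x₂], W q.out = w := by
  obtain ⟨u, h0, h1, h2⟩ := hne
  have key : ∀ v, u ≈ v := fun v => by
    obtain ⟨M, g0, g1, g2⟩ := hall v
    rw [← h0] at g0
    rw [← h1] at g1
    rw [← h2] at g2
    exact Polygon.triangle_equiv hs hs' g0 g1 g2
  refine finsum_moduli_eq ⟨u⟩ (fun v v' => Setoid.trans (Setoid.symm (key v)) (key v'))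
    fun v => ?_
  obtain ⟨M, g0, g1, g2⟩ := hall v
  exact hW v M g0 g1 g2

variable {s s' : ℝ} {i j : ℤ} (hi : |(i : ℝ)| < s) (hj : |(j : ℝ)| < s')
  (hij : |((i + j : ℤ) : ℝ)| < s + s') {C : Type*} [CommRing C] (σ : C ≃+* C) (a b : C)

/-- All corners lie in one translate of `(0, 1/2)`, so there are neither stars nor crossings of `x =
0`. When the two input angles agree, so does the output angle, and the triangle is constant. -/
theorem finsum_triangles_zz :
    ∑ᶠ u : Moduli ![s + s', s, 0] ![(zPt (s + s') (i + j) hij.le).1,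
      (shift s s' (zPt s' j hj.le)).1, (zPt s i hi.le).1],
      triangleSign u.out • u.out.nabla σ 2 (a * u.out.nabla σ 1 (b * u.out.nabla σ 0 1)) =
    a * b := by
  have hs : 0 < s := (abs_nonneg _).trans_lt hi
  have hs' : 0 < s' := (abs_nonneg _).trans_lt hj
  have ha := ang_mem hi
  have hb := ang_mem hj
  have hc := ang_mem hij
  obtain ⟨o1, o2, o3⟩ := ang_between hi hj hij
  have star0 := starPt_zero_fst
  have star1 := starPt_fst hs.ne'
  have star2 := starPt_fst (add_pos hs hs').ne'
  have d0 : mas (s + s') 0 (zPt (s + s') (i + j) hij.le).1 = 0 :=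
    mas_eq_zero (add_pos hs hs') (sinT_ang hij)
  have d1 : mas (s + s') s (shift s s' (zPt s' j hj.le)).1 = 0 :=
    mas_eq_zero (by linarith) (sinT_ang hj)
  have d2 : mas s 0 (zPt s i hi.le).1 = 0 := mas_eq_zero hs (sinT_ang hi)
  refine finsum_triangles hs hs' (t₀ := ang (s + s') (i + j)) (t₁ := ang s' j) (t₂ := ang s i)
    ?_ (fun u => ?_) (W := fun u => triangleSign u • u.nabla σ 2
      (a * u.nabla σ 1 (b * u.nabla σ 0 1))) fun u M u0 u1 u2 => ?_
  · rcases lt_trichotomy (ang s i) (ang s' j) with h | h | h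
    · exact exists_triangle hs hs' (zPt (s + s') (i + j) hij.le).2.1
        (shift s s' (zPt s' j hj.le)).2.2 (zPt s i hi.le).2.2 rfl rfl rfl (mul_cs_ang hij.le)
        (mul_cs_ang hj.le) (mul_cs_ang hi.le)
        (triangleCorners_zz_of_lt ha hb hc (o1 h).1 (o1 h).2)
    · have h' := o3 h
      -- The flow lowers this point by `s * cs (ang s i) = i`, an integer, so it does not move on
      -- the torus.
      have e1 : (shift s s' (zPt s' j hj.le)).1 = (zPt s i hi.le).1 := by
        refine Prod.ext (congrArg ((↑) : ℝ → UnitAddCircle) h.symm) ?_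
        change (0 : UnitAddCircle) - ((s * cosT (ang s' j : UnitAddCircle) : ℝ) : UnitAddCircle) = 0
        rw [cosT_coe', ← h, mul_cs_ang hi.le, zero_sub, neg_eq_zero]
        exact (AddCircle.coe_eq_zero_iff 1).2 ⟨i, by simp⟩
      have e0 : (zPt (s + s') (i + j) hij.le).1 = (zPt s i hi.le).1 :=
        Prod.ext (congrArg ((↑) : ℝ → UnitAddCircle) h') rfl
      have e2 : proj (ang s i : ℂ) = (zPt s i hi.le).1 := by
        refine Prod.ext ?_ ?_
        · simp [proj, zPt_fst]
        · rw [snd_eq_zero]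
          simp [proj]
      refine ⟨Polygon.const (ang s i : ℂ) (fun k => ?_) fun k => ?_, ?_, ?_, ?_⟩
      · fin_cases k
        · exact e2.trans e0.symm
        · exact e2.trans e1.symm
        · exact e2
      · fin_cases k
        · exact (zPt (s + s') (i + j) hij.le).2.1
        · exact (shift s s' (zPt s' j hj.le)).2.2
        · exact (zPt s i hi.le).2.2
      · exact h'.symm
      · exact h
      · rfl
    · exact exists_triangle hs hs' (zPt (s + s') (i + j) hij.le).2.1
        (shift s s' (zPt s' j hj.le)).2.2 (zPt s i hi.le).2.2 rfl rfl rfl (mul_cs_ang hij.le)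
        (mul_cs_ang hj.le) (mul_cs_ang hi.le)
        (triangleCorners_zz_of_gt ha hb hc (o2 h).1 (o2 h).2)
  · obtain ⟨m₀, h0⟩ := coe_eq_coe_iff.1 (u.coe_cornerX 0)
    obtain ⟨m₁, h1⟩ := coe_eq_coe_iff.1 (u.coe_cornerX 1)
    obtain ⟨m₂, h2⟩ := coe_eq_coe_iff.1 (u.coe_cornerX 2)
    change u.cornerX 0 = ang (s + s') (i + j) + m₀ at h0
    change u.cornerX 1 = ang s' j + m₁ at h1
    change u.cornerX 2 = ang s i + m₂ at h2
    rcases u.triangle_constant_or hs hs' with ⟨k0, k1, -⟩ | ⟨n, -, -, -, -, h⟩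
    · have r0 : m₀ = m₂ := int_eq_of_lt_of_lt (by linarith [ha.1, ha.2, hc.1, hc.2])
        (by linarith [ha.1, ha.2, hc.1, hc.2])
      have r1 : m₁ = m₂ := int_eq_of_lt_of_lt (by linarith [ha.1, ha.2, hb.1, hb.2])
        (by linarith [ha.1, ha.2, hb.1, hb.2])
      exact ⟨m₂, r0 ▸ h0, r1 ▸ h1, h2⟩
    · rw [h0, h1, h2, cs_add_int, cs_add_int, cs_add_int] at h
      obtain ⟨r1, r2, -⟩ := triangleCorners_zz ha hb hc h
      exact ⟨m₀, h0, r1 ▸ h1, r2 ▸ h2⟩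
  · have hst : u.numStars = 0 := by
      rcases u.triangle_constant_or hs hs' with ⟨-, -, c, hc'⟩ | ⟨n, hn, -⟩
      · have hne : ∀ {x : ℝ}, x ∈ Ioo (0 : ℝ) (1 / 2) → (x : UnitAddCircle) ≠ ((0 : ℝ)
            : UnitAddCircle) ∧ (x : UnitAddCircle) ≠ ((1 / 2 : ℝ) : UnitAddCircle) := by
          intro x hx
          constructor <;> intro h <;> obtain ⟨m, hm⟩ := coe_eq_coe_iff.1 h
          · have h1 : (0 : ℝ) < m := by linarith [hx.1]
            have h2 : (m : ℝ) < 1 := by linarith [hx.2]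
            norm_cast at h1 h2
            omega
          · have h1 : (-1 : ℝ) < m := by linarith [hx.1]
            have h2 : (m : ℝ) < 0 := by linarith [hx.2]
            norm_cast at h1 h2
            omega
        refine Polygon.numStars_of_constant hc' fun k => ?_
        fin_cases k
        · exact star2 ▸ (hne hc).2
        · exact star1 ▸ (hne hb).2
        · exact star0 ▸ (hne ha).1
      · rw [Polygon.numStars_triangle hn, u0, u1, u2,
          starCount_eq_zero star2 (M - 1) (by push_cast; constructor <;> linarith [hc.1, hc.2])
            (by push_cast; constructor <;> linarith [hb.1, hb.2]),
          starCount_eq_zero star1 (M - 1) (by push_cast; constructor <;> linarith [hb.1, hb.2])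
            (by push_cast; constructor <;> linarith [ha.1, ha.2]),
          starCount_eq_zero star0 M (by constructor <;> linarith [ha.1, ha.2])
            (by constructor <;> linarith [hc.1, hc.2])]
    have hsign : triangleSign u = 1 := by
      rw [triangleSign, hst, d0, d1, d2]
      simp
    have x3 : u.cornerX 3 = u.cornerX 0 := u.cornerX_add_self 0
    simp only [hsign, Polygon.nabla, zero_add, Nat.reduceAdd, x3, u0, u1, u2, floor_ang hi,
      floor_ang hj, floor_ang hij, map_one, mul_one, one_smul, sub_self, zpow_zero,
      RingAut.one_apply]

theorem not_constant_of_sinT {s s' : ℝ} (hs : 0 < s) (hs' : 0 < s') {y x₁ x₂ : Torus}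
    (h : sinT x₁.1 ≠ sinT x₂.1) (u : Polygon ![s + s', s, 0] ![y, x₁, x₂]) :
    ∃ n : Fin 3 → ℤ, Sides 3 (sideFun ![s + s', s, 0] n) u.cornerX u.lift ∧
      TriangleCorners (cs (u.cornerX 2)) (cs (u.cornerX 1)) (cs (u.cornerX 0)) (u.cornerX 0)
        (u.cornerX 1) (u.cornerX 2) := by
  rcases u.triangle_constant_or hs hs' with ⟨-, h1, -⟩ | ⟨n, hn, -, -, -, hT⟩
  · have e1 := u.coe_cornerX 1
    have e2 := u.coe_cornerX 2
    simp only [Fin.val_one, Fin.val_two, h1] at e1 e2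
    have : x₁.1 = x₂.1 := e1.symm.trans e2
    exact absurd (congrArg sinT this) h
  · exact ⟨n, hn, hT⟩

/-- The triangle lies around `1/2` and crosses no integer. Its side `1` runs backward from an input
of degree `1` through a star, and the two signs cancel. -/
theorem finsum_triangles_zx_of_lt (h : ang s i < ang s' j) :
    ∑ᶠ u : Moduli ![s + s', s, 0] ![(xiPt (s + s') (i + j) hij.le).1,
      (shift s s' (xiPt s' j hj.le)).1, (zPt s i hi.le).1],
      triangleSign u.out • u.out.nabla σ 2 (a * u.out.nabla σ 1 (b * u.out.nabla σ 0 1)) =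
    a * b := by
  have hs : 0 < s := (abs_nonneg _).trans_lt hi
  have hs' : 0 < s' := (abs_nonneg _).trans_lt hj
  have ha := ang_mem hi
  have hb := ang_mem hj
  have hc := ang_mem hij
  obtain ⟨a1, a2⟩ := ha
  obtain ⟨b1, b2⟩ := hb
  obtain ⟨c1, c2⟩ := hc
  obtain ⟨l1, l2⟩ := (ang_between hi hj hij).1 h
  have star0 := starPt_zero_fst
  have star1 := starPt_fst hs.ne'
  have star2 := starPt_fst (add_pos hs hs').ne'
  have d1 : mas (s + s') s (shift s s' (xiPt s' j hj.le)).1 = 1 :=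
    mas_eq_one (by linarith) (sinT_one_sub_ang hj)
  have hT := not_constant_of_sinT hs hs' (y := (xiPt (s + s') (i + j) hij.le).1)
    (x₁ := (shift s s' (xiPt s' j hj.le)).1) (x₂ := (zPt s i hi.le).1)
    ((sinT_one_sub_ang hj).trans (sinT_ang hi)).ne
  refine finsum_triangles hs hs' (t₀ := 1 - ang (s + s') (i + j)) (t₁ := 1 - ang s' j)
    (t₂ := ang s i) ?_ (fun u => ?_) (W := fun u => triangleSign u • u.nabla σ 2
      (a * u.nabla σ 1 (b * u.nabla σ 0 1))) fun u M u0 u1 u2 => ?_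
  · have e0 := cs_one_sub_add_int (ang (s + s') (i + j)) 0
    have e1 := cs_one_sub_add_int (ang s' j) 0
    rw [Int.cast_zero, add_zero] at e0 e1
    refine exists_triangle hs hs' (xiPt (s + s') (i + j) hij.le).2.1
      (shift s s' (xiPt s' j hj.le)).2.2 (zPt s i hi.le).2.2 rfl rfl rfl
      (by rw [e0, mul_cs_ang hij.le]) (by rw [e1, mul_cs_ang hj.le]) (mul_cs_ang hi.le) ?_
    rw [e0, e1]
    exact triangleCorners_zx_of_lt ⟨a1, a2⟩ ⟨b1, b2⟩ ⟨c1, c2⟩ l1 l2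
  · obtain ⟨m₀, h0⟩ := coe_eq_coe_iff.1 (u.coe_cornerX 0)
    obtain ⟨m₁, h1⟩ := coe_eq_coe_iff.1 (u.coe_cornerX 1)
    obtain ⟨m₂, h2⟩ := coe_eq_coe_iff.1 (u.coe_cornerX 2)
    change u.cornerX 0 = 1 - ang (s + s') (i + j) + m₀ at h0
    change u.cornerX 1 = 1 - ang s' j + m₁ at h1
    change u.cornerX 2 = ang s i + m₂ at h2
    obtain ⟨n, -, hT⟩ := hT u
    rw [h0, h1, h2, cs_one_sub_add_int, cs_one_sub_add_int, cs_add_int,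
      show 1 - ang (s + s') (i + j) + m₀ = -ang (s + s') (i + j) + ((m₀ + 1 : ℤ) : ℝ) by
        push_cast; ring,
      show 1 - ang s' j + m₁ = -ang s' j + ((m₁ + 1 : ℤ) : ℝ) by push_cast; ring] at hT
    obtain ⟨-, r1, r2⟩ | ⟨h', -⟩ := triangleCorners_zx ⟨a1, a2⟩ ⟨b1, b2⟩ ⟨c1, c2⟩ hT
    · obtain rfl : m₁ = m₀ := by omega
      obtain rfl : m₁ = m₂ := by omega
      exact ⟨m₁, h0, h1, h2⟩
    · exact absurd h h'.not_gt
  · obtain ⟨n, hn, -⟩ := hT u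
    have x3 : u.cornerX 3 = u.cornerX 0 := u.cornerX_add_self 0
    have hst : u.numStars = 1 := by
      rw [Polygon.numStars_triangle hn, u0, u1, u2,
        starCount_eq_zero star2 M (by constructor <;> linarith) (by constructor <;> linarith),
        starCount_eq_one star1 M (by
          rw [uIcc_of_ge (by linarith)]
          constructor <;> linarith) (by constructor <;> linarith) (by constructor <;> linarith),
        starCount_eq_zero star0 M (by constructor <;> linarith) (by constructor <;> linarith)]
    have hb1 : u.Backward 1 := by
      rw [Polygon.Backward, show 1 + 1 = 2 from rfl, u1, u2]
      linarith
    have hb2 : ¬ u.Backward 2 := by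
      rw [Polygon.Backward, show 2 + 1 = 3 from rfl, x3, u0, u2]
      linarith
    have hsign : triangleSign u = 1 := by
      rw [triangleSign, hst, if_pos hb1, if_neg hb2, d1]
      norm_num
    simp only [hsign, Polygon.nabla, zero_add, Nat.reduceAdd, x3, u0, u1, u2, floor_ang hi,
      floor_one_sub_ang hj, floor_one_sub_ang hij, map_one, mul_one, one_smul, sub_self, zpow_zero,
      RingAut.one_apply]

/-- The triangle lies around `0`. Side `1` crosses to the right and side `2` back to the left, so
`b` receives `σ` after its inverse and `a` receives `σ`. The star of `L` on side `2` cancels the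
sign of that backward side. -/
theorem finsum_triangles_zx_of_gt (h : ang s' j < ang s i) :
    ∑ᶠ u : Moduli ![s + s', s, 0] ![(xiPt (s + s') (i + j) hij.le).1,
      (shift s s' (xiPt s' j hj.le)).1, (zPt s i hi.le).1],
      triangleSign u.out • u.out.nabla σ 2 (a * u.out.nabla σ 1 (b * u.out.nabla σ 0 1)) =
    σ a * b := by
  have hs : 0 < s := (abs_nonneg _).trans_lt hi
  have hs' : 0 < s' := (abs_nonneg _).trans_lt hj
  obtain ⟨a1, a2⟩ := ang_mem hi
  obtain ⟨b1, b2⟩ := ang_mem hj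
  obtain ⟨c1, c2⟩ := ang_mem hij
  obtain ⟨l1, l2⟩ := (ang_between hi hj hij).2.1 h
  have star0 := starPt_zero_fst
  have star1 := starPt_fst hs.ne'
  have star2 := starPt_fst (add_pos hs hs').ne'
  have d0 : mas (s + s') 0 (xiPt (s + s') (i + j) hij.le).1 = 1 :=
    mas_eq_one (add_pos hs hs') (sinT_one_sub_ang hij)
  have d2 : mas s 0 (zPt s i hi.le).1 = 0 := mas_eq_zero hs (sinT_ang hi)
  have hT := not_constant_of_sinT hs hs' (y := (xiPt (s + s') (i + j) hij.le).1)
    (x₁ := (shift s s' (xiPt s' j hj.le)).1) (x₂ := (zPt s i hi.le).1)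
    ((sinT_one_sub_ang hj).trans (sinT_ang hi)).ne
  refine finsum_triangles hs hs' (t₀ := -ang (s + s') (i + j)) (t₁ := -ang s' j)
    (t₂ := ang s i) ?_ (fun u => ?_) (W := fun u => triangleSign u • u.nabla σ 2
      (a * u.nabla σ 1 (b * u.nabla σ 0 1))) fun u M u0 u1 u2 => ?_
  · refine exists_triangle hs hs' (xiPt (s + s') (i + j) hij.le).2.1
      (shift s s' (xiPt s' j hj.le)).2.2 (zPt s i hi.le).2.2
      (coe_neg_ang _ _) (coe_neg_ang _ _) rfl
      (by rw [cs_neg, mul_cs_ang hij.le]) (by rw [cs_neg, mul_cs_ang hj.le]) (mul_cs_ang hi.le) ?_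
    rw [cs_neg, cs_neg]
    exact triangleCorners_zx_of_gt ⟨a1, a2⟩ ⟨b1, b2⟩ ⟨c1, c2⟩ l1 l2
  · obtain ⟨m₀, h0⟩ := coe_eq_coe_iff.1 (u.coe_cornerX 0)
    obtain ⟨m₁, h1⟩ := coe_eq_coe_iff.1 (u.coe_cornerX 1)
    obtain ⟨m₂, h2⟩ := coe_eq_coe_iff.1 (u.coe_cornerX 2)
    change u.cornerX 0 = 1 - ang (s + s') (i + j) + m₀ at h0
    change u.cornerX 1 = 1 - ang s' j + m₁ at h1
    change u.cornerX 2 = ang s i + m₂ at h2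
    obtain ⟨n, -, hT⟩ := hT u
    rw [show 1 - ang (s + s') (i + j) + m₀ = -ang (s + s') (i + j) + ((m₀ + 1 : ℤ) : ℝ) by
        push_cast; ring] at h0
    rw [show 1 - ang s' j + m₁ = -ang s' j + ((m₁ + 1 : ℤ) : ℝ) by push_cast; ring] at h1
    rw [h0, h1, h2, cs_neg_add_int, cs_neg_add_int, cs_add_int] at hT
    obtain ⟨h', -⟩ | ⟨-, r1, r2⟩ := triangleCorners_zx ⟨a1, a2⟩ ⟨b1, b2⟩ ⟨c1, c2⟩ hT
    · exact absurd h h'.not_gt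
    · exact ⟨m₂, r2 ▸ h0, r2 ▸ r1 ▸ h1, h2⟩
  · obtain ⟨n, hn, -⟩ := hT u
    have x3 : u.cornerX 3 = u.cornerX 0 := u.cornerX_add_self 0
    have hst : u.numStars = 1 := by
      rw [Polygon.numStars_triangle hn, u0, u1, u2,
        starCount_eq_zero star2 (M - 1) (by push_cast; constructor <;> linarith)
          (by push_cast; constructor <;> linarith),
        starCount_eq_zero star1 (M - 1) (by push_cast; constructor <;> linarith)
          (by push_cast; constructor <;> linarith),
        starCount_eq_one star0 M (by
          rw [uIcc_of_ge (by linarith)]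
          constructor <;> linarith) (by constructor <;> linarith) (by constructor <;> linarith)]
    have hb1 : ¬ u.Backward 1 := by
      rw [Polygon.Backward, show 1 + 1 = 2 from rfl, u1, u2]
      linarith
    have hb2 : u.Backward 2 := by
      rw [Polygon.Backward, show 2 + 1 = 3 from rfl, x3, u0, u2]
      linarith
    have hsign : triangleSign u = 1 := by
      rw [triangleSign, hst, if_neg hb1, if_pos hb2, d0, d2]
      norm_num
    simp only [hsign, Polygon.nabla, zero_add, Nat.reduceAdd, x3, u0, u1, u2, floor_ang hi,
      floor_neg_ang hj, floor_neg_ang hij, map_one, mul_one, one_smul, sub_self, zpow_zero,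
      sub_sub_cancel, zpow_one, sub_sub_cancel_left, map_mul]
    rw [zpow_neg_one, ← RingAut.mul_apply, mul_inv_cancel, RingAut.one_apply]

/-- The triangle lies around `0`, but side `2` stays on one side of it. Only side `1` transports
`b`, by `σ`; the crossing on side `0` acts on `1`. There is no star, and the degrees at the backward
sides are even. -/
theorem finsum_triangles_xz_of_lt (h : ang s i < ang s' j) :
    ∑ᶠ u : Moduli ![s + s', s, 0] ![(xiPt (s + s') (i + j) hij.le).1,
      (shift s s' (zPt s' j hj.le)).1, (xiPt s i hi.le).1],
      triangleSign u.out • u.out.nabla σ 2 (a * u.out.nabla σ 1 (b * u.out.nabla σ 0 1)) =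
    a * σ b := by
  have hs : 0 < s := (abs_nonneg _).trans_lt hi
  have hs' : 0 < s' := (abs_nonneg _).trans_lt hj
  obtain ⟨a1, a2⟩ := ang_mem hi
  obtain ⟨b1, b2⟩ := ang_mem hj
  obtain ⟨c1, c2⟩ := ang_mem hij
  obtain ⟨l1, l2⟩ := (ang_between hi hj hij).1 h
  have star0 := starPt_zero_fst
  have star1 := starPt_fst hs.ne'
  have star2 := starPt_fst (add_pos hs hs').ne'
  have d0 : mas (s + s') 0 (xiPt (s + s') (i + j) hij.le).1 = 1 :=
    mas_eq_one (add_pos hs hs') (sinT_one_sub_ang hij)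
  have d1 : mas (s + s') s (shift s s' (zPt s' j hj.le)).1 = 0 :=
    mas_eq_zero (by linarith) (sinT_ang hj)
  have d2 : mas s 0 (xiPt s i hi.le).1 = 1 := mas_eq_one hs (sinT_one_sub_ang hi)
  have hT := not_constant_of_sinT hs hs' (y := (xiPt (s + s') (i + j) hij.le).1)
    (x₁ := (shift s s' (zPt s' j hj.le)).1) (x₂ := (xiPt s i hi.le).1)
    ((sinT_one_sub_ang hi).trans (sinT_ang hj)).ne'
  refine finsum_triangles hs hs' (t₀ := -ang (s + s') (i + j)) (t₁ := ang s' j)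
    (t₂ := -ang s i) ?_ (fun u => ?_) (W := fun u => triangleSign u • u.nabla σ 2
      (a * u.nabla σ 1 (b * u.nabla σ 0 1))) fun u M u0 u1 u2 => ?_
  · refine exists_triangle hs hs' (xiPt (s + s') (i + j) hij.le).2.1
      (shift s s' (zPt s' j hj.le)).2.2 (xiPt s i hi.le).2.2
      (coe_neg_ang _ _) rfl (coe_neg_ang _ _)
      (by rw [cs_neg, mul_cs_ang hij.le]) (mul_cs_ang hj.le) (by rw [cs_neg, mul_cs_ang hi.le]) ?_
    rw [cs_neg, cs_neg]
    exact triangleCorners_xz_of_lt ⟨a1, a2⟩ ⟨b1, b2⟩ ⟨c1, c2⟩ l1 l2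
  · obtain ⟨m₀, h0⟩ := coe_eq_coe_iff.1 (u.coe_cornerX 0)
    obtain ⟨m₁, h1⟩ := coe_eq_coe_iff.1 (u.coe_cornerX 1)
    obtain ⟨m₂, h2⟩ := coe_eq_coe_iff.1 (u.coe_cornerX 2)
    change u.cornerX 0 = 1 - ang (s + s') (i + j) + m₀ at h0
    change u.cornerX 1 = ang s' j + m₁ at h1
    change u.cornerX 2 = 1 - ang s i + m₂ at h2
    obtain ⟨n, -, hT⟩ := hT u
    rw [show 1 - ang (s + s') (i + j) + m₀ = -ang (s + s') (i + j) + ((m₀ + 1 : ℤ) : ℝ) by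
        push_cast; ring] at h0
    rw [show 1 - ang s i + m₂ = -ang s i + ((m₂ + 1 : ℤ) : ℝ) by push_cast; ring] at h2
    rw [h0, h1, h2, cs_neg_add_int, cs_neg_add_int, cs_add_int] at hT
    obtain ⟨-, r1, r2⟩ | ⟨h', -⟩ := triangleCorners_xz ⟨a1, a2⟩ ⟨b1, b2⟩ ⟨c1, c2⟩ hT
    · exact ⟨m₁, r2 ▸ h0, h1, r2 ▸ r1 ▸ h2⟩
    · exact absurd h h'.not_gt
  · obtain ⟨n, hn, -⟩ := hT u
    have x3 : u.cornerX 3 = u.cornerX 0 := u.cornerX_add_self 0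
    have hst : u.numStars = 0 := by
      rw [Polygon.numStars_triangle hn, u0, u1, u2,
        starCount_eq_zero star2 (M - 1) (by push_cast; constructor <;> linarith)
          (by push_cast; constructor <;> linarith),
        starCount_eq_zero star1 (M - 1) (by push_cast; constructor <;> linarith)
          (by push_cast; constructor <;> linarith),
        starCount_eq_zero star0 (M - 1) (by push_cast; constructor <;> linarith)
          (by push_cast; constructor <;> linarith)]
    have hsign : triangleSign u = 1 := by
      rw [triangleSign, hst, d0, d1, d2]
      norm_num
    simp only [hsign, Polygon.nabla, zero_add, Nat.reduceAdd, x3, u0, u1, u2, floor_ang hj,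
      floor_neg_ang hi, floor_neg_ang hij, map_one, mul_one, one_smul, sub_self, zpow_zero,
      RingAut.one_apply, sub_sub_cancel, zpow_one]

/-- The triangle lies around `1/2`. Sides `0` and `1` carry one star each, and sides `1` and `2` run
forward. -/
theorem finsum_triangles_xz_of_gt (h : ang s' j < ang s i) :
    ∑ᶠ u : Moduli ![s + s', s, 0] ![(xiPt (s + s') (i + j) hij.le).1,
      (shift s s' (zPt s' j hj.le)).1, (xiPt s i hi.le).1],
      triangleSign u.out • u.out.nabla σ 2 (a * u.out.nabla σ 1 (b * u.out.nabla σ 0 1)) =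
    a * b := by
  have hs : 0 < s := (abs_nonneg _).trans_lt hi
  have hs' : 0 < s' := (abs_nonneg _).trans_lt hj
  obtain ⟨a1, a2⟩ := ang_mem hi
  obtain ⟨b1, b2⟩ := ang_mem hj
  obtain ⟨c1, c2⟩ := ang_mem hij
  obtain ⟨l1, l2⟩ := (ang_between hi hj hij).2.1 h
  have star0 := starPt_zero_fst
  have star1 := starPt_fst hs.ne'
  have star2 := starPt_fst (add_pos hs hs').ne'
  have hT := not_constant_of_sinT hs hs' (y := (xiPt (s + s') (i + j) hij.le).1)
    (x₁ := (shift s s' (zPt s' j hj.le)).1) (x₂ := (xiPt s i hi.le).1)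
    ((sinT_one_sub_ang hi).trans (sinT_ang hj)).ne'
  refine finsum_triangles hs hs' (t₀ := 1 - ang (s + s') (i + j)) (t₁ := ang s' j)
    (t₂ := 1 - ang s i) ?_ (fun u => ?_) (W := fun u => triangleSign u • u.nabla σ 2
      (a * u.nabla σ 1 (b * u.nabla σ 0 1))) fun u M u0 u1 u2 => ?_
  · have e0 := cs_one_sub_add_int (ang (s + s') (i + j)) 0
    have e1 := cs_one_sub_add_int (ang s i) 0
    rw [Int.cast_zero, add_zero] at e0 e1
    refine exists_triangle hs hs' (xiPt (s + s') (i + j) hij.le).2.1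
      (shift s s' (zPt s' j hj.le)).2.2 (xiPt s i hi.le).2.2 rfl rfl rfl
      (by rw [e0, mul_cs_ang hij.le]) (mul_cs_ang hj.le) (by rw [e1, mul_cs_ang hi.le]) ?_
    rw [e0, e1]
    exact triangleCorners_xz_of_gt ⟨a1, a2⟩ ⟨b1, b2⟩ ⟨c1, c2⟩ l1 l2
  · obtain ⟨m₀, h0⟩ := coe_eq_coe_iff.1 (u.coe_cornerX 0)
    obtain ⟨m₁, h1⟩ := coe_eq_coe_iff.1 (u.coe_cornerX 1)
    obtain ⟨m₂, h2⟩ := coe_eq_coe_iff.1 (u.coe_cornerX 2)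
    change u.cornerX 0 = 1 - ang (s + s') (i + j) + m₀ at h0
    change u.cornerX 1 = ang s' j + m₁ at h1
    change u.cornerX 2 = 1 - ang s i + m₂ at h2
    obtain ⟨n, -, hT⟩ := hT u
    rw [h0, h1, h2, cs_one_sub_add_int, cs_one_sub_add_int, cs_add_int,
      show 1 - ang (s + s') (i + j) + m₀ = -ang (s + s') (i + j) + ((m₀ + 1 : ℤ) : ℝ) by
        push_cast; ring,
      show 1 - ang s i + m₂ = -ang s i + ((m₂ + 1 : ℤ) : ℝ) by push_cast; ring] at hT
    obtain ⟨h', -⟩ | ⟨-, r1, r2⟩ := triangleCorners_xz ⟨a1, a2⟩ ⟨b1, b2⟩ ⟨c1, c2⟩ hT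
    · exact absurd h h'.not_gt
    · obtain rfl : m₂ = m₀ := by omega
      obtain rfl : m₂ = m₁ := by omega
      exact ⟨m₂, h0, h1, h2⟩
  · obtain ⟨n, hn, -⟩ := hT u
    have x3 : u.cornerX 3 = u.cornerX 0 := u.cornerX_add_self 0
    have hst : u.numStars = 2 := by
      rw [Polygon.numStars_triangle hn, u0, u1, u2,
        starCount_eq_one star2 M (by
          rw [uIcc_of_ge (by linarith)]
          constructor <;> linarith) (by constructor <;> linarith) (by constructor <;> linarith),
        starCount_eq_one star1 M (by
          rw [uIcc_of_le (by linarith)]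
          constructor <;> linarith) (by constructor <;> linarith) (by constructor <;> linarith),
        starCount_eq_zero star0 M (by constructor <;> linarith) (by constructor <;> linarith)]
    have hb1 : ¬ u.Backward 1 := by
      rw [Polygon.Backward, show 1 + 1 = 2 from rfl, u1, u2]
      linarith
    have hb2 : ¬ u.Backward 2 := by
      rw [Polygon.Backward, show 2 + 1 = 3 from rfl, x3, u0, u2]
      linarith
    have hsign : triangleSign u = 1 := by
      rw [triangleSign, hst, if_neg hb1, if_neg hb2]
      norm_num
    simp only [hsign, Polygon.nabla, zero_add, Nat.reduceAdd, x3, u0, u1, u2, floor_ang hj,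
      floor_one_sub_ang hi, floor_one_sub_ang hij, map_one, mul_one, one_smul, sub_self, zpow_zero,
      RingAut.one_apply]

end TriangleSums

/-! ### Differentials and products of the generators for fixed `s` -/

theorem LoudIdx.abs_lt {s : LoudIdx} {i : ℤ} (h : |(i : ℝ)| ≤ s.1) : |(i : ℝ)| < s.1 :=
  lt_of_le_of_ne h fun he => s.2.2 |i| (by rw [Int.cast_abs, he])

theorem abs_add_lt {s s' : ℝ} {i j : ℤ} (hi : |(i : ℝ)| < s) (hj : |(j : ℝ)| < s') :
    |((i + j : ℤ) : ℝ)| < s + s' := by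
  rw [Int.cast_add]
  exact (abs_add_le _ _).trans_lt (add_lt_add hi hj)

theorem pos_of_abs_lt {s : ℝ} {i : ℤ} (hi : |(i : ℝ)| < s) : 0 < s := (abs_nonneg _).trans_lt hi

section Points

variable {s : ℝ} {i : ℤ} (hi : |(i : ℝ)| < s)

theorem mas_zPt : mas s 0 (zPt s i hi.le).1 = 0 := mas_eq_zero (pos_of_abs_lt hi) (sinT_ang hi)

theorem mas_xiPt : mas s 0 (xiPt s i hi.le).1 = 1 :=
  mas_eq_one (pos_of_abs_lt hi) (sinT_one_sub_ang hi)

theorem mas_shift_zPt {t : ℝ} : mas (t + s) t (shift t s (zPt s i hi.le)).1 = 0 :=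
  mas_eq_zero (by linarith [pos_of_abs_lt hi]) (sinT_ang hi)

theorem mas_shift_xiPt {t : ℝ} : mas (t + s) t (shift t s (xiPt s i hi.le)).1 = 1 :=
  mas_eq_one (by linarith [pos_of_abs_lt hi]) (sinT_one_sub_ang hi)

theorem eq_zPt {p : InterPt s 0} (hp : mas s 0 p.1 = 0) (hl : label p = i) :
    p = zPt s i hi.le := by
  subst hl
  refine (eq_zPt_or_eq_xiPt (pos_of_abs_lt hi) p).resolve_right fun h => ?_
  rw [h] at hp
  exact zero_ne_one (hp.symm.trans (mas_xiPt hi))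

theorem eq_xiPt {p : InterPt s 0} (hp : mas s 0 p.1 = 1) (hl : label p = i) :
    p = xiPt s i hi.le := by
  subst hl
  refine (eq_zPt_or_eq_xiPt (pos_of_abs_lt hi) p).resolve_left fun h => ?_
  rw [h] at hp
  exact zero_ne_one ((mas_zPt hi).symm.trans hp)

end Points

theorem mas_le_one (a b : ℝ) (p : Torus) : mas a b p ≤ 1 := by
  rw [mas]
  split_ifs <;> simp

theorem label_eq_of_bigon {s : ℝ} {y x : InterPt s 0} (u : Polygon ![s, 0] ![y.1, x.1]) :
    label y = label x := by
  rcases u.bigon_constant_or with h | ⟨n, -, h0, h1⟩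
  · rw [Subtype.ext h]
  · have e0 : (u.cornerX 0 : UnitAddCircle) = y.1.1 := u.coe_cornerX 0
    have e1 : (u.cornerX 1 : UnitAddCircle) = x.1.1 := u.coe_cornerX 1
    have l0 := label_eq y
    have l1 := label_eq x
    rw [← e0, cosT_coe', h0] at l0
    rw [← e1, cosT_coe', h1] at l1
    exact_mod_cast l0.trans l1.symm

theorem label_eq_of_triangle {s s' : ℝ} (hs : 0 < s) (hs' : 0 < s') {y : InterPt (s + s') 0}
    {q : InterPt s' 0} {p : InterPt s 0}
    (u : Polygon ![s + s', s, 0] ![y.1, (shift s s' q).1, p.1]) :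
    label y = label p + label q := by
  have e0 : (u.cornerX 0 : UnitAddCircle) = y.1.1 := u.coe_cornerX 0
  have e1 : (u.cornerX 1 : UnitAddCircle) = q.1.1 := u.coe_cornerX 1
  have e2 : (u.cornerX 2 : UnitAddCircle) = p.1.1 := u.coe_cornerX 2
  have l0 := label_eq y
  have l1 := label_eq q
  have l2 := label_eq p
  rw [← e0, cosT_coe', u.triangle_cs hs hs'] at l0
  rw [← e1, cosT_coe'] at l1
  rw [← e2, cosT_coe'] at l2
  rw [← l1, ← l2] at l0
  exact_mod_cast l0

theorem finsum_subsingleton_index {ι M : Type*} [AddCommMonoid M] {P : ι → Prop} {f : ι → M}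
    {y : ι} {v : M} (hy : P y) (hv : f y = v) (h : ∀ x, P x → x ≠ y → f x = 0) :
    ∑ᶠ (x) (_ : P x), f x = v := by
  rw [finsum_eq_single _ y, finsum_prop hy, hv]
  intro x hx
  by_cases hP : P x
  · rw [finsum_prop hP, h x hP hx]
  · simp [hP]

variable {C : Type*} [CommRing C] (σ : C ≃+* C)

/-- A bigon preserves the label, and degree and label together name a point, so all other outputs
have empty moduli spaces. -/
theorem finsum_bigons_zPt {s : ℝ} {i : ℤ} (hi : |(i : ℝ)| < s) (c : C) :
    ∑ᶠ (y : InterPt s 0) (_ : mas s 0 y.1 = mas s 0 (zPt s i hi.le).1 + 1),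
      Finsupp.single y (∑ᶠ u : Moduli ![s, 0] ![y.1, (zPt s i hi.le).1],
        bigonSign u.out • u.out.nabla σ 1 (c * u.out.nabla σ 0 1)) =
    Finsupp.single (xiPt s i hi.le) (σ c - c) := by
  rw [mas_zPt hi, zero_add]
  refine finsum_subsingleton_index (mas_xiPt hi) ?_ fun y hy hne => ?_
  · rw [finsum_bigons σ hi, sub_eq_add_neg]
  · have : IsEmpty (Moduli ![s, 0] ![y.1, (zPt s i hi.le).1]) :=
      ⟨fun u => hne (eq_xiPt hi hy ((label_eq_of_bigon u.out).trans (label_zPt hi.le)))⟩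
    rw [finsum_of_isEmpty, Finsupp.single_zero]

theorem finsum_bigons_xiPt {s : ℝ} {i : ℤ} (hi : |(i : ℝ)| < s) (c : C) :
    ∑ᶠ (y : InterPt s 0) (_ : mas s 0 y.1 = mas s 0 (xiPt s i hi.le).1 + 1),
      Finsupp.single y (∑ᶠ u : Moduli ![s, 0] ![y.1, (xiPt s i hi.le).1],
        bigonSign u.out • u.out.nabla σ 1 (c * u.out.nabla σ 0 1)) = 0 := by
  rw [mas_xiPt hi]
  refine finsum_eq_zero_of_forall_eq_zero fun y => ?_
  have : ¬ mas s 0 y.1 = 1 + 1 := by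
    have := mas_le_one s 0 y.1
    omega
  simp [this]

section TriangleSum

variable {s s' : ℝ}

/-- Labels add up in triangles, so at most one output of the required degree has a nonempty moduli
space. -/
theorem triangleSum_eq_single (hs : 0 < s) (hs' : 0 < s') {p : InterPt s 0} {q : InterPt s' 0}
    {a b v : C} {y : InterPt (s + s') 0}
    (hy : mas (s + s') 0 y.1 = mas (s + s') s (shift s s' q).1 + mas s 0 p.1)
    (huniq : ∀ y', mas (s + s') 0 y'.1 = mas (s + s') s (shift s s' q).1 + mas s 0 p.1 →
      label y' = label p + label q → y' = y)
    (hv : ∑ᶠ u : Moduli ![s + s', s, 0] ![y.1, (shift s s' q).1, p.1],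
      triangleSign u.out • u.out.nabla σ 2 (a * u.out.nabla σ 1 (b * u.out.nabla σ 0 1)) = v) :
    triangleSum σ (s + s') s 0 p a (shift s s' q) b = Finsupp.single y v := by
  refine finsum_subsingleton_index hy (by rw [hv]) fun y' hy' hne => ?_
  have : IsEmpty (Moduli ![s + s', s, 0] ![y'.1, (shift s s' q).1, p.1]) :=
    ⟨fun u => hne (huniq y' hy' (label_eq_of_triangle hs hs' u.out))⟩
  rw [finsum_of_isEmpty, Finsupp.single_zero]

variable {i j : ℤ} (hi : |(i : ℝ)| < s) (hj : |(j : ℝ)| < s') (a b : C)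

theorem triangleSum_zz : triangleSum σ (s + s') s 0 (zPt s i hi.le) a
      (shift s s' (zPt s' j hj.le)) b =
    Finsupp.single (zPt (s + s') (i + j) (abs_add_lt hi hj).le) (a * b) := by
  refine triangleSum_eq_single σ (pos_of_abs_lt hi) (pos_of_abs_lt hj) ?_ (fun y hy hl => ?_)
    (finsum_triangles_zz hi hj (abs_add_lt hi hj) σ a b)
  · rw [mas_zPt hi, mas_shift_zPt hj, mas_zPt (abs_add_lt hi hj)]
  · rw [mas_zPt hi, mas_shift_zPt hj] at hy
    rw [label_zPt, label_zPt] at hl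
    exact eq_zPt (abs_add_lt hi hj) hy hl

theorem triangleSum_zx {v : C} (hv : ∑ᶠ u : Moduli ![s + s', s, 0]
      ![(xiPt (s + s') (i + j) (abs_add_lt hi hj).le).1, (shift s s' (xiPt s' j hj.le)).1,
        (zPt s i hi.le).1],
      triangleSign u.out • u.out.nabla σ 2 (a * u.out.nabla σ 1 (b * u.out.nabla σ 0 1)) = v) :
    triangleSum σ (s + s') s 0 (zPt s i hi.le) a (shift s s' (xiPt s' j hj.le)) b =
    Finsupp.single (xiPt (s + s') (i + j) (abs_add_lt hi hj).le) v := by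
  refine triangleSum_eq_single σ (pos_of_abs_lt hi) (pos_of_abs_lt hj) ?_ (fun y hy hl => ?_) hv
  · rw [mas_zPt hi, mas_shift_xiPt hj, mas_xiPt (abs_add_lt hi hj)]
  · rw [mas_zPt hi, mas_shift_xiPt hj] at hy
    rw [label_zPt, label_xiPt] at hl
    exact eq_xiPt (abs_add_lt hi hj) hy hl

theorem triangleSum_xz {v : C} (hv : ∑ᶠ u : Moduli ![s + s', s, 0]
      ![(xiPt (s + s') (i + j) (abs_add_lt hi hj).le).1, (shift s s' (zPt s' j hj.le)).1,
        (xiPt s i hi.le).1],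
      triangleSign u.out • u.out.nabla σ 2 (a * u.out.nabla σ 1 (b * u.out.nabla σ 0 1)) = v) :
    triangleSum σ (s + s') s 0 (xiPt s i hi.le) a (shift s s' (zPt s' j hj.le)) b =
    Finsupp.single (xiPt (s + s') (i + j) (abs_add_lt hi hj).le) v := by
  refine triangleSum_eq_single σ (pos_of_abs_lt hi) (pos_of_abs_lt hj) ?_ (fun y hy hl => ?_) hv
  · rw [mas_xiPt hi, mas_shift_zPt hj, mas_xiPt (abs_add_lt hi hj)]
  · rw [mas_xiPt hi, mas_shift_zPt hj] at hy
    rw [label_xiPt, label_zPt] at hl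
    exact eq_xiPt (abs_add_lt hi hj) hy hl

theorem triangleSum_xx : triangleSum σ (s + s') s 0 (xiPt s i hi.le) a
      (shift s s' (xiPt s' j hj.le)) b = 0 := by
  rw [triangleSum, mas_xiPt hi, mas_shift_xiPt hj]
  refine finsum_eq_zero_of_forall_eq_zero fun y => ?_
  have : ¬ mas (s + s') 0 y.1 = 1 + 1 := by
    have := mas_le_one (s + s') 0 y.1
    omega
  simp [this]

end TriangleSum

theorem ang_zero (s : ℝ) : ang s 0 = 1 / 4 := by
  have := Real.pi_pos
  rw [ang, Int.cast_zero, zero_div, Real.arccos_zero]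
  field_simp
  norm_num

theorem sinT_one_fourth : sinT ((1 / 4 : ℝ) : UnitAddCircle) = 1 := by
  rw [sinT_coe, show 2 * Real.pi * (1 / 4) = Real.pi / 2 by ring, Real.sin_pi_div_two]

theorem sinT_three_fourths : sinT ((3 / 4 : ℝ) : UnitAddCircle) = -1 := by
  rw [sinT_coe, show 2 * Real.pi * (3 / 4) = 2 * Real.pi - Real.pi / 2 by ring,
    Real.sin_two_pi_sub, Real.sin_pi_div_two]

theorem zPt_zero_fst {s : ℝ} (h : |((0 : ℤ) : ℝ)| ≤ s) :
    (zPt s 0 h).1.1 = ((1 / 4 : ℝ) : UnitAddCircle) := by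
  rw [zPt_fst, ang_zero]

theorem xiPt_zero_fst {s : ℝ} (h : |((0 : ℤ) : ℝ)| ≤ s) :
    (xiPt s 0 h).1.1 = ((3 / 4 : ℝ) : UnitAddCircle) := by
  rw [xiPt_fst, ang_zero]
  norm_num

theorem label_eq_zero_of_one_fourth {s : ℝ} {p : InterPt s 0}
    (h : p.1.1 = ((1 / 4 : ℝ) : UnitAddCircle)) : label p = 0 := by
  have := label_eq p
  rw [h, cosT_coe, show 2 * Real.pi * (1 / 4) = Real.pi / 2 by ring, Real.cos_pi_div_two,
    mul_zero] at this
  exact_mod_cast this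

theorem label_eq_zero_of_three_fourths {s : ℝ} {p : InterPt s 0}
    (h : p.1.1 = ((3 / 4 : ℝ) : UnitAddCircle)) : label p = 0 := by
  have := label_eq p
  rw [h, cosT_coe, show 2 * Real.pi * (3 / 4) = 2 * Real.pi - Real.pi / 2 by ring,
    Real.cos_two_pi_sub, Real.cos_pi_div_two, mul_zero] at this
  exact_mod_cast this

theorem zPt_fst_ne {s : ℝ} {i : ℤ} (hi : |(i : ℝ)| < s) :
    (zPt s i hi.le).1.1 ≠ ((3 / 4 : ℝ) : UnitAddCircle) := fun h => by
  have := sinT_ang hi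
  rw [← zPt_fst hi.le, h, sinT_three_fourths] at this
  linarith

theorem xiPt_fst_ne {s : ℝ} {i : ℤ} (hi : |(i : ℝ)| < s) :
    (xiPt s i hi.le).1.1 ≠ ((1 / 4 : ℝ) : UnitAddCircle) := fun h => by
  have := sinT_one_sub_ang hi
  rw [← xiPt_fst hi.le, h, sinT_one_fourth] at this
  linarith

section Slope

variable {e s s' : ℝ} {i j : ℤ}

/-- The cosine decreases, so the order of the angles is that of `j / s'` and `i / s`, and the common
factor `s` drops out: the product rule can pass to the limit because of this. -/
theorem ang_lt_ang_iff (he : 0 < e) (hs' : s' = e * s) (hi : |(i : ℝ)| < s)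
    (hj : |(j : ℝ)| < s') : ang s i < ang s' j ↔ (j : ℝ) / e < i := by
  have hs := pos_of_abs_lt hi
  rw [← cs_lt_iff (ang_mem hj) (ang_mem hi), div_lt_iff₀ he, ← mul_cs_ang hi.le,
    ← mul_cs_ang hj.le, hs', show s * cs (ang s i) * e = e * s * cs (ang s i) by ring,
    mul_lt_mul_iff_right₀ (mul_pos he hs)]

/-- Equal angles mean `e * i = j`. For irrational `e` only the pair of zero labels remains, which
covers the two degenerate cases fixed by convention. -/
theorem ang_eq_ang (he : Irrational e) (hs' : s' = e * s) (hi : |(i : ℝ)| < s)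
    (hj : |(j : ℝ)| < s') (h : ang s i = ang s' j) : i = 0 ∧ j = 0 := by
  have e1 := mul_cs_ang hi.le
  have e2 := mul_cs_ang hj.le
  rw [← h, hs', mul_assoc, e1] at e2
  have hi0 : i = 0 := by
    by_contra hne
    refine he ⟨(j : ℚ) / i, ?_⟩
    have : (i : ℝ) ≠ 0 := Int.cast_ne_zero.2 hne
    push_cast
    rw [← e2]
    field_simp
  rw [hi0, Int.cast_zero, mul_zero] at e2
  exact ⟨hi0, by exact_mod_cast e2.symm⟩

end Slope

section ProdBasis

variable {s s' : LoudIdx} {i j : ℤ} (hi : |(i : ℝ)| < s.1) (hj : |(j : ℝ)| < s'.1) (a b : C)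

theorem prodBasis_zz : prodBasis σ s s' (zPt s.1 i hi.le) a (zPt s'.1 j hj.le) b =
    Finsupp.single (zPt (s.1 + s'.1) (i + j) (abs_add_lt hi hj).le) (a * b) := by
  rw [prodBasis, if_neg fun h => zPt_fst_ne hi h.1, if_neg fun h => zPt_fst_ne hj h.2,
    triangleSum_zz σ hi hj]

theorem prodBasis_xx : prodBasis σ s s' (xiPt s.1 i hi.le) a (xiPt s'.1 j hj.le) b = 0 := by
  rw [prodBasis, if_neg fun h => xiPt_fst_ne hj h.2, if_neg fun h => xiPt_fst_ne hi h.1,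
    triangleSum_xx σ hi hj]

/-- The conventional value at `i = j = 0` belongs to the second branch, because `0 / e < 0` fails;
elsewhere the angles differ and the count of triangles applies. -/
theorem prodBasis_zx {e : ℝ} (he : 0 < e) (hirr : Irrational e) (hs' : s'.1 = e * s.1) :
    prodBasis σ s s' (zPt s.1 i hi.le) a (xiPt s'.1 j hj.le) b =
    Finsupp.single (xiPt (s.1 + s'.1) (i + j) (abs_add_lt hi hj).le)
      (if (j : ℝ) / e < i then a * b else σ a * b) := by
  rw [prodBasis, if_neg fun h => zPt_fst_ne hi h.1]
  split_ifs with h h' h'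
  · have h1 := label_eq_zero_of_one_fourth h.1
    have h2 := label_eq_zero_of_three_fourths h.2
    rw [label_zPt] at h1
    rw [label_xiPt] at h2
    simp [h1, h2] at h'
  · have h1 := label_eq_zero_of_one_fourth h.1
    have h2 := label_eq_zero_of_three_fourths h.2
    rw [label_zPt] at h1
    rw [label_xiPt] at h2
    subst h1 h2
    rfl
  · exact triangleSum_zx σ hi hj a b (finsum_triangles_zx_of_lt hi hj (abs_add_lt hi hj) σ a b
      ((ang_lt_ang_iff he hs' hi hj).2 h'))
  · refine triangleSum_zx σ hi hj a b (finsum_triangles_zx_of_gt hi hj (abs_add_lt hi hj) σ a b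
      (lt_of_le_of_ne (not_lt.1 fun h'' => h' ((ang_lt_ang_iff he hs' hi hj).1 h'')) fun h'' => ?_))
    obtain ⟨rfl, rfl⟩ := ang_eq_ang hirr hs' hi hj h''.symm
    exact h ⟨zPt_zero_fst _, xiPt_zero_fst _⟩

theorem prodBasis_xz {e : ℝ} (he : 0 < e) (hirr : Irrational e) (hs' : s'.1 = e * s.1) :
    prodBasis σ s s' (xiPt s.1 i hi.le) a (zPt s'.1 j hj.le) b =
    Finsupp.single (xiPt (s.1 + s'.1) (i + j) (abs_add_lt hi hj).le)
      (if (j : ℝ) / e < i then a * σ b else a * b) := by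
  rw [prodBasis]
  by_cases h : (xiPt s.1 i hi.le).1.1 = ((3 / 4 : ℝ) : UnitAddCircle) ∧
      (zPt s'.1 j hj.le).1.1 = ((1 / 4 : ℝ) : UnitAddCircle)
  · rw [if_pos h]
    have h1 := label_eq_zero_of_three_fourths h.1
    have h2 := label_eq_zero_of_one_fourth h.2
    rw [label_xiPt] at h1
    rw [label_zPt] at h2
    subst h1 h2
    rw [if_neg (by simp)]
    rfl
  rw [if_neg h, if_neg fun h => xiPt_fst_ne hi h.1]
  split_ifs with h'
  · exact triangleSum_xz σ hi hj a b (finsum_triangles_xz_of_lt hi hj (abs_add_lt hi hj) σ a b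
      ((ang_lt_ang_iff he hs' hi hj).2 h'))
  · refine triangleSum_xz σ hi hj a b (finsum_triangles_xz_of_gt hi hj (abs_add_lt hi hj) σ a b
      (lt_of_le_of_ne (not_lt.1 fun h'' => h' ((ang_lt_ang_iff he hs' hi hj).1 h'')) fun h'' => ?_))
    obtain ⟨rfl, rfl⟩ := ang_eq_ang hirr hs' hi hj h''.symm
    exact h ⟨xiPt_zero_fst _, zPt_zero_fst _⟩

end ProdBasis

/-! ### The generators of the direct limit -/

theorem zPt_congr {s : ℝ} {i j : ℤ} (h : i = j) (hi : |(i : ℝ)| ≤ s) (hj : |(j : ℝ)| ≤ s) :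
    zPt s i hi = zPt s j hj := by
  subst h
  rfl

theorem xiPt_congr {s : ℝ} {i j : ℤ} (h : i = j) (hi : |(i : ℝ)| ≤ s) (hj : |(j : ℝ)| ≤ s) :
    xiPt s i hi = xiPt s j hj := by
  subst h
  rfl

/-- The name of an intersection point: `Sum.inl i` for `z_i` and `Sum.inr i` for `ξ_i`. -/
def name {s : ℝ} (p : InterPt s 0) : ℤ ⊕ ℤ :=
  if 0 < sinT p.1.1 then .inl (label p) else .inr (label p)

section Name

variable {s : ℝ} {i : ℤ} (hi : |(i : ℝ)| < s)

theorem name_zPt : name (zPt s i hi.le) = .inl i := by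
  rw [name, if_pos (show 0 < sinT (zPt s i hi.le).1.1 from sinT_ang hi), label_zPt]

theorem name_xiPt : name (xiPt s i hi.le) = .inr i := by
  rw [name, if_neg (show ¬ 0 < sinT (xiPt s i hi.le).1.1 from (sinT_one_sub_ang hi).not_gt),
    label_xiPt]

theorem move_zPt {s' : ℝ} (hs : 0 ≤ s) (h : s ≤ s') :
    move hs h (zPt s i hi.le) = zPt s' i (hi.le.trans h) := by
  rw [move, if_pos (show 0 < sinT (zPt s i hi.le).1.1 from sinT_ang hi)]
  exact zPt_congr (label_zPt hi.le) _ _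

theorem move_xiPt {s' : ℝ} (hs : 0 ≤ s) (h : s ≤ s') :
    move hs h (xiPt s i hi.le) = xiPt s' i (hi.le.trans h) := by
  rw [move, if_neg (show ¬ 0 < sinT (xiPt s i hi.le).1.1 from (sinT_one_sub_ang hi).not_gt)]
  exact xiPt_congr (label_xiPt hi.le) _ _

end Name

/-- The intersection points of `φ^s L_(0)` and `L_(0)` are the `z_i` and the `ξ_i`. -/
theorem LoudIdx.point_cases (s : LoudIdx) (p : InterPt s.1 0) : ∃ (i : ℤ) (hi : |(i : ℝ)| < s.1),
    p = zPt s.1 i hi.le ∨ p = xiPt s.1 i hi.le :=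
  ⟨label p, LoudIdx.abs_lt (abs_label_le s.2.1.le p), eq_zPt_or_eq_xiPt s.2.1 p⟩

theorem name_move {s s' : LoudIdx} (h : s ≤ s') (p : InterPt s.1 0) :
    name (move s.2.1.le h p) = name p := by
  obtain ⟨i, hi, rfl | rfl⟩ := s.point_cases p
  · rw [move_zPt hi, name_zPt hi, name_zPt (hi.trans_le h)]
  · rw [move_xiPt hi, name_xiPt hi, name_xiPt (hi.trans_le h)]

variable {C : Type*} [CommRing C]

theorem toLoud_continuation {s s' : LoudIdx} (h : s ≤ s') (w : CF C s.1 0) :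
    toLoud C s' (continuation C s s' h w) = toLoud C s w :=
  AddCommGroup.DirectLimit.of_f (f := continuation C) h w

theorem continuation_single {s s' : LoudIdx} (h : s ≤ s') (p : InterPt s.1 0) (a : C) :
    continuation C s s' h (Finsupp.single p a) = Finsupp.single (move s.2.1.le h p) a :=
  Finsupp.mapDomain_single

theorem toLoud_zPt_of_le {s s' : LoudIdx} (h : s ≤ s') {i : ℤ} (hi : |(i : ℝ)| ≤ s.1) (a : C) :
    toLoud C s' (Finsupp.single (zPt s'.1 i (hi.trans h)) a) =
      toLoud C s (Finsupp.single (zPt s.1 i hi) a) := by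
  rw [← toLoud_continuation h, continuation_single, move_zPt (LoudIdx.abs_lt hi)]

theorem toLoud_xiPt_of_le {s s' : LoudIdx} (h : s ≤ s') {i : ℤ} (hi : |(i : ℝ)| ≤ s.1) (a : C) :
    toLoud C s' (Finsupp.single (xiPt s'.1 i (hi.trans h)) a) =
      toLoud C s (Finsupp.single (xiPt s.1 i hi) a) := by
  rw [← toLoud_continuation h, continuation_single, move_xiPt (LoudIdx.abs_lt hi)]

theorem toLoud_zPt (s : LoudIdx) {i : ℤ} (hi : |(i : ℝ)| ≤ s.1) (a : C) :
    toLoud C s (Finsupp.single (zPt s.1 i hi) a) = zLoud C i a := by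
  rcases le_total s (bigIdx i) with h | h
  · exact (toLoud_zPt_of_le h hi a).symm
  · exact toLoud_zPt_of_le h (abs_le_bigIdx i) a

theorem toLoud_xiPt (s : LoudIdx) {i : ℤ} (hi : |(i : ℝ)| ≤ s.1) (a : C) :
    toLoud C s (Finsupp.single (xiPt s.1 i hi) a) = xiLoud C i a := by
  rcases le_total s (bigIdx i) with h | h
  · exact (toLoud_xiPt_of_le h hi a).symm
  · exact toLoud_xiPt_of_le h (abs_le_bigIdx i) a

/-- The generators `z_i · a` and `ξ_i · a` of the direct limit, additive in `a`. -/
def gen : ℤ ⊕ ℤ → C →+ CFloud C :=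
  Sum.elim (fun i => (toLoud C (bigIdx i)).comp (Finsupp.singleAddHom (zPt _ i (abs_le_bigIdx i))))
    fun i => (toLoud C (bigIdx i)).comp (Finsupp.singleAddHom (xiPt _ i (abs_le_bigIdx i)))

theorem gen_inl (i : ℤ) (a : C) : gen (.inl i) a = zLoud C i a := rfl

theorem gen_inr (i : ℤ) (a : C) : gen (.inr i) a = xiLoud C i a := rfl

theorem toLoud_single (s : LoudIdx) (p : InterPt s.1 0) (a : C) :
    toLoud C s (Finsupp.single p a) = gen (name p) a := by
  obtain ⟨i, hi, rfl | rfl⟩ := s.point_cases p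
  · rw [toLoud_zPt, name_zPt hi, gen_inl]
  · rw [toLoud_xiPt, name_xiPt hi, gen_inr]

theorem toLoud_eq_sum (s : LoudIdx) (w : CF C s.1 0) :
    toLoud C s w = w.sum fun p a => gen (name p) a := by
  conv_lhs => rw [← Finsupp.sum_single w]
  rw [map_finsuppSum]
  simp only [toLoud_single]

/-- The coordinates of an element of the direct limit. -/
def coords : CFloud C →+ (ℤ ⊕ ℤ →₀ C) :=
  AddCommGroup.DirectLimit.lift _ _ _
    (fun s => (Finsupp.mapDomain.addMonoidHom name : CF C s.1 0 →+ (ℤ ⊕ ℤ →₀ C)))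
    fun s s' h w => by
      change Finsupp.mapDomain name (Finsupp.mapDomain (move s.2.1.le h) w) =
        Finsupp.mapDomain name w
      rw [← Finsupp.mapDomain_comp]
      exact congrArg (fun f => Finsupp.mapDomain f w) (funext (name_move h))

theorem coords_toLoud (s : LoudIdx) (w : CF C s.1 0) :
    coords (toLoud C s w) = Finsupp.mapDomain name w :=
  AddCommGroup.DirectLimit.lift_of (f := continuation C) _ _ _ _ _

theorem coords_gen (g : ℤ ⊕ ℤ) (a : C) : coords (gen g a) = Finsupp.single g a := by
  rcases g with i | i
  · rw [gen_inl, zLoud, coords_toLoud, Finsupp.mapDomain_single,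
      name_zPt (LoudIdx.abs_lt (abs_le_bigIdx i))]
  · rw [gen_inr, xiLoud, coords_toLoud, Finsupp.mapDomain_single,
      name_xiPt (LoudIdx.abs_lt (abs_le_bigIdx i))]

/-- The direct limit is freely generated by the `z_i` and the `ξ_i`. -/
def loudEquiv : (ℤ ⊕ ℤ →₀ C) ≃+ CFloud C :=
  AddMonoidHom.toAddEquiv (Finsupp.liftAddHom gen) coords
    (Finsupp.addHom_ext fun g a => by simp [coords_gen])
    (AddCommGroup.DirectLimit.hom_ext _ fun s => Finsupp.addHom_ext fun p a => by
      change Finsupp.liftAddHom gen (coords (toLoud C s (Finsupp.single p a))) =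
        toLoud C s (Finsupp.single p a)
      rw [toLoud_single, coords_gen]
      simp)

theorem loudEquiv_single (g : ℤ ⊕ ℤ) (a : C) : loudEquiv (Finsupp.single g a) = gen g a :=
  Finsupp.liftAddHom_apply_single _ _ _

theorem loudEquiv_symm_gen (g : ℤ ⊕ ℤ) (a : C) : loudEquiv.symm (gen g a) = Finsupp.single g a :=
  coords_gen g a

theorem loud_induction {P : CFloud C → Prop} (w : CFloud C) (h0 : P 0)
    (hadd : ∀ w w', P w → P w' → P (w + w')) (hgen : ∀ g a, P (gen g a)) : P w := by
  rw [← loudEquiv.apply_symm_apply w]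
  induction loudEquiv.symm w using Finsupp.induction_linear with
  | zero => rwa [map_zero]
  | add f f' hf hf' =>
    rw [map_add]
    exact hadd _ _ hf hf'
  | single g a =>
    rw [loudEquiv_single]
    exact hgen g a

theorem loud_hom_ext {N : Type*} [AddCommMonoid N] {f f' : CFloud C →+ N}
    (h : ∀ g a, f (gen g a) = f' (gen g a)) : f = f' :=
  AddMonoidHom.ext fun w => loud_induction (P := fun w => f w = f' w) w (by rw [map_zero, map_zero])
    (fun w w' hw hw' => by rw [map_add, map_add, hw, hw']) h

/-- The additive map with given values on the generators. -/
def loudLift {N : Type*} [AddCommMonoid N] (F : ℤ ⊕ ℤ → C →+ N) : CFloud C →+ N :=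
  (Finsupp.liftAddHom F).comp loudEquiv.symm.toAddMonoidHom

theorem loudLift_gen {N : Type*} [AddCommMonoid N] (F : ℤ ⊕ ℤ → C →+ N) (g : ℤ ⊕ ℤ) (a : C) :
    loudLift F (gen g a) = F g a := by
  change Finsupp.liftAddHom F (loudEquiv.symm (gen g a)) = F g a
  rw [loudEquiv_symm_gen]
  simp

theorem loudEquiv_sum_symm (f : (ℤ →₀ C) × (ℤ →₀ C)) :
    loudEquiv (Finsupp.sumFinsuppAddEquivProdFinsupp.symm f) =
      (f.1.sum fun i a => zLoud C i a) + f.2.sum fun i a => xiLoud C i a := by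
  let F : (ℤ →₀ C) × (ℤ →₀ C) →+ CFloud C := AddMonoidHom.coprod
    (Finsupp.liftAddHom fun i => gen (.inl i)) (Finsupp.liftAddHom fun i => gen (.inr i))
  have : (loudEquiv.toAddMonoidHom.comp
      Finsupp.sumFinsuppAddEquivProdFinsupp.symm.toAddMonoidHom) = F := by
    refine AddMonoidHom.ext fun f => ?_
    obtain ⟨f, rfl⟩ := Finsupp.sumFinsuppAddEquivProdFinsupp.surjective f
    change loudEquiv (Finsupp.sumFinsuppAddEquivProdFinsupp.symm _) = _
    rw [AddEquiv.symm_apply_apply]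
    induction f using Finsupp.induction_linear with
    | zero => rw [map_zero, map_zero, map_zero]
    | add f f' hf hf' => rw [map_add, hf, hf', map_add, map_add]
    | single g a =>
      rw [loudEquiv_single]
      rcases g with i | i
      · have : Finsupp.sumFinsuppAddEquivProdFinsupp (Finsupp.single (Sum.inl i : ℤ ⊕ ℤ) a) =
            (Finsupp.single i a, 0) := by
          ext j
          · simp [Finsupp.single_apply]
          · simp
        rw [this]
        simp [F]
      · have : Finsupp.sumFinsuppAddEquivProdFinsupp (Finsupp.single (Sum.inr i : ℤ ⊕ ℤ) a) =
            (0, Finsupp.single i a) := by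
          ext j
          · simp
          · simp [Finsupp.single_apply]
        rw [this]
        simp [F]
  exact DFunLike.congr_fun this f

theorem loud_bijective : Function.Bijective (fun f : (ℤ →₀ C) × (ℤ →₀ C) =>
    (f.1.sum fun i a => zLoud C i a) + f.2.sum fun i a => xiLoud C i a) := by
  have : (fun f : (ℤ →₀ C) × (ℤ →₀ C) =>
      (f.1.sum fun i a => zLoud C i a) + f.2.sum fun i a => xiLoud C i a) =
      Finsupp.sumFinsuppAddEquivProdFinsupp.symm.trans loudEquiv :=
    funext fun f => (loudEquiv_sum_symm f).symm
  rw [this]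
  exact AddEquiv.bijective _

theorem single_mem_cfDeg {s : ℝ} {k : ℕ} {p : InterPt s 0} (hp : mas s 0 p.1 = k) (a : C) :
    Finsupp.single p a ∈ cfDeg C s 0 k :=
  Finsupp.single_mem_supported C a hp

/-- Here `ι` lists the names of the points of degree `k`, so one argument serves both degrees. -/
theorem loudDeg_eq_range {k : ℕ} {ι : ℤ → ℤ ⊕ ℤ}
    (h1 : ∀ (s : LoudIdx) (p : InterPt s.1 0), mas s.1 0 p.1 = k → ∃ i, name p = ι i)
    (h2 : ∀ i, ∃ (s : LoudIdx) (p : InterPt s.1 0), mas s.1 0 p.1 = k ∧ name p = ι i) :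
    (loudDeg C k : Set (CFloud C)) =
      Set.range (fun f : ℤ →₀ C => f.sum fun i a => gen (ι i) a) := by
  have : loudDeg C k = (Finsupp.liftAddHom fun i => gen (C := C) (ι i)).range := by
    refine le_antisymm (iSup_le fun s => ?_) ?_
    · rintro _ ⟨w, hw, rfl⟩
      rw [toLoud_eq_sum]
      refine AddSubgroup.sum_mem _ fun p hp => ?_
      obtain ⟨i, hi⟩ := h1 s p (hw hp)
      exact ⟨Finsupp.single i (w p), by simp [hi]⟩
    · rintro _ ⟨f, rfl⟩
      refine AddSubgroup.sum_mem _ fun i _ => ?_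
      obtain ⟨s, p, hp, hn⟩ := h2 i
      refine AddSubgroup.mem_iSup_of_mem s ⟨Finsupp.single p (f i), single_mem_cfDeg hp _, ?_⟩
      rw [toLoud_single, hn]
  rw [this]
  rfl

theorem loudDeg_zero : (loudDeg C 0 : Set (CFloud C)) =
    Set.range (fun f : ℤ →₀ C => f.sum fun i a => zLoud C i a) := by
  refine loudDeg_eq_range (ι := .inl) (fun s p hp => ?_) fun i => ?_
  · obtain ⟨i, hi, rfl | rfl⟩ := s.point_cases p
    · exact ⟨i, name_zPt hi⟩
    · rw [mas_xiPt hi] at hp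
      exact absurd hp one_ne_zero
  · have hi := LoudIdx.abs_lt (abs_le_bigIdx i)
    exact ⟨bigIdx i, zPt _ i hi.le, mas_zPt hi, name_zPt hi⟩

theorem loudDeg_one : (loudDeg C 1 : Set (CFloud C)) =
    Set.range (fun f : ℤ →₀ C => f.sum fun i a => xiLoud C i a) := by
  refine loudDeg_eq_range (ι := .inr) (fun s p hp => ?_) fun i => ?_
  · obtain ⟨i, hi, rfl | rfl⟩ := s.point_cases p
    · rw [mas_zPt hi] at hp
      exact absurd hp zero_ne_one
    · exact ⟨i, name_xiPt hi⟩
  · have hi := LoudIdx.abs_lt (abs_le_bigIdx i)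
    exact ⟨bigIdx i, xiPt _ i hi.le, mas_xiPt hi, name_xiPt hi⟩

/-! ### The differential and the multiplications -/

section Structure

variable (σ : C ≃+* C)

/-- The differential of the loud Floer cochains. -/
def loudD : CFloud C →+ CFloud C :=
  loudLift (Sum.elim (fun i => (gen (.inr i)).comp ((σ : C →+ C) - AddMonoidHom.id C)) fun _ => 0)

theorem loudD_z (i : ℤ) (a : C) : loudD σ (zLoud C i a) = xiLoud C i (σ a - a) :=
  loudLift_gen _ (.inl i) a

theorem loudD_xi (i : ℤ) (a : C) : loudD σ (xiLoud C i a) = 0 :=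
  loudLift_gen _ (.inr i) a

theorem isLoudDifferential_loudD : IsLoudDifferential σ (loudD σ) := by
  intro s w
  rw [toLoud_eq_sum, map_finsuppSum, mu1, map_finsuppSum]
  refine Finsupp.sum_congr fun p _ => ?_
  obtain ⟨i, hi, rfl | rfl⟩ := s.point_cases p
  · rw [finsum_bigons_zPt σ hi, name_zPt hi, gen_inl, loudD_z, toLoud_xiPt]
  · rw [finsum_bigons_xiPt σ hi, name_xiPt hi, gen_inr, loudD_xi, map_zero]

theorem isLoudDifferential_iff (d : CFloud C →+ CFloud C) :
    IsLoudDifferential σ d ↔ d = loudD σ := by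
  constructor
  · intro h
    refine AddCommGroup.DirectLimit.hom_ext _ fun s => AddMonoidHom.ext fun w => ?_
    exact (h s w).trans (isLoudDifferential_loudD σ s w).symm
  · rintro rfl
    exact isLoudDifferential_loudD σ

/-- The products of the generators. -/
def genMul (e : ℝ) : ℤ ⊕ ℤ → ℤ ⊕ ℤ → C →+ C →+ CFloud C
  | .inl i, .inl j => AddMonoidHom.mul.compr₂ (gen (.inl (i + j)))
  | .inr i, .inl j =>
    open Classical in
    if (j : ℝ) / e < i then (AddMonoidHom.mul.compl₂ (σ : C →+ C)).compr₂ (gen (.inr (i + j)))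
    else AddMonoidHom.mul.compr₂ (gen (.inr (i + j)))
  | .inl i, .inr j =>
    open Classical in
    if (j : ℝ) / e < i then AddMonoidHom.mul.compr₂ (gen (.inr (i + j)))
    else (AddMonoidHom.mul.comp (σ : C →+ C)).compr₂ (gen (.inr (i + j)))
  | .inr _, .inr _ => 0

/-- The multiplication of the loud Floer cochains, for the slope `e`. -/
def loudMul (e : ℝ) : CFloud C →+ CFloud C →+ CFloud C :=
  loudLift fun g => (loudLift fun g' => (genMul σ e g g').flip).flip

theorem loudMul_gen (e : ℝ) (g g' : ℤ ⊕ ℤ) (a b : C) :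
    loudMul σ e (gen g a) (gen g' b) = genMul σ e g g' a b := by
  rw [loudMul, loudLift_gen, AddMonoidHom.flip_apply, loudLift_gen, AddMonoidHom.flip_apply]

variable (e : ℝ) (i j : ℤ) (a b : C)

theorem loudMul_zz :
    loudMul σ e (zLoud C i a) (zLoud C j b) = zLoud C (i + j) (a * b) :=
  loudMul_gen σ e (.inl i) (.inl j) a b

theorem loudMul_xx : loudMul σ e (xiLoud C i a) (xiLoud C j b) = 0 :=
  loudMul_gen σ e (.inr i) (.inr j) a b

open Classical in
theorem loudMul_xz : loudMul σ e (xiLoud C i a) (zLoud C j b) =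
    xiLoud C (i + j) (if (j : ℝ) / e < i then a * σ b else a * b) := by
  refine (loudMul_gen σ e (.inr i) (.inl j) a b).trans ?_
  rw [genMul]
  split_ifs <;> rfl

open Classical in
theorem loudMul_zx : loudMul σ e (zLoud C i a) (xiLoud C j b) =
    xiLoud C (i + j) (if (j : ℝ) / e < i then a * b else σ a * b) := by
  refine (loudMul_gen σ e (.inl i) (.inr j) a b).trans ?_
  rw [genMul]
  split_ifs <;> rfl

end Structure

/-! ### Existence, uniqueness and the Leibniz rule for the product on the limit -/

section Product

variable (σ : C ≃+* C) {e : ℝ}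

theorem isLoudProduct_loudMul (he : 0 < e) (hirr : Irrational e) :
    IsLoudProduct σ e (loudMul σ e) := by
  intro s s' hs' hsum w w'
  have key : ∀ (p : InterPt s.1 0) (a : C) (q : InterPt s'.1 0) (b : C),
      toLoud C ⟨s.1 + s'.1, hsum⟩ (prodBasis σ s s' p a q b) =
        loudMul σ e (gen (name p) a) (gen (name q) b) := by
    intro p a q b
    obtain ⟨i, hi, rfl | rfl⟩ := s.point_cases p <;> obtain ⟨j, hj, rfl | rfl⟩ := s'.point_cases q
    · rw [prodBasis_zz σ hi hj, name_zPt hi, name_zPt hj, gen_inl, gen_inl, loudMul_zz]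
      exact toLoud_zPt ⟨s.1 + s'.1, hsum⟩ _ _
    · rw [prodBasis_zx σ hi hj a b he hirr hs', name_zPt hi, name_xiPt hj, gen_inl, gen_inr,
        loudMul_zx]
      convert toLoud_xiPt ⟨s.1 + s'.1, hsum⟩ _ _
    · rw [prodBasis_xz σ hi hj a b he hirr hs', name_xiPt hi, name_zPt hj, gen_inl, gen_inr,
        loudMul_xz]
      convert toLoud_xiPt ⟨s.1 + s'.1, hsum⟩ _ _
    · rw [prodBasis_xx σ hi hj, name_xiPt hi, name_xiPt hj, gen_inr, gen_inr, loudMul_xx, map_zero]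
  rw [toLoud_eq_sum s, triangleProd, map_finsuppSum, map_finsuppSum, Finsupp.sum, Finsupp.sum,
    AddMonoidHom.finsetSum_apply]
  refine Finset.sum_congr rfl fun p _ => ?_
  rw [toLoud_eq_sum, map_finsuppSum, map_finsuppSum]
  exact Finsupp.sum_congr fun q _ => (key p _ q _).symm

/-- There are arbitrarily large indices `s` for which `e s` and `s + e s` are indices, too. -/
theorem exists_idx (he : 0 < e) (B : ℝ) : ∃ s s' : LoudIdx, B ≤ s.1 ∧ B ≤ s'.1 ∧
    s'.1 = e * s.1 ∧ (0 < s.1 + s'.1 ∧ ∀ n : ℤ, (n : ℝ) ≠ s.1 + s'.1) := by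
  -- The values of `s` for which `s`, `e * s` or `s + e * s` is an integer are countably many, so
  -- good ones are dense.
  let bad : Set ℝ := Set.range (fun n : ℤ => (n : ℝ)) ∪ Set.range (fun n : ℤ => (n : ℝ) / e) ∪
    Set.range (fun n : ℤ => (n : ℝ) / (1 + e))
  have hbad : bad.Countable := ((Set.countable_range _).union (Set.countable_range _)).union
    (Set.countable_range _)
  obtain ⟨x, hx', hx⟩ := (hbad.dense_compl ℝ).exists_gt (max 0 (max B (B / e)))
  simp only [bad, Set.mem_compl_iff, Set.mem_union, Set.mem_range, not_or, not_exists] at hx'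
  obtain ⟨⟨n1, n2⟩, n3⟩ := hx'
  obtain ⟨h0, h12⟩ := max_lt_iff.1 hx
  obtain ⟨h1, h2⟩ := max_lt_iff.1 h12
  rw [div_lt_iff₀ he] at h2
  refine ⟨⟨x, h0, n1⟩, ⟨e * x, mul_pos he h0, fun n h => n2 n ?_⟩, h1.le, ?_, rfl,
    add_pos h0 (mul_pos he h0), fun n h => n3 n ?_⟩
  · rw [h]
    field_simp
  · change B ≤ e * x
    linarith
  · change (n : ℝ) = x + e * x at h
    have : 1 + e ≠ 0 := by positivity
    rw [h]
    field_simp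

theorem exists_name_eq (g : ℤ ⊕ ℤ) :
    ∃ B : ℝ, ∀ s : LoudIdx, B ≤ s.1 → ∃ p : InterPt s.1 0, name p = g := by
  rcases g with i | i <;> refine ⟨|(i : ℝ)|, fun s hs => ?_⟩
  · exact ⟨zPt s.1 i hs, name_zPt (LoudIdx.abs_lt hs)⟩
  · exact ⟨xiPt s.1 i hs, name_xiPt (LoudIdx.abs_lt hs)⟩

/-- A product is tested only on pairs of indices `(s, e * s)`. Uniqueness needs such a pair at which
both generators are already present. -/
theorem isLoudProduct_iff (he : 0 < e) (hirr : Irrational e)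
    (m : CFloud C →+ CFloud C →+ CFloud C) : IsLoudProduct σ e m ↔ m = loudMul σ e := by
  constructor
  · intro h
    refine loud_hom_ext fun g a => loud_hom_ext fun g' b => ?_
    obtain ⟨B, hB⟩ := exists_name_eq g
    obtain ⟨B', hB'⟩ := exists_name_eq g'
    obtain ⟨s, s', h1, h2, hs', hsum⟩ := exists_idx he (max B B')
    obtain ⟨p, rfl⟩ := hB s ((le_max_left _ _).trans h1)
    obtain ⟨q, rfl⟩ := hB' s' ((le_max_right _ _).trans h2)
    rw [← toLoud_single, ← toLoud_single, h s s' hs' hsum,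
      isLoudProduct_loudMul σ he hirr s s' hs' hsum]
  · rintro rfl
    exact isLoudProduct_loudMul σ he hirr

/-- Only two generators of degree zero give a nontrivial identity. One branch reads `(σ a - a) σ b +
a (σ b - b)`, the other `(σ a - a) b + σ a (σ b - b)`, and both equal `σ (a b) - a b`. -/
theorem loudMul_leibniz (w w' : CFloud C) : loudD σ (loudMul σ e w w') =
    loudMul σ e (loudD σ w) w' + loudMul σ e w (loudD σ w') := by
  induction w using loud_induction with
  | h0 => simp
  | hadd w₁ w₂ h₁ h₂ =>
    simp only [map_add, AddMonoidHom.add_apply, h₁, h₂]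
    abel
  | hgen g a =>
    induction w' using loud_induction with
    | h0 => simp
    | hadd w₁ w₂ h₁ h₂ =>
      simp only [map_add, h₁, h₂]
      abel
    | hgen g' b =>
      rcases g with i | i <;> rcases g' with j | j <;> simp only [gen_inl, gen_inr]
      · rw [loudMul_zz, loudD_z, loudD_z, loudD_z, loudMul_xz, loudMul_zx, ← gen_inr, ← gen_inr,
          ← gen_inr, ← map_add]
        congr 1
        split_ifs <;> rw [map_mul] <;> ring
      · rw [loudMul_zx, loudD_z, loudD_xi, loudD_xi, loudMul_xx, map_zero, add_zero]
      · rw [loudMul_xz, loudD_xi, loudD_z, loudD_xi, loudMul_xx, map_zero,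
          AddMonoidHom.zero_apply, add_zero]
      · rw [loudMul_xx, loudD_xi, loudD_xi, map_zero, map_zero, AddMonoidHom.zero_apply, map_zero, add_zero]

end Product

/-! ### Cohomology -/

variable {C : Type*} [CommRing C] (σ : C ≃+* C)

theorem exists_ne_of_ne_refl {σ : C ≃+* C} (hσ : σ ≠ RingEquiv.refl C) : ∃ c, σ c ≠ c := by
  by_contra! h
  exact hσ (RingEquiv.ext h)

theorem xiLoud_injective (i : ℤ) : Function.Injective (xiLoud C i) := fun a b h => by
  have := congrArg (fun w => coords w (.inr i)) h
  simpa [← gen_inr, coords_gen] using this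

theorem loudMul_not_assoc (hσ : σ ≠ RingEquiv.refl C) {e : ℝ} (he : 0 < e) :
    ¬ ∀ w w' w'' : CFloud C,
      loudMul σ e (loudMul σ e w w') w'' = loudMul σ e w (loudMul σ e w' w'') := by
  intro h
  obtain ⟨c, hc⟩ := exists_ne_of_ne_refl hσ
  -- Multiplying from the left raises the first index to `1 > 0 / e` before `c` enters, so `σ c`
  -- appears; from the right the slopes `1 / e ≥ 0` leave `c` alone.
  have := h (xiLoud C 0 1) (zLoud C 1 1) (zLoud C 0 c)
  have h1 : ¬ (((1 : ℤ) : ℝ) / e < (0 : ℤ)) := by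
    simp only [Int.cast_one, Int.cast_zero, not_lt]
    positivity
  rw [loudMul_xz, if_neg h1, loudMul_xz, if_pos (by simp), loudMul_zz, loudMul_xz,
    if_neg (by simpa using h1)] at this
  simp only [one_mul, zero_add, add_zero] at this
  exact hc (xiLoud_injective _ this)

theorem loudMul_ne_of_lt (hσ : σ ≠ RingEquiv.refl C) {e e' : ℝ} (he : 0 < e) (h : e < e') :
    loudMul σ e ≠ loudMul σ e' := by
  intro hm
  obtain ⟨c, hc⟩ := exists_ne_of_ne_refl hσ
  -- A fraction `n / d` between the slopes gives generators `ξ_d` and `z_n` that fall into different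
  -- branches for `e` and `e'`.
  obtain ⟨r, h1, h2⟩ := exists_rat_btwn h
  have hden : (0 : ℝ) < (r.den : ℤ) := by exact_mod_cast r.den_pos
  have hr : (r : ℝ) = r.num / (r.den : ℤ) := by
    rw [Int.cast_natCast]
    exact_mod_cast (Rat.num_div_den r).symm
  rw [hr, lt_div_iff₀ hden] at h1
  rw [hr, div_lt_iff₀ hden] at h2
  have := DFunLike.congr_fun (DFunLike.congr_fun hm (xiLoud C r.den 1)) (zLoud C r.num c)
  rw [loudMul_xz, loudMul_xz, if_neg (by rw [div_lt_iff₀ he]; linarith),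
    if_pos (by rw [div_lt_iff₀ (he.trans h)]; linarith), one_mul, one_mul] at this
  exact hc (xiLoud_injective _ this).symm

theorem loudMul_ne (hσ : σ ≠ RingEquiv.refl C) {e e' : ℝ} (he : 0 < e) (he' : 0 < e')
    (h : e ≠ e') : loudMul σ e ≠ loudMul σ e' := by
  rcases h.lt_or_gt with h | h
  · exact loudMul_ne_of_lt σ hσ he h
  · exact (loudMul_ne_of_lt σ hσ he' h).symm

/-- The generators of the cocycles. -/
def IsCocycleGen (w : CFloud C) : Prop :=
  (∃ i c, σ c = c ∧ w = zLoud C i c) ∨ ∃ i c, w = xiLoud C i c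

theorem coords_loudD (w : CFloud C) (i : ℤ) :
    coords (loudD σ w) (.inr i) = σ (coords w (.inl i)) - coords w (.inl i) := by
  induction w using loud_induction with
  | h0 => simp
  | hadd w w' h h' =>
    simp only [map_add, Finsupp.add_apply, h, h']
    ring
  | hgen g a =>
    rcases g with j | j
    · rw [gen_inl, loudD_z, ← gen_inr, ← gen_inl, coords_gen, coords_gen]
      by_cases h : j = i
      · simp [h]
      · simp [h]
    · rw [gen_inr, loudD_xi, ← gen_inr, coords_gen]
      simp

theorem fixed_of_mem_ker {w : CFloud C} (hw : w ∈ (loudD σ).ker) (i : ℤ) :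
    σ (coords w (.inl i)) = coords w (.inl i) := by
  rw [← sub_eq_zero, ← coords_loudD, AddMonoidHom.mem_ker.1 hw, map_zero, Finsupp.zero_apply]

theorem eq_sum_coords (w : CFloud C) : w = (coords w).sum fun g a => gen g a :=
  (loudEquiv.apply_symm_apply w).symm

theorem mem_closure_of_mem_ker {w : CFloud C} (hw : w ∈ (loudD σ).ker) :
    w ∈ AddSubmonoid.closure {w | IsCocycleGen σ w} := by
  rw [eq_sum_coords w]
  refine AddSubmonoid.sum_mem _ fun g _ => AddSubmonoid.subset_closure ?_
  rcases g with i | i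
  · exact .inl ⟨i, _, fixed_of_mem_ker σ hw i, rfl⟩
  · exact .inr ⟨i, _, rfl⟩

/-- An additive property of cocycles holds as soon as it holds for the generators. -/
theorem ker_induction {P : CFloud C → Prop} (h0 : P 0) (hadd : ∀ w w', P w → P w' → P (w + w'))
    (hz : ∀ i c, σ c = c → P (zLoud C i c))
    (hx : ∀ i c, P (xiLoud C i c)) {w : CFloud C} (hw : w ∈ (loudD σ).ker) : P w := by
  have hw' := mem_closure_of_mem_ker σ hw
  clear hw
  induction hw' using AddSubmonoid.closure_induction with
  | mem w h =>
    rcases h with ⟨i, c, hc, rfl⟩ | ⟨i, c, rfl⟩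
    · exact hz i c hc
    · exact hx i c
  | zero => exact h0
  | add w w' _ _ h h' => exact hadd _ _ h h'

theorem ker_hom_ext {N : Type*} [AddCommMonoid N] {f f' : CFloud C →+ N}
    (hz : ∀ i c, σ c = c → f (zLoud C i c) = f' (zLoud C i c))
    (hx : ∀ i c, f (xiLoud C i c) = f' (xiLoud C i c)) {w : CFloud C} (hw : w ∈ (loudD σ).ker) :
    f w = f' w :=
  ker_induction σ (P := fun w => f w = f' w) (by rw [map_zero, map_zero])
    (fun w w' h h' => by rw [map_add, map_add, h, h']) hz hx hw

section Cocycles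

variable {σ} (e : ℝ) (i j : ℤ)

/-- The branches differ by `σ` on the coefficient of the degree zero factor, so they coincide when
that coefficient is fixed; hence the product of cocycles does not see `e`. -/
theorem loudMul_zx_of_fixed {a : C} (ha : σ a = a) (b : C) :
    loudMul σ e (zLoud C i a) (xiLoud C j b) = xiLoud C (i + j) (a * b) := by
  rw [loudMul_zx, ha, ite_self]

theorem loudMul_xz_of_fixed (a : C) {b : C} (hb : σ b = b) :
    loudMul σ e (xiLoud C i a) (zLoud C j b) = xiLoud C (i + j) (a * b) := by
  rw [loudMul_xz, hb, ite_self]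

end Cocycles

theorem loudMul_eq_of_mem_ker (e e' : ℝ) {w w' : CFloud C} (hw : w ∈ (loudD σ).ker)
    (hw' : w' ∈ (loudD σ).ker) : loudMul σ e w w' = loudMul σ e' w w' := by
  refine ker_hom_ext σ (f := (loudMul σ e).flip w') (f' := (loudMul σ e').flip w')
    (fun i a ha => ?_) (fun i a => ?_) hw <;> simp only [AddMonoidHom.flip_apply] <;>
    refine ker_hom_ext σ (fun j b hb => ?_) (fun j b => ?_) hw'
  · rw [loudMul_zz, loudMul_zz]
  · rw [loudMul_zx_of_fixed _ _ _ ha, loudMul_zx_of_fixed _ _ _ ha]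
  · rw [loudMul_xz_of_fixed _ _ _ _ hb, loudMul_xz_of_fixed _ _ _ _ hb]
  · rw [loudMul_xx, loudMul_xx]

theorem loudMul_assoc_of_mem_ker (e : ℝ) {w w' w'' : CFloud C} (hw : w ∈ (loudD σ).ker)
    (hw' : w' ∈ (loudD σ).ker) (hw'' : w'' ∈ (loudD σ).ker) :
    loudMul σ e (loudMul σ e w w') w'' = loudMul σ e w (loudMul σ e w' w'') := by
  have hmul : ∀ {a b : C}, σ a = a → σ b = b → σ (a * b) = a * b := fun ha hb => by
    rw [map_mul, ha, hb]
  refine ker_induction σ (P := fun w => loudMul σ e (loudMul σ e w w') w'' = loudMul σ e w (loudMul σ e w' w''))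
    (by simp only [map_zero, AddMonoidHom.zero_apply])
    (fun _ _ h h' => by simp only [map_add, AddMonoidHom.add_apply, h, h'])
    (fun i a ha => ?_) (fun i a => ?_) hw <;>
  refine ker_induction σ (P := fun w' => loudMul σ e (loudMul σ e _ w') w'' = loudMul σ e _ (loudMul σ e w' w''))
    (by simp only [map_zero, AddMonoidHom.zero_apply])
    (fun _ _ h h' => by simp only [map_add, AddMonoidHom.add_apply, h, h'])
    (fun j b hb => ?_) (fun j b => ?_) hw' <;>
  refine ker_induction σ (P := fun w'' => loudMul σ e (loudMul σ e _ _) w'' = loudMul σ e _ (loudMul σ e _ w''))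
    (by simp only [map_zero])
    (fun _ _ h h' => by simp only [map_add, h, h'])
    (fun k c hc => ?_) (fun k c => ?_) hw''
  · simp only [loudMul_zz, add_assoc, mul_assoc]
  · simp only [loudMul_zz, loudMul_zx_of_fixed, ha, hb, hmul, add_assoc, mul_assoc]
  · simp only [loudMul_xz_of_fixed, loudMul_zx_of_fixed, ha, hc, add_assoc, mul_assoc]
  · simp only [loudMul_zx_of_fixed, ha, loudMul_xx, map_zero]
  · simp only [loudMul_zz, loudMul_xz_of_fixed, hb, hc, hmul, add_assoc, mul_assoc]
  · simp only [loudMul_zx_of_fixed, loudMul_xz_of_fixed, hb, loudMul_xx]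
  · simp only [loudMul_xz_of_fixed, hc, loudMul_xx, map_zero, AddMonoidHom.zero_apply]
  · simp only [loudMul_xx, map_zero, AddMonoidHom.zero_apply]

/-! ### Degree zero cohomology as a Laurent polynomial ring -/

/-- The map `∑ c_i z^i ↦ ∑ z_i · c_i` to the direct limit. -/
def laurentHom : LaurentPolynomial (fixedSubring σ) →+ CFloud C :=
  (Finsupp.liftAddHom fun i => (gen (.inl i)).comp (fixedSubring σ).subtype.toAddMonoidHom).comp
    (AddMonoidAlgebra.coeffAddEquiv (R := fixedSubring σ) (M := ℤ)).toAddMonoidHom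

theorem laurentHom_C_mul_T (i : ℤ) (c : fixedSubring σ) :
    laurentHom σ (LaurentPolynomial.C c * LaurentPolynomial.T i) = zLoud C i c := by
  rw [← LaurentPolynomial.single_eq_C_mul_T]
  exact Finsupp.liftAddHom_apply_single _ _ _

theorem coords_laurentHom (f : LaurentPolynomial (fixedSubring σ)) (i : ℤ) :
    coords (laurentHom σ f) (.inl i) = (f.coeff i : C) := by
  induction f using LaurentPolynomial.induction_on' with
  | add f g hf hg =>
    rw [map_add, map_add, Finsupp.add_apply, hf, hg, AddMonoidAlgebra.coeff_add,
      Finsupp.add_apply, Subring.coe_add]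
  | C_mul_T n c =>
    rw [laurentHom_C_mul_T, ← gen_inl, coords_gen, ← LaurentPolynomial.single_eq_C_mul_T]
    change _ = ((Finsupp.single n c i : fixedSubring σ) : C)
    by_cases h : n = i
    · simp [h]
    · simp [h]

theorem zLoud_mem_HF0 {i : ℤ} {c : C} (hc : σ c = c) : zLoud C i c ∈ HF0 (loudD σ) := by
  refine ⟨?_, ?_⟩
  · change loudD σ (zLoud C i c) = 0
    rw [loudD_z, hc, sub_self, ← gen_inr, map_zero]
  · change zLoud C i c ∈ (loudDeg C 0 : Set (CFloud C))
    rw [loudDeg_zero]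
    refine ⟨Finsupp.single i c, ?_⟩
    exact Finsupp.sum_single_index (map_zero (gen (.inl i)))

theorem laurentHom_mem (f : LaurentPolynomial (fixedSubring σ)) :
    laurentHom σ f ∈ HF0 (loudD σ) := by
  induction f using LaurentPolynomial.induction_on' with
  | add f g hf hg =>
    rw [map_add]
    exact AddSubgroup.add_mem _ hf hg
  | C_mul_T n c =>
    rw [laurentHom_C_mul_T]
    exact zLoud_mem_HF0 σ c.2

theorem laurentHom_injective : Function.Injective (laurentHom σ) := fun f g h => by
  ext i
  rw [← coords_laurentHom, h, coords_laurentHom]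

/-- The coordinates of a degree zero cocycle at the `z_i` are fixed by `σ`, so they are the
coefficients of a Laurent polynomial over the fixed subring. -/
theorem exists_laurentHom_eq {w : CFloud C} (hw : w ∈ HF0 (loudD σ)) :
    ∃ f, laurentHom σ f = w := by
  obtain ⟨hk, hd⟩ := hw
  obtain ⟨f, rfl⟩ : w ∈ Set.range (fun f : ℤ →₀ C => f.sum fun i a => zLoud C i a) :=
    loudDeg_zero (C := C) ▸ hd
  have hcoord : ∀ i, coords (f.sum fun i a => zLoud C i a) (.inl i) = f i := by
    intro i
    have h := loudEquiv_sum_symm (C := C) (f, 0)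
    rw [Finsupp.sum_zero_index, add_zero] at h
    rw [← h]
    exact DFunLike.congr_fun (loudEquiv.symm_apply_apply
      (Finsupp.sumFinsuppAddEquivProdFinsupp.symm (f, 0))) (Sum.inl i)
  have hf : ∀ i, σ (f i) = f i := fun i => by
    rw [← hcoord, fixed_of_mem_ker σ hk]
  have hsupp : ∀ i, (⟨f i, hf i⟩ : fixedSubring σ) ≠ 0 → i ∈ f.support := fun i hi =>
    Finsupp.mem_support_iff.2 fun h => hi (Subtype.ext h)
  exact ⟨.ofCoeff (Finsupp.onFinset f.support (fun i => ⟨f i, hf i⟩) hsupp),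
    Finsupp.onFinset_sum hsupp fun i => map_zero _⟩

theorem laurentHom_mul (e : ℝ) (f g : LaurentPolynomial (fixedSubring σ)) :
    laurentHom σ (f * g) = loudMul σ e (laurentHom σ f) (laurentHom σ g) := by
  induction f using LaurentPolynomial.induction_on' with
  | add f f' h h' => rw [add_mul, map_add, map_add, map_add, h, h', AddMonoidHom.add_apply]
  | C_mul_T i a =>
    induction g using LaurentPolynomial.induction_on' with
    | add g g' h h' => rw [mul_add, map_add, map_add, map_add, h, h']
    | C_mul_T j b =>
      rw [mul_mul_mul_comm, ← map_mul, ← LaurentPolynomial.T_add, laurentHom_C_mul_T,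
        laurentHom_C_mul_T, laurentHom_C_mul_T, loudMul_zz, Subring.coe_mul]

/-- The isomorphism of Laurent polynomials over `C^σ` with `HF^0_loud`. -/
def laurentEquiv : LaurentPolynomial (fixedSubring σ) ≃+ HF0 (loudD σ) :=
  AddEquiv.ofBijective ((laurentHom σ).codRestrict (HF0 (loudD σ)) (laurentHom_mem σ))
    ⟨fun _ _ h => laurentHom_injective σ (congrArg Subtype.val h), fun w => by
      obtain ⟨f, hf⟩ := exists_laurentHom_eq σ w.2
      exact ⟨f, Subtype.ext hf⟩⟩

theorem loudMul_mem_HF0 (e : ℝ) {w w' : CFloud C} (hw : w ∈ HF0 (loudD σ))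
    (hw' : w' ∈ HF0 (loudD σ)) : loudMul σ e w w' ∈ HF0 (loudD σ) := by
  obtain ⟨f, rfl⟩ := exists_laurentHom_eq σ hw
  obtain ⟨g, rfl⟩ := exists_laurentHom_eq σ hw'
  rw [← laurentHom_mul]
  exact laurentHom_mem σ _

end LoudFloer

end

open LoudFloer in
theorem mainTheorem5 {C : Type*} [CommRing C] (σ : C ≃+* C) :
    -- the elements `z_i · a`, `ξ_i · a` of the direct limit, which form its two graded pieces
    (∀ (s : LoudIdx) (i : ℤ) (h : |(i : ℝ)| ≤ s.1) (a : C),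
      toLoud C s (Finsupp.single (zPt s.1 i h) a) = zLoud C i a ∧
      toLoud C s (Finsupp.single (xiPt s.1 i h) a) = xiLoud C i a) ∧
    Function.Bijective (fun f : (ℤ →₀ C) × (ℤ →₀ C) =>
      (f.1.sum fun i a => zLoud C i a) + f.2.sum fun i a => xiLoud C i a) ∧
    (loudDeg C 0 : Set (CFloud C)) = Set.range (fun f : ℤ →₀ C => f.sum fun i a => zLoud C i a) ∧
    (loudDeg C 1 : Set (CFloud C)) = Set.range (fun f : ℤ →₀ C => f.sum fun i a => xiLoud C i a) ∧
    ∃ (d : CFloud C →+ CFloud C) (m : ℝ → CFloud C →+ CFloud C →+ CFloud C),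
      -- the differential exists, is unique, and is given by the formula
      (∀ d' : CFloud C →+ CFloud C, IsLoudDifferential σ d' ↔ d' = d) ∧
      (∀ (i : ℤ) (a : C), d (zLoud C i a) = xiLoud C i (σ a - a) ∧ d (xiLoud C i a) = 0) ∧
      -- the multiplication exists, is unique, and is given by the formulas
      (∀ e : ℝ, 0 < e → Irrational e →
        (∀ m' : CFloud C →+ CFloud C →+ CFloud C, IsLoudProduct σ e m' ↔ m' = m e) ∧
        (∀ (i j : ℤ) (a b : C),
          m e (zLoud C i a) (zLoud C j b) = zLoud C (i + j) (a * b) ∧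
          ((j : ℝ) / e < i →
            m e (xiLoud C i a) (zLoud C j b) = xiLoud C (i + j) (a * σ b) ∧
            m e (zLoud C i a) (xiLoud C j b) = xiLoud C (i + j) (a * b)) ∧
          ((i : ℝ) ≤ j / e →
            m e (xiLoud C i a) (zLoud C j b) = xiLoud C (i + j) (a * b) ∧
            m e (zLoud C i a) (xiLoud C j b) = xiLoud C (i + j) (σ a * b)) ∧
          m e (xiLoud C i a) (xiLoud C j b) = 0) ∧
        -- the Leibniz rule
        (∀ w w' : CFloud C, d (m e w w') = m e (d w) w' + m e w (d w')) ∧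
        -- failure of associativity
        (σ ≠ RingEquiv.refl C →
          ¬ ∀ w w' w'' : CFloud C, m e (m e w w') w'' = m e w (m e w' w'')) ∧
        -- on degree zero cohomology the product is defined and associative
        (∀ w ∈ HF0 d, ∀ w' ∈ HF0 d, m e w w' ∈ HF0 d) ∧
        (∀ w ∈ HF0 d, ∀ w' ∈ HF0 d, ∀ w'' ∈ HF0 d, m e (m e w w') w'' = m e w (m e w' w'')) ∧
        -- on total cohomology, the product is associative
        (∀ w ∈ d.ker, ∀ w' ∈ d.ker, ∀ w'' ∈ d.ker,
          m e (m e w w') w'' - m e w (m e w' w'') ∈ d.range)) ∧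
      -- dependence on `e`: distinct products, same induced product on cohomology
      (∀ e e' : ℝ, 0 < e → Irrational e → 0 < e' → Irrational e' →
        (σ ≠ RingEquiv.refl C → e ≠ e' → m e ≠ m e') ∧
        (∀ w ∈ HF0 d, ∀ w' ∈ HF0 d, m e w w' = m e' w w') ∧
        (∀ w ∈ d.ker, ∀ w' ∈ d.ker, m e w w' - m e' w w' ∈ d.range)) ∧
      -- the ring isomorphism of Laurent polynomials over `C^σ` with degree zero cohomology
      ∃ Φ : LaurentPolynomial (fixedSubring σ) ≃+ HF0 d,
        (∀ (i : ℤ) (c : fixedSubring σ),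
          (Φ (LaurentPolynomial.C c * LaurentPolynomial.T i) : CFloud C) = zLoud C i (c : C)) ∧
        ∀ e : ℝ, 0 < e → Irrational e → ∀ f g : LaurentPolynomial (fixedSubring σ),
          (Φ (f * g) : CFloud C) = m e (Φ f) (Φ g) := by
  refine ⟨fun s i h a => ⟨toLoud_zPt s h a, toLoud_xiPt s h a⟩, loud_bijective, loudDeg_zero,
    loudDeg_one, loudD σ, loudMul σ, isLoudDifferential_iff σ,
    fun i a => ⟨loudD_z σ i a, loudD_xi σ i a⟩, fun e he hirr => ⟨isLoudProduct_iff σ he hirr,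
      fun i j a b => ⟨loudMul_zz σ e i j a b, fun h => ⟨?_, ?_⟩, fun h => ⟨?_, ?_⟩,
        loudMul_xx σ e i j a b⟩,
      loudMul_leibniz σ, fun hσ => loudMul_not_assoc σ hσ he,
      fun w hw w' hw' => loudMul_mem_HF0 σ e hw hw',
      fun w hw w' hw' w'' hw'' => loudMul_assoc_of_mem_ker σ e hw.1 hw'.1 hw''.1,
      fun w hw w' hw' w'' hw'' => ?_⟩,
    fun e e' he _ he' _ => ⟨fun hσ => loudMul_ne σ hσ he he',
      fun w hw w' hw' => loudMul_eq_of_mem_ker σ e e' hw.1 hw'.1, fun w hw w' hw' => ?_⟩,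
    laurentEquiv σ, fun i c => laurentHom_C_mul_T σ i c, fun e _ _ f g => laurentHom_mul σ e f g⟩
  · rw [loudMul_xz, if_pos h]
  · rw [loudMul_zx, if_pos h]
  · rw [loudMul_xz, if_neg h.not_gt]
  · rw [loudMul_zx, if_neg h.not_gt]
  -- The associator of cocycles vanishes already on cochains, not merely modulo exact elements.
  · rw [loudMul_assoc_of_mem_ker σ e hw hw' hw'', sub_self]
    exact zero_mem _
  · rw [loudMul_eq_of_mem_ker σ e e' hw hw', sub_self]
    exact zero_mem _
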